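/- **Setting.** Let $\gamma>\alpha>\beta\ge 1$, let $0<\bar u<\infty$, and let $f\in C[0,\bar u)\cap C^2(0,\bar u)$ with $f(0)=0$ and $f>0$ on $(0,\bar u)$. Put $g=f^{1/\beta}$ and $G(u)=\int_0^u g(s)\,ds$, let $G^{-1}$ be the inverse of $G$ on $[0,\bar u)$, and assume: * (G1) $g'(u)>0$ and $g''(u)>0$ for all $u\in(0,\bar u)$; * (G2) the finite limit $q:=\lim_{u\to0^+}\frac{g'(u)^2}{g(u)g''(u)}$ exists; * (G3) if $q=1$, then $\frac{g'(u)^2}{g(u)g''(u)}\ge1$ for all small $u>0$. For $a\in[0,\bar u)$ and $r_0>0$, a solution of the problem $(P_a)$ on $[0,r_0)$ is a function $u\in C^2(0,r_0)\cap C[0,r_0)$ with $0<u(r)<\bar u$ for $0<r<r_0$ and $$r^{-(\gamma-1)}\left(r^{\alpha}|u'|^{\beta-1}u'\right)'=\frac1{f(u)}\quad\text{for }0<r<r_0,\qquad u(0)=a .$$ Problem $(P_0)$ is the singular problem; solutions with $a>0$ are called regular. Set $\theta=1+\frac{\gamma-\alpha}{\beta}$, $\tau=\beta\gamma+\alpha-\beta$,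 and $$q_c=\frac12+\frac{\theta(\beta+1)^2}{4(\sqrt\tau-\sqrt\theta)^2-2\theta(\beta+1)^2},$$ with the convention $q_c=+\infty$ if this denominator is $\le 0$. **Theorem.** One has $q\ge1$, $\theta>1$, $\tau>1$; the limit $L:=\lim_{u\to0^+}\frac{g'(u)G(u)}{g(u)^2}$ exists and lies in $(\frac12,1]$; and $A:=\theta\{\gamma-L(\gamma-\alpha+\beta)\}^{1/\beta}>0$. Moreover, for every sufficiently small $r_0>0$ the following hold. (i) The singular problem $(P_0)$ has a unique solution $u^*$ on $[0,r_0)$, and $$u^*(r)=G^{-1}\left[\frac{r^\theta}{A}(1+o(1))\right]\quad\text{as }r\to0.$$ (ii) $u^*$ is of class $C^1$ at the origin (that is, on $[0,\varepsilon)$ for some $\varepsilon>0$) if and only if $\lim_{s\to0^+}\frac{s^\theta}{G(s)}$ exists and is finite. In this case $$(u^*)'(0)=\left[\frac1A\lim_{s\to0^+}\frac{s^\theta}{G(s)}\right]^{1/\theta}.$$ In particular, $u^*$ is not of class $C^1$ at the origin if $q=1$, or if $q>1$ and $\frac{\gamma-\alpha}{\beta}<\frac{q}{q-1}$. (iii)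 For all sufficiently small $a>0$, the problem $(P_a)$ has a unique solution $u(\cdot,a)$ on $[0,r_0)$, and $u(\cdot,a)\to u^*$ in $C^2_{loc}(0,r_0)\cap C_{loc}[0,r_0)$ as $a\to0^+$. (iv) If $q<q_c$, then for each $\rho\in(0,r_0)$ the number of zeros of $u(\cdot,a)-u^*$ in $(0,\rho)$ tends to $\infty$ as $a\to0^+$. -/

import Mathlib

open Set Filter Topology

noncomputable section

namespace MEMS

/-- `g = f ^ (1 / β)`. -/
def g (f : ℝ → ℝ) (β : ℝ) (u : ℝ) : ℝ := f u ^ (1 / β)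

/-- The primitive `G(u) = ∫₀ᵘ g(s) ds`. -/
def G (f : ℝ → ℝ) (β : ℝ) (u : ℝ) : ℝ := ∫ s in (0 : ℝ)..u, g f β s

/-- The inverse of `G` restricted to `[0, ū)`, where `G` is strictly increasing; it is
meaningful on the range `G([0, ū))` only. -/
def Ginv (f : ℝ → ℝ) (β ubar : ℝ) : ℝ → ℝ := Function.invFunOn (G f β) (Ico 0 ubar)

/-- The quotient `g'(u)² / (g(u) g''(u))`. -/
def qQuot (f : ℝ → ℝ) (β : ℝ) (u : ℝ) : ℝ :=
  deriv (g f β) u ^ 2 / (g f β u * deriv (deriv (g f β)) u)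

/-- The quotient `g'(u) G(u) / g(u)²`. -/
def LQuot (f : ℝ → ℝ) (β : ℝ) (u : ℝ) : ℝ :=
  deriv (g f β) u * G f β u / g f β u ^ 2

/-- `θ = 1 + (γ - α) / β`. -/
def theta (α β γ : ℝ) : ℝ := 1 + (γ - α) / β

/-- `A = θ {γ - L (γ - α + β)} ^ (1 / β)`. -/
def A (α β γ L : ℝ) : ℝ := theta α β γ * (γ - L * (γ - α + β)) ^ (1 / β)

/-- `τ = β γ + α - β`. -/
def tau (α β γ : ℝ) : ℝ := β * γ + α - β

/-- The denominator `4 (√τ - √θ)² - 2 θ (β + 1)²` in the critical exponent. -/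
def qcDenom (α β γ : ℝ) : ℝ :=
  4 * (√(tau α β γ) - √(theta α β γ)) ^ 2 - 2 * theta α β γ * (β + 1) ^ 2

open Classical in
/-- The critical exponent `q_c = 1/2 + θ (β + 1)² / (4 (√τ - √θ)² - 2 θ (β + 1)²)`, which is `+∞`
when the denominator is not positive. With this convention `1 < q_c` is equivalent to
`α - β < 4 θ`. -/
def qc (α β γ : ℝ) : EReal :=
  if qcDenom α β γ ≤ 0 then ⊤
  else ((1 / 2 + theta α β γ * (β + 1) ^ 2 / qcDenom α β γ : ℝ) : EReal)

/-- `u ∈ C²(0, r₀) ∩ C[0, r₀)`, with values in the domain `(0, ū)` of `1 / f` on `(0, r₀)`,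
solves `r ^ (-(γ - 1)) (r ^ α |u'| ^ (β - 1) u')' = 1 / f(u)` on `(0, r₀)` with `u(0) = a`.
The singular problem is `a = 0`; for `a > 0` this is a regular solution. Nothing is asked of `u`
outside `[0, r₀)`. -/
structure IsSolution (α β γ ubar : ℝ) (f : ℝ → ℝ) (a r₀ : ℝ) (u : ℝ → ℝ) : Prop where
  contDiffOn : ContDiffOn ℝ 2 u (Ioo 0 r₀)
  continuousOn : ContinuousOn u (Ico 0 r₀)
  mem_Ioo : ∀ r ∈ Ioo 0 r₀, u r ∈ Ioo 0 ubar
  initial : u 0 = a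
  differentiableAt_flux : ∀ r ∈ Ioo 0 r₀,
    DifferentiableAt ℝ (fun s => s ^ α * |deriv u s| ^ (β - 1) * deriv u s) r
  equation : ∀ r ∈ Ioo 0 r₀,
    r ^ (-(γ - 1)) * deriv (fun s => s ^ α * |deriv u s| ^ (β - 1) * deriv u s) r = 1 / f (u r)

/-- `u` is the unique solution on `[0, r₀)` with initial value `a`. -/
def IsUniqueSolution (α β γ ubar : ℝ) (f : ℝ → ℝ) (a r₀ : ℝ) (u : ℝ → ℝ) : Prop :=
  IsSolution α β γ ubar f a r₀ u ∧
    ∀ v : ℝ → ℝ, IsSolution α β γ ubar f a r₀ v → EqOn v u (Ico 0 r₀)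

/-- `u` is of class `C¹` at the origin, that is, on some interval `[0, ε)` (with the one-sided
derivative at `0`). -/
def IsC1AtOrigin (u : ℝ → ℝ) : Prop := ∃ ε > 0, ContDiffOn ℝ 1 u (Ico 0 ε)

/-- Convergence `U(·, a) → u` in `C²_loc(0, r₀) ∩ C_loc[0, r₀)` as `a → 0⁺`. -/
def ConvergesC2Loc (r₀ : ℝ) (U : ℝ → ℝ → ℝ) (u : ℝ → ℝ) : Prop :=
  (∀ K : Set ℝ, IsCompact K → K ⊆ Ioo 0 r₀ →
    TendstoUniformlyOn U u (𝓝[>] 0) K ∧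
    TendstoUniformlyOn (fun a => deriv (U a)) (deriv u) (𝓝[>] 0) K ∧
    TendstoUniformlyOn (fun a => deriv (deriv (U a))) (deriv (deriv u)) (𝓝[>] 0) K) ∧
  (∀ K : Set ℝ, IsCompact K → K ⊆ Ico 0 r₀ → TendstoUniformlyOn U u (𝓝[>] 0) K)

/-- The zero number of `h` on `I`, with values in `ℕ ∪ {∞}`. -/
def zeroNumber (I : Set ℝ) (h : ℝ → ℝ) : ℕ∞ := {r ∈ I | h r = 0}.encard

end MEMS

end

/-! ### Lotka–Volterra trajectories: leaving the axes -/

noncomputable section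

namespace MEMS

/-! Put t = log r, let F be the flux r^α |u'|^(β-1) u', and set y = log G(u), η = dy/dt and w = r^γ
/ (f(u) F) = d(log F)/dt. The equation becomes the planar system η' = η(θ - γ/β + w/β - (1-ℓ)η), w'
= w(γ - w - βℓη), where ℓ = g'G/g² is evaluated along the solution. Since ℓ → L at the origin, this
is a slowly perturbed Lotka–Volterra system with interior equilibrium η = θ, w = w₀ := γ - Lβθ. As η
w^(1/β) = r^θ / G(u), convergence to the equilibrium is the profile G(u) ~ r^θ / A with A = θ
w₀^(1/β).

Singular and regular solutions obey the same bounds, with constants independent of the initial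
value: G(u) ≥ c r^θ (`Sol.prim_ge`), w ≤ γ (`Sol.pow_le_flux`) and, while ℓ ≤ 1, η ≤ M
(`Sol.eta_le`). They imply that a trajectory with G(a) small compared with e^(θT₀) has been away
from both axes at some time before T₀ (`Traj.exists_away`). From then on a Volterra Lyapunov
function, made strict by a cross term, brings it to the equilibrium exponentially, up to an error of
the size of |ℓ - L| (`Traj.exists_decay`).

Near the equilibrium the difference p of two functions y solves p'' + bp' + ap = 0, with a = θw₀ and
b = (1-L)θ + w₀, up to an error small relative to |p| + |p'|. The error is relative, not merely
small, because dℓ/d(log G) → 0 (`Convexlike.tendsto_ellDeriv`), so that differences of ℓ are small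
multiples of p. Hence any two solutions with small initial values approach each other
(`exists_pair`). This one estimate gives three things: with both initial values 0, where T₀ can be
taken arbitrarily early, uniqueness of the singular solution; along initial values tending to 0, a
uniform Cauchy property and so existence; with one value equal to 0, the convergence u(·,a) → u*.
Regular solutions themselves come from a contraction with a truncated source, and the a priori
bounds remove the truncation on an interval independent of a.

If q < q_c the oscillator is underdamped (`discriminant_neg`), so u(·,a) and u* cross in every
window of fixed length in log r, and the number of windows available before log ρ grows without
bound as a → 0. Regularity at the origin is read off from u' = (u/r) · η · G/(g u), where η → θ and
G/(g u) → 1 - L. -/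

/-- A Lotka–Volterra trajectory on `(-∞, T)` with slowly varying coefficient `l`. -/
structure Traj (β θ γ M T : ℝ) (y η w l : ℝ → ℝ) : Prop where
  hy : ∀ t < T, HasDerivAt y (η t) t
  hη : ∀ t < T, HasDerivAt η (η t * (θ - γ / β + w t / β - (1 - l t) * η t)) t
  hw : ∀ t < T, HasDerivAt w (w t * (γ - w t - β * l t * η t)) t
  η_pos : ∀ t < T, 0 < η t
  η_le : ∀ t < T, η t ≤ M
  w_pos : ∀ t < T, 0 < w t
  w_le : ∀ t < T, w t ≤ γ
  l_le : ∀ t < T, l t ≤ 1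
  l_nonneg : ∀ t < T, 0 ≤ l t
  rel : ∀ t < T, Real.log (w t) = -β * (y t - θ * t + Real.log (η t))

/-- Gronwall's inequality in exponential form. -/
lemma le_of_deriv_le_neg_mul_add {f f' : ℝ → ℝ} {c μ s t : ℝ} (hc : 0 < c) (hst : s ≤ t)
    (hf : ∀ x ∈ Icc s t, HasDerivAt f (f' x) x)
    (h : ∀ x ∈ Icc s t, f' x ≤ -c * f x + μ) :
    f t ≤ (f s - μ / c) * Real.exp (-c * (t - s)) + μ / c := by
  have hd : ∀ x ∈ Icc s t, HasDerivAt (fun x => (f x - μ / c) * Real.exp (c * x))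
      (f' x * Real.exp (c * x) + (f x - μ / c) * (Real.exp (c * x) * c)) x := by
    intro x hx
    have h1 : HasDerivAt (fun x => Real.exp (c * x)) (Real.exp (c * x) * c) x := by
      simpa using ((hasDerivAt_id x).const_mul c).exp
    exact ((hf x hx).sub_const _).mul h1
  have ha : AntitoneOn (fun x => (f x - μ / c) * Real.exp (c * x)) (Icc s t) := by
    apply antitoneOn_of_deriv_nonpos (convex_Icc s t)
    · exact fun x hx => (hd x hx).continuousAt.continuousWithinAt
    · exact fun x hx => (hd x (interior_subset hx)).differentiableAt.differentiableWithinAt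
    · intro x hx
      rw [(hd x (interior_subset hx)).deriv]
      have h2 := h x (interior_subset hx)
      have h3 : f' x * Real.exp (c * x) + (f x - μ / c) * (Real.exp (c * x) * c)
          = (f' x + c * f x - μ) * Real.exp (c * x) := by field_simp; ring
      rw [h3]
      exact mul_nonpos_of_nonpos_of_nonneg (by linarith) (Real.exp_pos _).le
  have h4 := ha (left_mem_Icc.2 hst) (right_mem_Icc.2 hst) hst
  simp only at h4
  have h5 : Real.exp (-c * (t - s)) = Real.exp (c * s) / Real.exp (c * t) := by
    rw [← Real.exp_sub]; congr 1; ring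
  rw [h5, ← sub_le_iff_le_add, ← mul_div_assoc, le_div_iff₀ (Real.exp_pos _)]
  exact h4

lemma antitoneOn_of_hasDerivAt_nonpos {f f' : ℝ → ℝ} {D : Set ℝ} (hD : Convex ℝ D)
    (hf : ∀ x ∈ D, HasDerivAt f (f' x) x) (h : ∀ x ∈ D, f' x ≤ 0) : AntitoneOn f D := by
  apply antitoneOn_of_deriv_nonpos hD
  · exact fun x hx => (hf x hx).continuousAt.continuousWithinAt
  · exact fun x hx => (hf x (interior_subset hx)).differentiableAt.differentiableWithinAt
  · intro x hx
    rw [(hf x (interior_subset hx)).deriv]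
    exact h x (interior_subset hx)

lemma monotoneOn_of_hasDerivAt_nonneg {f f' : ℝ → ℝ} {D : Set ℝ} (hD : Convex ℝ D)
    (hf : ∀ x ∈ D, HasDerivAt f (f' x) x) (h : ∀ x ∈ D, 0 ≤ f' x) : MonotoneOn f D := by
  apply monotoneOn_of_deriv_nonneg hD
  · exact fun x hx => (hf x hx).continuousAt.continuousWithinAt
  · exact fun x hx => (hf x (interior_subset hx)).differentiableAt.differentiableWithinAt
  · intro x hx
    rw [(hf x (interior_subset hx)).deriv]
    exact h x (interior_subset hx)

/-- A level that is crossed downwards only acts as a barrier. -/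
lemma le_of_deriv_neg_on_level {f f' : ℝ → ℝ} {C s t : ℝ} (hst : s ≤ t)
    (hf : ∀ x ∈ Icc s t, HasDerivAt f (f' x) x) (hs : f s ≤ C)
    (h : ∀ x ∈ Icc s t, f x = C → f' x < 0) : f t ≤ C := by
  have := image_le_of_deriv_right_lt_deriv_boundary (f := f) (f' := f') (a := s) (b := t)
    (B := fun _ => C) (B' := fun _ => 0)
    (fun x hx => (hf x hx).continuousAt.continuousWithinAt)
    (fun x hx => (hf x (Ico_subset_Icc_self hx)).hasDerivWithinAt) hs
    (fun x => hasDerivAt_const x C)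
    (fun x hx => h x (Ico_subset_Icc_self hx))
  exact this (right_mem_Icc.2 hst)

namespace Traj

variable {β θ γ M T : ℝ} {y η w l : ℝ → ℝ}

lemma hasDerivAt_log_η (h : Traj β θ γ M T y η w l) {t : ℝ} (ht : t < T) :
    HasDerivAt (fun t => Real.log (η t)) (θ - γ / β + w t / β - (1 - l t) * η t) t := by
  have := (h.hη t ht).log (h.η_pos t ht).ne'
  have h2 := (h.η_pos t ht).ne'
  convert this using 1
  field_simp

/-- Running backwards, the predator grows until the prey is not small. -/
lemma exists_prey_large (h : Traj β θ γ M T y η w l) (hβ : 0 < β) (hc : β * θ < γ)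
    {t₁ : ℝ} (ht : t₁ < T) :
    ∃ t ≤ t₁, (γ - β * θ) / 2 ≤ w t ∧ η t₁ ≤ η t := by
  set w₁ := (γ - β * θ) / 2 with hw₁
  set c₁ := (γ - β * θ) / (2 * β) with hc₁
  have hc₁pos : 0 < c₁ := by apply div_pos <;> linarith
  have key : ∀ t < T, w t ≤ w₁ → θ - γ / β + w t / β - (1 - l t) * η t ≤ -c₁ := by
    intro t ht hwt
    have h1 : 0 ≤ (1 - l t) * η t :=
      mul_nonneg (by linarith [h.l_le t ht]) (h.η_pos t ht).le
    have h2 : w t / β ≤ w₁ / β := by gcongr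
    have h3 : θ - γ / β + w₁ / β = -c₁ := by rw [hw₁, hc₁]; field_simp; ring
    linarith
  have anti : ∀ s ≤ t₁, (∀ x ∈ Icc s t₁, w x ≤ w₁) →
      Real.log (η t₁) + c₁ * (t₁ - s) ≤ Real.log (η s) := by
    intro s hs hx
    have := antitoneOn_of_hasDerivAt_nonpos (f := fun t => Real.log (η t) + c₁ * t)
      (f' := fun t => θ - γ / β + w t / β - (1 - l t) * η t + c₁) (convex_Icc s t₁)
      (fun x hx => (h.hasDerivAt_log_η (hx.2.trans_lt ht)).add
        (by simpa using (hasDerivAt_id x).const_mul c₁))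
      (fun x hx' => by linarith [key x (hx'.2.trans_lt ht) (hx x hx')])
    have := this (left_mem_Icc.2 hs) (right_mem_Icc.2 hs) hs
    simp only at this
    linarith
  have ex : ∃ s ≤ t₁, w₁ ≤ w s := by
    by_contra! hcon
    -- Growth of log η at rate c₁ over this length of backward time would carry it one unit above
    -- log M.
    set s := t₁ - (Real.log M - Real.log (η t₁) + 1) / c₁ with hs
    have hMlog : Real.log (η t₁) ≤ Real.log M := Real.log_le_log (h.η_pos _ ht) (h.η_le _ ht)
    have hs1 : s ≤ t₁ := by
      have : 0 ≤ (Real.log M - Real.log (η t₁) + 1) / c₁ := div_nonneg (by linarith) hc₁pos.le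
      linarith
    have h1 := anti s hs1 (fun x hx => (hcon x hx.2).le)
    have h2 : Real.log (η s) ≤ Real.log M :=
      Real.log_le_log (h.η_pos _ (hs1.trans_lt ht)) (h.η_le _ (hs1.trans_lt ht))
    have h3 : c₁ * (t₁ - s) = Real.log M - Real.log (η t₁) + 1 := by
      rw [hs]; field_simp; ring
    linarith
  obtain ⟨s, hs, hws⟩ := ex
  have hcont : ContinuousOn w (Icc s t₁) := fun x hx =>
    (h.hw x (hx.2.trans_lt ht)).continuousAt.continuousWithinAt
  -- The last time at which the prey is at least w₁: afterwards it is below w₁, so η decreases from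
  -- there to t₁.
  have hcomp : IsCompact (Icc s t₁ ∩ w ⁻¹' (Ici w₁)) :=
    isCompact_Icc.of_isClosed_subset
      (hcont.preimage_isClosed_of_isClosed isClosed_Icc isClosed_Ici) inter_subset_left
  obtain ⟨t, ⟨htI, htw⟩, htmax⟩ := hcomp.exists_isGreatest ⟨s, ⟨le_rfl, hs⟩, hws⟩
  refine ⟨t, htI.2, htw, ?_⟩
  have hlt : ∀ x ∈ Ioc t t₁, w x < w₁ := by
    intro x hx
    by_contra! hcon
    exact absurd (htmax ⟨⟨htI.1.trans hx.1.le, hx.2⟩, hcon⟩) (not_le.2 hx.1)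
  have hwt : w t ≤ w₁ ∨ t = t₁ := by
    rcases htI.2.eq_or_lt with h1 | h1
    · exact Or.inr h1
    · left
      have : Tendsto w (𝓝[>] t) (𝓝 (w t)) :=
        (h.hw t (h1.trans ht)).continuousAt.tendsto.mono_left nhdsWithin_le_nhds
      refine le_of_tendsto this ?_
      filter_upwards [Ioc_mem_nhdsGT h1] with x hx using (hlt x hx).le
  rcases hwt with hwt | rfl
  · have := anti t htI.2 (fun x hx => by
      rcases hx.1.eq_or_lt with h1 | h1
      · rw [← h1]; exact hwt
      · exact (hlt x ⟨h1, hx.2⟩).le)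
    have h2 : 0 ≤ c₁ * (t₁ - t) := mul_nonneg hc₁pos.le (by linarith [htI.2])
    exact (Real.log_le_log_iff (h.η_pos _ ht) (h.η_pos _ (htI.2.trans_lt ht))).1 (by linarith)
  · exact le_rfl

/-- A trajectory issuing from a small initial value has left the two axes at a prescribed time. -/
lemma exists_away (h : Traj β θ γ M T y η w l) (hβ : 1 ≤ β) (hθ : 0 < θ) (hc : β * θ < γ)
    {κ C v₀ T₀ : ℝ} (hκ : 0 < κ) (hκθ : κ ≤ θ / 4) (hT : T₀ < T)
    (hyC : ∀ t < T, θ * t - C ≤ y t) (hv : Tendsto (fun t => Real.exp (y t)) atBot (𝓝 v₀))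
    (hv₀ : v₀ < Real.exp (θ * T₀ - C - 2 * κ / θ)) :
    ∃ t ≤ T₀, (γ - β * θ) / 2 ≤ w t ∧ κ ≤ η t := by
  have hβ0 : 0 < β := by linarith
  -- If η < κ all the way back to -∞, then w stays close to γ, hence η' ≥ (θ/2) η, and y can vary by
  -- at most 2κ/θ before T₀. This contradicts the small limit v₀ of e^y.
  by_cases hex : ∃ t ≤ T₀, κ ≤ η t
  · obtain ⟨t₁, ht₁, hκ₁⟩ := hex
    obtain ⟨t, ht, h1, h2⟩ := h.exists_prey_large hβ0 hc (ht₁.trans_lt hT)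
    exact ⟨t, ht.trans ht₁, h1, hκ₁.trans h2⟩
  push Not at hex
  exfalso
  have hβκ : β * κ ≤ γ / 4 := by nlinarith
  have hγ : 0 < γ := by nlinarith
  set w₁ := (γ - β * θ) / 2 with hw₁
  have hw₁pos : 0 < w₁ := by rw [hw₁]; linarith
  have hle : ∀ t ≤ T₀, l t * η t ≤ κ := by
    intro t ht
    have h1 := h.l_le t (ht.trans_lt hT)
    have h2 := h.η_pos t (ht.trans_lt hT)
    nlinarith [hex t ht]
  -- the prey stays away from zero
  have hwlow : ∀ t ≤ T₀, w₁ ≤ w t := by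
    intro t ht
    obtain ⟨s, hs, hws, -⟩ := h.exists_prey_large hβ0 hc (ht.trans_lt hT)
    have := le_of_deriv_neg_on_level (f := fun x => -w x) (C := -w₁) hs
      (fun x hx => (h.hw x ((hx.2.trans ht).trans_lt hT)).neg) (by linarith)
      (fun x hx hxe => by
        have h1 := hle x (hx.2.trans ht)
        have h2 : w x = w₁ := by linarith
        have h3 : 0 < γ - w x - β * l x * η x := by
          have : β * l x * η x ≤ β * κ := by
            rw [mul_assoc]; exact mul_le_mul_of_nonneg_left h1 hβ0.le
          rw [h2, hw₁]; nlinarith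
        have h4 := h.w_pos x ((hx.2.trans ht).trans_lt hT)
        have := mul_pos h4 h3
        linarith)
    linarith
  set δ := γ - β * κ with hδ
  have hδpos : 0 < δ := by rw [hδ]; linarith
  have hwlow2 : ∀ t ≤ T₀, δ ≤ w t := by
    intro t ht
    have hwt := h.w_pos t (ht.trans_lt hT)
    -- The reciprocal makes the logistic inequality linear: (1/w)' ≤ 1 - δ/w. Letting s → -∞ removes
    -- the initial value, which is at most 1/w₁.
    have hp : ∀ s ≤ t, (w t)⁻¹ ≤ ((w s)⁻¹ - 1 / δ) * Real.exp (-δ * (t - s)) + 1 / δ := by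
      intro s hs
      refine le_of_deriv_le_neg_mul_add (f := fun x => (w x)⁻¹)
        (f' := fun x => -(w x * (γ - w x - β * l x * η x)) / w x ^ 2) hδpos hs
        (fun x hx => (h.hw x ((hx.2.trans ht).trans_lt hT)).inv
          (h.w_pos x ((hx.2.trans ht).trans_lt hT)).ne') ?_
      intro x hx
      have h1 := hle x (hx.2.trans ht)
      have h4 := h.w_pos x ((hx.2.trans ht).trans_lt hT)
      have h5 : -(w x * (γ - w x - β * l x * η x)) / w x ^ 2
          = (-γ + β * (l x * η x)) * (w x)⁻¹ + 1 := by field_simp; ring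
      rw [h5]
      have h6 : 0 < (w x)⁻¹ := inv_pos.2 h4
      have : β * (l x * η x) ≤ β * κ := mul_le_mul_of_nonneg_left h1 hβ0.le
      have h7 := mul_le_mul_of_nonneg_right this h6.le
      rw [hδ]; nlinarith
    have hlim : Tendsto (fun s => (1 / w₁) * Real.exp (-δ * (t - s)) + 1 / δ) atBot
        (𝓝 ((1 / w₁) * 0 + 1 / δ)) := by
      refine ((Real.tendsto_exp_atBot.comp ?_).const_mul _).add_const _
      have : (fun s => -δ * (t - s)) = fun s => δ * s + (-δ * t) := by ext; ring
      rw [this]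
      exact tendsto_atBot_add_const_right _ _ (tendsto_id.const_mul_atBot hδpos)
    have : (w t)⁻¹ ≤ (1 / w₁) * 0 + 1 / δ := by
      refine ge_of_tendsto hlim ?_
      filter_upwards [eventually_le_atBot t] with s hs
      refine (hp s hs).trans ?_
      gcongr
      have h1 : (w s)⁻¹ ≤ 1 / w₁ := by
        rw [one_div]; exact inv_anti₀ hw₁pos (hwlow s (hs.trans ht))
      have : 0 < 1 / δ := by positivity
      linarith
    rw [mul_zero, zero_add, one_div] at this
    exact (inv_le_inv₀ hwt hδpos).1 this
  -- hence the predator is integrable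
  have hanti : AntitoneOn (fun t => y t - 2 / θ * η t) (Iic T₀) := by
    refine antitoneOn_of_hasDerivAt_nonpos (convex_Iic T₀)
      (fun x hx => (h.hy x (lt_of_le_of_lt hx hT)).sub
        ((h.hη x (lt_of_le_of_lt hx hT)).const_mul (2 / θ))) ?_
    intro x hx
    have h1 := hwlow2 x hx
    have h2 := hex x hx
    have h3 := h.η_pos x (lt_of_le_of_lt hx hT)
    have h4 : (1 - l x) * η x ≤ κ := by
      have := h.l_nonneg x (lt_of_le_of_lt hx hT)
      nlinarith
    have h5 : δ / β ≤ w x / β := by gcongr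
    have h6 : δ / β = γ / β - κ := by rw [hδ]; field_simp
    have h7 : θ / 2 ≤ θ - γ / β + w x / β - (1 - l x) * η x := by linarith
    have h8 : 2 / θ * (η x * (θ / 2)) = η x := by field_simp
    have h9 : 2 / θ * (η x * (θ / 2)) ≤
        2 / θ * (η x * (θ - γ / β + w x / β - (1 - l x) * η x)) := by gcongr
    linarith
  have hbd : ∀ s ≤ T₀, Real.exp (θ * T₀ - C - 2 * κ / θ) ≤ Real.exp (y s) := by
    intro s hs
    have h1 := hanti (mem_Iic.2 hs) (mem_Iic.2 le_rfl) hs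
    simp only at h1
    have h2 := h.η_pos s (hs.trans_lt hT)
    have h3 := hex T₀ le_rfl
    have h4 := hyC T₀ hT
    apply Real.exp_le_exp.2
    have h5 : 2 / θ * η T₀ ≤ 2 * κ / θ := by
      rw [mul_div_right_comm]; gcongr
    have h6 : 0 < 2 / θ * η s := by positivity
    linarith
  have := ge_of_tendsto hv ((eventually_le_atBot T₀).mono hbd)
  linarith

end Traj

end MEMS

end

/-! ### The strict Lyapunov function and decay to the equilibrium -/

noncomputable section

namespace MEMS

/-- The Volterra function `x - x₀ - x₀ log (x / x₀)`. -/
def volterra (x₀ x : ℝ) : ℝ := x - x₀ - x₀ * (Real.log x - Real.log x₀)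

/-- The inequality log z ≤ z - 1 at z = √(x/x₀) gives the bound (√x - √x₀)², and (√x + √x₀)² ≤ 4B
converts it into a multiple of (x - x₀)². -/
lemma volterra_lower {x₀ x B : ℝ} (h₀ : 0 < x₀) (hx : 0 < x) (h₀B : x₀ ≤ B) (hxB : x ≤ B) :
    (x - x₀) ^ 2 / (4 * B) ≤ volterra x₀ x := by
  have hB : 0 < B := h₀.trans_le h₀B
  set p := √x with hp
  set p₀ := √x₀ with hp₀
  have hpp : 0 < p := Real.sqrt_pos.2 hx
  have hpp₀ : 0 < p₀ := Real.sqrt_pos.2 h₀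
  have e1 : x = p ^ 2 := (Real.sq_sqrt hx.le).symm
  have e2 : x₀ = p₀ ^ 2 := (Real.sq_sqrt h₀.le).symm
  have hlog : Real.log x - Real.log x₀ = 2 * Real.log (p / p₀) := by
    rw [e1, e2, Real.log_pow, Real.log_pow, Real.log_div hpp.ne' hpp₀.ne']; push_cast; ring
  have h1 : Real.log (p / p₀) ≤ p / p₀ - 1 := Real.log_le_sub_one_of_pos (by positivity)
  have h2 : x₀ * (Real.log x - Real.log x₀) ≤ 2 * p₀ * (p - p₀) := by
    rw [hlog]
    calc x₀ * (2 * Real.log (p / p₀)) ≤ x₀ * (2 * (p / p₀ - 1)) := by gcongr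
      _ = 2 * p₀ * (p - p₀) := by rw [e2]; field_simp
  have h3 : (p - p₀) ^ 2 ≤ volterra x₀ x := by
    unfold volterra
    have : (p - p₀) ^ 2 = x - x₀ - 2 * p₀ * (p - p₀) := by rw [e1, e2]; ring
    linarith
  refine le_trans ?_ h3
  rw [div_le_iff₀ (by positivity)]
  have h4 : (x - x₀) ^ 2 = (p - p₀) ^ 2 * (p + p₀) ^ 2 := by rw [e1, e2]; ring
  rw [h4]
  apply mul_le_mul_of_nonneg_left _ (sq_nonneg _)
  nlinarith [sq_nonneg (p - p₀)]

lemma volterra_upper {x₀ x : ℝ} (h₀ : 0 < x₀) (hx : 0 < x) :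
    volterra x₀ x ≤ (x - x₀) ^ 2 / x := by
  have h1 : 1 - x₀ / x ≤ Real.log x - Real.log x₀ := by
    rw [← Real.log_div hx.ne' h₀.ne']
    have := Real.one_sub_inv_le_log_of_pos (div_pos hx h₀)
    rwa [inv_div] at this
  unfold volterra
  have h2 := mul_le_mul_of_nonneg_left h1 h₀.le
  have h3 : (x - x₀) ^ 2 / x = x - x₀ - x₀ * (1 - x₀ / x) := by field_simp
  linarith

lemma sq_sub_div_le {x₀ x : ℝ} (h₀ : 0 < x₀) (hx : x₀ / 2 ≤ x) :
    (x - x₀) ^ 2 / x ≤ 2 / x₀ * (x - x₀) ^ 2 := by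
  rw [div_mul_eq_mul_div, div_le_div_iff₀ (by linarith) h₀]
  nlinarith [sq_nonneg (x - x₀)]

lemma sq_div_four_le_sq_sub {x₀ x : ℝ} (h₀ : 0 < x₀) (hx : x < x₀ / 2) :
    x₀ ^ 2 / 4 ≤ (x - x₀) ^ 2 := by
  nlinarith

/-- Here `x'` is the logarithmic derivative, the form in which Lotka–Volterra equations are given;
the singular factor 1/x then cancels. -/
lemma hasDerivAt_volterra {x₀ : ℝ} {x x' : ℝ → ℝ} {t : ℝ} (hx : HasDerivAt x (x t * x' t) t)
    (h : 0 < x t) : HasDerivAt (fun t => volterra x₀ (x t)) ((x t - x₀) * x' t) t := by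
  have := (hx.sub_const x₀).sub (((hx.log h.ne').sub_const (Real.log x₀)).const_mul x₀)
  refine this.congr_deriv ?_
  have := h.ne'
  field_simp

/-- The derivative of the strict Lyapunov function is negative up to the perturbation. -/
lemma lyapunov_deriv_le {β θ γ M L ε w η l μ : ℝ} (hβ : 1 ≤ β) (hθ : 0 < θ)
    (hL : 0 < L) (hL1 : L ≤ 1) (hw₀ : 0 < γ - L * β * θ) (hw : 0 < w) (hwγ : w ≤ γ)
    (hη : 0 < η) (hηM : η ≤ M) (hε : 0 < ε) (hεM : ε * M ≤ 1 / 4)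
    (hεC : ε * (γ + M + β * (M + θ)) ^ 2 ≤ β * L * (γ - L * β * θ) / 2)
    (hl : |l - L| ≤ μ) :
    (w - (γ - L * β * θ)) * (γ - w - β * l * η)
      + β ^ 2 * L * ((η - θ) * (θ - γ / β + w / β - (1 - l) * η))
      + ε * (w * (γ - w - β * l * η) * (η - θ)
        + (w - (γ - L * β * θ)) * (η * (θ - γ / β + w / β - (1 - l) * η)))
    ≤ -(1 / 2) * (w - (γ - L * β * θ)) ^ 2
      - ε * (β * L * (γ - L * β * θ)) / 2 * (η - θ) ^ 2
      + μ * (M * (β * γ + β ^ 2 * L * (M + θ)) + ε * (β * γ * M * (M + θ) + γ * M ^ 2)) := by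
  have hβ0 : 0 < β := by linarith
  set w₀ := γ - L * β * θ with hw₀d
  have hw₀γ : w₀ < γ := by
    have : 0 < L * β * θ := by positivity
    linarith
  obtain ⟨P, hP⟩ : ∃ P, P = w - w₀ := ⟨_, rfl⟩
  obtain ⟨N, hN⟩ : ∃ N, N = η - θ := ⟨_, rfl⟩
  obtain ⟨d, hd⟩ : ∃ d, d = l - L := ⟨_, rfl⟩
  have hM : 0 < M := hη.trans_le hηM
  have e1 : γ - w - β * l * η = -P - β * L * N - β * d * η := by
    rw [hP, hN, hd, hw₀d]; ring
  have e2 : θ - γ / β + w / β - (1 - l) * η = P / β - (1 - L) * N + d * η := by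
    rw [hP, hN, hd, hw₀d]; field_simp; ring
  rw [e1, e2, ← hP, ← hN]
  have hPγ : |P| ≤ γ := by rw [hP, abs_le]; constructor <;> linarith
  have hNB : |N| ≤ M + θ := by rw [hN, abs_le]; constructor <;> linarith
  rw [← hd] at hl
  have hμ : 0 ≤ μ := (abs_nonneg _).trans hl
  have hγ : 0 < γ := hw.trans_le hwγ
  -- The weight β²L cancels the indefinite products PN. The damping of N that remains carries the
  -- factor 1 - L and is lost when L = 1; the cross term εPN supplies -εβLw₀N² in its place.
  have e3 : P * (-P - β * L * N - β * d * η) + β ^ 2 * L * (N * (P / β - (1 - L) * N + d * η))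
      + ε * (w * (-P - β * L * N - β * d * η) * N + P * (η * (P / β - (1 - L) * N + d * η)))
      = -P ^ 2 - β ^ 2 * L * (1 - L) * N ^ 2 - ε * (β * L * w₀) * N ^ 2
        + ε * (η / β) * P ^ 2 + ε * (P * N * (-w - (1 - L) * η - β * L * N))
        + d * (η * (-β * P + β ^ 2 * L * N) + ε * (-β * w * η * N + P * η ^ 2)) := by
    have : w = w₀ + P := by rw [hP]; ring
    rw [this]; field_simp; ring
  rw [e3]
  have b1 : 0 ≤ β ^ 2 * L * (1 - L) * N ^ 2 := by
    have : 0 ≤ 1 - L := by linarith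
    positivity
  have b2 : ε * (η / β) * P ^ 2 ≤ 1 / 4 * P ^ 2 := by
    apply mul_le_mul_of_nonneg_right _ (sq_nonneg _)
    have : η / β ≤ M := (div_le_self hη.le hβ).trans hηM
    exact (mul_le_mul_of_nonneg_left this hε.le).trans hεM
  set C₁ := γ + M + β * (M + θ) with hC₁
  have b3 : ε * (P * N * (-w - (1 - L) * η - β * L * N))
      ≤ 1 / 4 * P ^ 2 + ε * (β * L * w₀) / 2 * N ^ 2 := by
    have h1 : |(-w - (1 - L) * η - β * L * N)| ≤ C₁ := by
      have a1 : (1 - L) * η ≤ M :=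
        (mul_le_of_le_one_left hη.le (by linarith)).trans hηM
      have a2 : 0 ≤ (1 - L) * η := mul_nonneg (by linarith) hη.le
      have a3 : |β * L * N| ≤ β * (M + θ) := by
        rw [abs_mul, abs_of_pos (by positivity)]
        exact mul_le_mul (mul_le_of_le_one_right hβ0.le hL1) hNB (abs_nonneg _) hβ0.le
      rw [abs_le] at a3 ⊢
      constructor <;> linarith [a3.1, a3.2]
    have h2 : P * N * (-w - (1 - L) * η - β * L * N) ≤ |P| * |N| * C₁ := by
      refine (le_abs_self _).trans ?_
      rw [abs_mul, abs_mul]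
      gcongr
    have h3 : ε * (|P| * |N| * C₁) ≤ 1 / 4 * P ^ 2 + ε ^ 2 * C₁ ^ 2 * N ^ 2 := by
      rw [← sq_abs P, ← sq_abs N]
      linarith [two_mul_le_add_sq (|P| / 2) (ε * C₁ * |N|)]
    have h4 : ε ^ 2 * C₁ ^ 2 * N ^ 2 ≤ ε * (β * L * w₀) / 2 * N ^ 2 := by
      apply mul_le_mul_of_nonneg_right _ (sq_nonneg _)
      linarith [mul_le_mul_of_nonneg_left hεC hε.le]
    linarith [mul_le_mul_of_nonneg_left h2 hε.le]
  have b4 : d * (η * (-β * P + β ^ 2 * L * N) + ε * (-β * w * η * N + P * η ^ 2))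
      ≤ μ * (M * (β * γ + β ^ 2 * L * (M + θ)) + ε * (β * γ * M * (M + θ) + γ * M ^ 2)) := by
    refine (le_abs_self _).trans ?_
    rw [abs_mul]
    apply mul_le_mul hl _ (abs_nonneg _) hμ
    have c1 : |η * (-β * P + β ^ 2 * L * N)| ≤ M * (β * γ + β ^ 2 * L * (M + θ)) := by
      rw [abs_mul, abs_of_pos hη]
      apply mul_le_mul hηM _ (abs_nonneg _) hM.le
      refine (abs_add_le _ _).trans ?_
      rw [abs_mul, abs_mul, abs_neg, abs_of_pos hβ0, abs_of_pos (a := β ^ 2 * L) (by positivity)]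
      gcongr
    have c2 : |ε * (-β * w * η * N + P * η ^ 2)| ≤ ε * (β * γ * M * (M + θ) + γ * M ^ 2) := by
      rw [abs_mul, abs_of_pos hε]
      apply mul_le_mul_of_nonneg_left _ hε.le
      refine (abs_add_le _ _).trans ?_
      rw [abs_mul, abs_mul, abs_mul, abs_mul, abs_neg, abs_of_pos hβ0, abs_of_pos hw,
        abs_of_pos hη, abs_of_nonneg (sq_nonneg η)]
      gcongr
    exact (abs_add_le _ _).trans (add_le_add c1 c2)
  linarith

/-- The trajectories that are away from the axes at some time approach the equilibrium. -/
lemma Traj.exists_decay {β θ γ M L κ : ℝ} (hβ : 1 ≤ β) (hθ : 0 < θ) (hc : β * θ < γ)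
    (hL : 0 < L) (hL1 : L ≤ 1) (hM : 0 < M) (hκ : 0 < κ) :
    ∃ C > 0, ∃ c > 0, ∃ μ₀ > 0, ∀ (T μ : ℝ) (y η w l : ℝ → ℝ), Traj β θ γ M T y η w l →
      0 ≤ μ → μ ≤ μ₀ → (∀ t < T, |l t - L| ≤ μ) →
      ∀ t₀ < T, (γ - β * θ) / 2 ≤ w t₀ → κ ≤ η t₀ → ∀ t < T, t₀ ≤ t →
        (w t - (γ - L * β * θ)) ^ 2 + (η t - θ) ^ 2 ≤ C * (Real.exp (-c * (t - t₀)) + μ) := by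
  have hβ0 : 0 < β := by linarith
  have hγ : 0 < γ := by nlinarith
  set w₀ := γ - L * β * θ with hw₀d
  have hw₀ : 0 < w₀ := by
    have : L * (β * θ) ≤ 1 * (β * θ) := mul_le_mul_of_nonneg_right hL1 (by positivity)
    rw [hw₀d]; linarith
  have hw₀γ : w₀ ≤ γ := by
    have : 0 < L * β * θ := by positivity
    linarith
  set k := β ^ 2 * L with hk
  have hkpos : 0 < k := by positivity
  set w₁ := (γ - β * θ) / 2 with hw₁
  have hw₁pos : 0 < w₁ := by rw [hw₁]; linarith
  set B := M + θ with hB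
  have hBpos : 0 < B := by positivity
  set C₁ := γ + M + β * B with hC₁
  have hC₁pos : 0 < C₁ := by positivity
  obtain ⟨c₅, hc₅, hc₅1, hc₅2⟩ : ∃ c₅ > 0, c₅ ≤ 1 / (4 * γ) ∧ c₅ ≤ k / (4 * B) :=
    ⟨min (1 / (4 * γ)) (k / (4 * B)), by positivity, min_le_left _ _, min_le_right _ _⟩
  obtain ⟨ε, hε, hεM, hεC, hεc⟩ : ∃ ε > 0, ε * M ≤ 1 / 4 ∧ ε * C₁ ^ 2 ≤ β * L * w₀ / 2 ∧
      ε ≤ c₅ := by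
    refine ⟨min (1 / 4 / M) (min (β * L * w₀ / 2 / C₁ ^ 2) c₅), by positivity, ?_, ?_, ?_⟩
    · rw [← le_div_iff₀ hM]; exact min_le_left _ _
    · rw [← le_div_iff₀ (by positivity)]; exact (min_le_right _ _).trans (min_le_left _ _)
    · exact (min_le_right _ _).trans (min_le_right _ _)
  obtain ⟨c₃, hc₃, hc₃1, hc₃2⟩ : ∃ c₃ > 0, c₃ ≤ 1 / 2 ∧ c₃ ≤ ε * (β * L * w₀) / 2 :=
    ⟨min (1 / 2) (ε * (β * L * w₀) / 2), by positivity, min_le_left _ _, min_le_right _ _⟩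
  set C₂ := M * (β * γ + k * B) + ε * (β * γ * M * B + γ * M ^ 2) with hC₂
  have hC₂pos : 0 < C₂ := by positivity
  set C₆ := 2 / w₀ + 2 * k / θ with hC₆
  have hC₆pos : 0 < C₆ := by positivity
  obtain ⟨c₆, hc₆, hc₆1, hc₆2, hc₆3⟩ : ∃ c₆ > 0, c₆ ≤ 1 / C₆ ∧ c₆ ≤ w₀ ^ 2 / 4 ∧
      c₆ ≤ θ ^ 2 / 4 :=
    ⟨min (1 / C₆) (min (w₀ ^ 2 / 4) (θ ^ 2 / 4)), by positivity, min_le_left _ _,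
      (min_le_right _ _).trans (min_le_left _ _), (min_le_right _ _).trans (min_le_right _ _)⟩
  obtain ⟨C₈, hC₈1, hC₈⟩ : ∃ C₈ : ℝ, 1 ≤ C₈ ∧ 3 / 2 * (γ ^ 2 / w₁ + k * (B ^ 2 / κ)) ≤ C₈ :=
    ⟨max 1 (3 / 2 * (γ ^ 2 / w₁ + k * (B ^ 2 / κ))), le_max_left _ _, le_max_right _ _⟩
  have hC₈pos : 0 < C₈ := by linarith
  set c := 2 * c₃ * c₆ / (3 * C₈) with hcd
  have hcpos : 0 < c := by positivity
  refine ⟨2 / c₅ * (C₈ + C₂ / c), by positivity, c, hcpos, c₃ * c₆ / (3 * C₂), by positivity, ?_⟩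
  intro T μ y η w l h hμ hμ₀ hl t₀ ht₀ hwt₀ hηt₀ t ht htt
  set V : ℝ → ℝ := fun t => volterra w₀ (w t) + k * volterra θ (η t) with hV
  set W : ℝ → ℝ := fun t => V t + ε * ((w t - w₀) * (η t - θ)) with hW
  have hP : ∀ t < T, (w t - w₀) ^ 2 ≤ γ ^ 2 := fun t ht => by
    have := h.w_pos t ht
    have := h.w_le t ht
    apply sq_le_sq'  <;> linarith
  have hN : ∀ t < T, (η t - θ) ^ 2 ≤ B ^ 2 := fun t ht => by
    have := h.η_pos t ht
    have := h.η_le t ht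
    apply sq_le_sq'  <;> linarith
  have hVlow : ∀ t < T, c₅ * ((w t - w₀) ^ 2 + (η t - θ) ^ 2) ≤ V t := by
    intro t ht
    have h1 := volterra_lower hw₀ (h.w_pos t ht) hw₀γ (h.w_le t ht)
    have h2 := volterra_lower hθ (h.η_pos t ht) (show θ ≤ B by linarith)
      (show η t ≤ B by linarith [h.η_le t ht])
    have h3 : c₅ * (w t - w₀) ^ 2 ≤ (w t - w₀) ^ 2 / (4 * γ) := by
      rw [div_eq_mul_one_div, mul_comm]; gcongr
    have h4 : c₅ * (η t - θ) ^ 2 ≤ k * ((η t - θ) ^ 2 / (4 * B)) := by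
      calc c₅ * (η t - θ) ^ 2 ≤ k / (4 * B) * (η t - θ) ^ 2 := by gcongr
        _ = _ := by ring
    have h5 := mul_le_mul_of_nonneg_left h2 hkpos.le
    simp only [hV]; linarith
  have hVup : ∀ t < T, V t ≤ (w t - w₀) ^ 2 / w t + k * ((η t - θ) ^ 2 / η t) := by
    intro t ht
    have h1 := volterra_upper hw₀ (h.w_pos t ht)
    have h2 := mul_le_mul_of_nonneg_left (volterra_upper hθ (h.η_pos t ht)) hkpos.le
    simp only [hV]; linarith
  have hcross : ∀ t < T, |ε * ((w t - w₀) * (η t - θ))| ≤ V t / 2 := by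
    intro t ht
    rw [abs_mul, abs_of_pos hε, abs_mul]
    have h1 : |w t - w₀| * |η t - θ| ≤ ((w t - w₀) ^ 2 + (η t - θ) ^ 2) / 2 := by
      rw [← sq_abs (w t - w₀), ← sq_abs (η t - θ)]
      linarith [two_mul_le_add_sq |w t - w₀| |η t - θ|]
    have h2 := hVlow t ht
    calc ε * (|w t - w₀| * |η t - θ|)
        ≤ c₅ * (((w t - w₀) ^ 2 + (η t - θ) ^ 2) / 2) := by gcongr
      _ ≤ V t / 2 := by linarith
  have hWlow : ∀ t < T, V t / 2 ≤ W t := fun t ht => by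
    have := (abs_le.1 (hcross t ht)).1
    simp only [hW]; linarith
  have hWup : ∀ t < T, W t ≤ 3 / 2 * V t := fun t ht => by
    have := (abs_le.1 (hcross t ht)).2
    simp only [hW]; linarith
  have hVnn : ∀ t < T, 0 ≤ V t := fun t ht => le_trans (by positivity) (hVlow t ht)
  -- V is unbounded near the axes while the dissipated quadratic form is not, so only min(V, 1) can
  -- be absorbed. Below half of an equilibrium coordinate the form has a constant lower bound.
  have hmin : ∀ t < T, c₆ * min (V t) 1 ≤ (w t - w₀) ^ 2 + (η t - θ) ^ 2 := by
    intro t ht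
    have hsq1 := sq_nonneg (w t - w₀)
    have hsq2 := sq_nonneg (η t - θ)
    have hwt := h.w_pos t ht
    have hηt := h.η_pos t ht
    by_cases hw2 : w t < w₀ / 2
    · have h1 : w₀ ^ 2 / 4 ≤ (w t - w₀) ^ 2 := sq_div_four_le_sq_sub hw₀ hw2
      have h2 : c₆ * min (V t) 1 ≤ c₆ * 1 := mul_le_mul_of_nonneg_left (min_le_right _ _) hc₆.le
      linarith
    by_cases hη2 : η t < θ / 2
    · have h1 : θ ^ 2 / 4 ≤ (η t - θ) ^ 2 := sq_div_four_le_sq_sub hθ hη2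
      have h2 : c₆ * min (V t) 1 ≤ c₆ * 1 := mul_le_mul_of_nonneg_left (min_le_right _ _) hc₆.le
      linarith
    push Not at hw2 hη2
    have h1 : V t ≤ C₆ * ((w t - w₀) ^ 2 + (η t - θ) ^ 2) := by
      refine (hVup t ht).trans ?_
      have a1 : (w t - w₀) ^ 2 / w t ≤ 2 / w₀ * (w t - w₀) ^ 2 :=
        sq_sub_div_le hw₀ hw2
      have a2 : (η t - θ) ^ 2 / η t ≤ 2 / θ * (η t - θ) ^ 2 :=
        sq_sub_div_le hθ hη2
      have a3 : k * ((η t - θ) ^ 2 / η t) ≤ 2 * k / θ * (η t - θ) ^ 2 := by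
        refine (mul_le_mul_of_nonneg_left a2 hkpos.le).trans (le_of_eq ?_); ring
      have a4 : 0 ≤ 2 / w₀ * (η t - θ) ^ 2 := by positivity
      have a5 : 0 ≤ 2 * k / θ * (w t - w₀) ^ 2 := by positivity
      rw [hC₆]; linarith
    have h2 : c₆ * V t ≤ (w t - w₀) ^ 2 + (η t - θ) ^ 2 := by
      calc c₆ * V t ≤ 1 / C₆ * (C₆ * ((w t - w₀) ^ 2 + (η t - θ) ^ 2)) := by
            gcongr; exact hVnn t ht
        _ = _ := by field_simp
    exact (mul_le_mul_of_nonneg_left (min_le_left _ _) hc₆.le).trans h2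
  set W' : ℝ → ℝ := fun t => (w t - w₀) * (γ - w t - β * l t * η t)
      + k * ((η t - θ) * (θ - γ / β + w t / β - (1 - l t) * η t))
      + ε * (w t * (γ - w t - β * l t * η t) * (η t - θ)
        + (w t - w₀) * (η t * (θ - γ / β + w t / β - (1 - l t) * η t))) with hW'
  have hWd : ∀ t < T, HasDerivAt W (W' t) t := by
    intro t ht
    exact ((hasDerivAt_volterra (x' := fun t => γ - w t - β * l t * η t) (h.hw t ht)
      (h.w_pos t ht)).add ((hasDerivAt_volterra
        (x' := fun t => θ - γ / β + w t / β - (1 - l t) * η t) (h.hη t ht)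
      (h.η_pos t ht)).const_mul k)).add ((((h.hw t ht).sub_const w₀).mul
        ((h.hη t ht).sub_const θ)).const_mul ε)
  have hW'le : ∀ t < T, W' t ≤ -(2 / 3 * c₃ * c₆) * min (W t) 1 + μ * C₂ := by
    intro t ht
    have h1 : W' t ≤ -(1 / 2) * (w t - w₀) ^ 2 - ε * (β * L * w₀) / 2 * (η t - θ) ^ 2 + μ * C₂ :=
      lyapunov_deriv_le hβ hθ hL hL1 hw₀ (h.w_pos t ht) (h.w_le t ht) (h.η_pos t ht)
        (h.η_le t ht) hε hεM hεC (hl t ht)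
    have h2 : c₃ * (w t - w₀) ^ 2 ≤ 1 / 2 * (w t - w₀) ^ 2 := by gcongr
    have h3 : c₃ * (η t - θ) ^ 2 ≤ ε * (β * L * w₀) / 2 * (η t - θ) ^ 2 := by gcongr
    have h4 : 2 / 3 * min (W t) 1 ≤ min (V t) 1 := by
      have := hWup t ht
      have := hVnn t ht
      apply le_min
      · have := min_le_left (W t) 1
        linarith
      · have := min_le_right (W t) 1
        linarith
    have h5 : c₃ * (c₆ * (2 / 3 * min (W t) 1)) ≤ c₃ * (c₆ * min (V t) 1) := by gcongr
    have h6 := mul_le_mul_of_nonneg_left (hmin t ht) hc₃.le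
    linarith
  have hWt₀ : W t₀ ≤ C₈ := by
    refine (hWup t₀ ht₀).trans (le_trans ?_ hC₈)
    have := hVup t₀ ht₀
    have a1 : (w t₀ - w₀) ^ 2 / w t₀ ≤ γ ^ 2 / w₁ :=
      div_le_div₀ (by positivity) (hP t₀ ht₀) hw₁pos hwt₀
    have a2 : k * ((η t₀ - θ) ^ 2 / η t₀) ≤ k * (B ^ 2 / κ) :=
      mul_le_mul_of_nonneg_left (div_le_div₀ (by positivity) (hN t₀ ht₀) hκ hηt₀) hkpos.le
    linarith
  have hμC : μ * C₂ ≤ c₃ * c₆ / 3 := by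
    calc μ * C₂ ≤ c₃ * c₆ / (3 * C₂) * C₂ := by gcongr
      _ = _ := by field_simp
  -- At the level C₈ ≥ 1 the dissipation is at least (2/3)c₃c₆, while the choice of μ₀ keeps the
  -- perturbation below half of that.
  have hWC : ∀ s < T, t₀ ≤ s → W s ≤ C₈ := by
    intro s hs hts
    refine le_of_deriv_neg_on_level hts (fun x hx => hWd x (hx.2.trans_lt hs)) hWt₀ ?_
    intro x hx hxe
    have h1 := hW'le x (hx.2.trans_lt hs)
    rw [hxe, min_eq_right hC₈1] at h1
    have : 0 < c₃ * c₆ := by positivity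
    linarith
  -- Once W ≤ C₈ is known, min(W, 1) ≥ W / C₈ turns the truncated inequality into a linear one.
  have hfin := le_of_deriv_le_neg_mul_add (f := W) (f' := W') (c := c) (μ := μ * C₂) hcpos htt
    (fun x hx => hWd x (hx.2.trans_lt ht)) (by
      intro x hx
      have h1 := hW'le x (hx.2.trans_lt ht)
      have h2 := hWC x (hx.2.trans_lt ht) hx.1
      have h3 : 0 ≤ W x := (by linarith [hVnn x (hx.2.trans_lt ht)] : 0 ≤ V x / 2).trans
        (hWlow x (hx.2.trans_lt ht))
      have h4 : W x / C₈ ≤ min (W x) 1 := by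
        apply le_min
        · exact div_le_self h3 hC₈1
        · rw [div_le_one hC₈pos]; exact h2
      have h5 : c * W x = 2 / 3 * c₃ * c₆ * (W x / C₈) := by rw [hcd]; field_simp
      have h6 : 2 / 3 * c₃ * c₆ * (W x / C₈) ≤ 2 / 3 * c₃ * c₆ * min (W x) 1 := by gcongr
      linarith)
  have hexp := Real.exp_pos (-c * (t - t₀))
  have h1 : W t ≤ C₈ * Real.exp (-c * (t - t₀)) + μ * C₂ / c := by
    have : 0 ≤ μ * C₂ / c * Real.exp (-c * (t - t₀)) := by positivity
    have := mul_le_mul_of_nonneg_right hWt₀ hexp.le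
    linarith
  have h2 : c₅ / 2 * ((w t - w₀) ^ 2 + (η t - θ) ^ 2) ≤ W t := by
    linarith [hVlow t ht, hWlow t ht]
  have h3 : (w t - w₀) ^ 2 + (η t - θ) ^ 2 ≤ 2 / c₅ * W t := by
    calc (w t - w₀) ^ 2 + (η t - θ) ^ 2
        = 2 / c₅ * (c₅ / 2 * ((w t - w₀) ^ 2 + (η t - θ) ^ 2)) := by field_simp
      _ ≤ _ := by gcongr
  refine h3.trans ?_
  rw [mul_assoc]
  apply mul_le_mul_of_nonneg_left _ (by positivity)
  have h4 : 0 ≤ C₂ / c * Real.exp (-c * (t - t₀)) := by positivity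
  have h5 : 0 ≤ C₈ * μ := by positivity
  linarith [show μ * C₂ / c = C₂ / c * μ by ring,
    show (C₈ + C₂ / c) * (Real.exp (-c * (t - t₀)) + μ) = C₈ * Real.exp (-c * (t - t₀))
      + C₂ / c * Real.exp (-c * (t - t₀)) + C₈ * μ + C₂ / c * μ by ring]

end MEMS

end

/-! ### Perturbed damped oscillators and differences of trajectories -/

noncomputable section

namespace MEMS

/-- Solutions of a small perturbation of the damped oscillator `p'' + b p' + a p = 0` decay. -/
lemma exists_oscillator_decay {a b : ℝ} (ha : 0 < a) (hb : 0 < b) :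
    ∃ ε > 0, ∃ c > 0, ∃ C > 0, ∀ (p s s' : ℝ → ℝ) (t₀ t : ℝ), t₀ ≤ t →
      (∀ x ∈ Icc t₀ t, HasDerivAt p (s x) x) → (∀ x ∈ Icc t₀ t, HasDerivAt s (s' x) x) →
      (∀ x ∈ Icc t₀ t, |s' x + a * p x + b * s x| ≤ ε * (|p x| + |s x|)) →
      p t ^ 2 + s t ^ 2 ≤ C * (p t₀ ^ 2 + s t₀ ^ 2) * Real.exp (-c * (t - t₀)) := by
  obtain ⟨m, hm, hm1, hm2⟩ : ∃ m > 0, m ≤ b ∧ m ≤ a * b :=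
    ⟨min b (a * b), by positivity, min_le_left _ _, min_le_right _ _⟩
  obtain ⟨k, hk, hk1, hk2⟩ : ∃ k > 0, k ≤ a ∧ k ≤ 1 / 2 :=
    ⟨min a (1 / 2), by positivity, min_le_left _ _, min_le_right _ _⟩
  set K := a + b ^ 2 / 2 + 1 + b with hK
  have hKpos : 0 < K := by positivity
  set ε := m / (4 * (2 + b)) with hε
  set c := m / (2 * K) with hc
  have hcpos : 0 < c := by positivity
  refine ⟨ε, by positivity, c, hcpos, K / k, by positivity, ?_⟩
  intro p s s' t₀ t ht hp hs hbd
  -- The mixed term b p s makes the energy strict: E' = -b s² - ab p² plus the perturbation, whereas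
  -- the plain energy dissipates only through s.
  set E : ℝ → ℝ := fun x => (a + b ^ 2 / 2) * p x ^ 2 + s x ^ 2 + b * (p x * s x) with hE
  have hEup : ∀ x, E x ≤ K * (p x ^ 2 + s x ^ 2) := fun x => by
    have h1 : p x * s x ≤ p x ^ 2 + s x ^ 2 := by nlinarith [sq_nonneg (p x - s x)]
    have h2 := mul_le_mul_of_nonneg_left h1 hb.le
    have h3 : 0 ≤ (a + b ^ 2 / 2) * s x ^ 2 := by positivity
    have h4 := sq_nonneg (p x)
    simp only [hE, hK]; linarith
  have hElow : ∀ x, k * (p x ^ 2 + s x ^ 2) ≤ E x := fun x => by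
    have h1 : a * p x ^ 2 + 1 / 2 * s x ^ 2 ≤ E x := by
      have : E x = a * p x ^ 2 + 1 / 2 * s x ^ 2 + 1 / 2 * (b * p x + s x) ^ 2 := by
        simp only [hE]; ring
      rw [this]; linarith [sq_nonneg (b * p x + s x)]
    have h2 : k * p x ^ 2 ≤ a * p x ^ 2 := by gcongr
    have h3 : k * s x ^ 2 ≤ 1 / 2 * s x ^ 2 := by gcongr
    linarith
  set E' : ℝ → ℝ := fun x => (a + b ^ 2 / 2) * (2 * p x * s x) + 2 * s x * s' x
    + b * (s x * s x + p x * s' x) with hE'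
  have hEd : ∀ x ∈ Icc t₀ t, HasDerivAt E (E' x) x := fun x hx => by
    have h1 : HasDerivAt (fun x => p x ^ 2) (2 * p x * s x) x := by
      simpa using (hp x hx).fun_pow 2
    have h2 : HasDerivAt (fun x => s x ^ 2) (2 * s x * s' x) x := by
      simpa using (hs x hx).fun_pow 2
    exact ((h1.const_mul _).add h2).add (((hp x hx).mul (hs x hx)).const_mul b)
  have hE'le : ∀ x ∈ Icc t₀ t, E' x ≤ -c * E x + 0 := fun x hx => by
    obtain ⟨e, he⟩ : ∃ e, e = s' x + a * p x + b * s x := ⟨_, rfl⟩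
    have h1 := hbd x hx
    rw [← he] at h1
    have h2 : E' x = -b * s x ^ 2 - a * b * p x ^ 2 + (2 * s x + b * p x) * e := by
      simp only [hE', he]; ring
    have h3 : (2 * s x + b * p x) * e ≤ m / 2 * (p x ^ 2 + s x ^ 2) := by
      calc (2 * s x + b * p x) * e ≤ |2 * s x + b * p x| * |e| := by
            rw [← abs_mul]; exact le_abs_self _
        _ ≤ ((2 + b) * (|p x| + |s x|)) * (ε * (|p x| + |s x|)) := by
            gcongr
            refine (abs_add_le _ _).trans ?_
            rw [abs_mul, abs_mul, abs_of_pos hb, abs_of_pos (two_pos)]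
            nlinarith [abs_nonneg (p x), abs_nonneg (s x)]
        _ = m / 4 * (|p x| + |s x|) ^ 2 := by rw [hε]; field_simp
        _ ≤ m / 4 * (2 * (|p x| ^ 2 + |s x| ^ 2)) := by gcongr; exact add_sq_le
        _ = _ := by rw [sq_abs, sq_abs]; ring
    have h4 : m * s x ^ 2 ≤ b * s x ^ 2 := by gcongr
    have h5 : m * p x ^ 2 ≤ a * b * p x ^ 2 := by gcongr
    have h6 : c * E x ≤ m / 2 * (p x ^ 2 + s x ^ 2) := by
      calc c * E x ≤ c * (K * (p x ^ 2 + s x ^ 2)) := by gcongr; exact hEup x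
        _ = _ := by rw [hc]; field_simp
    linarith
  have hfin := le_of_deriv_le_neg_mul_add hcpos ht hEd hE'le
  simp only [zero_div, sub_zero, add_zero] at hfin
  have h1 : k * (p t ^ 2 + s t ^ 2) ≤ K * (p t₀ ^ 2 + s t₀ ^ 2) * Real.exp (-c * (t - t₀)) :=
    (hElow t).trans (hfin.trans (mul_le_mul_of_nonneg_right (hEup t₀) (Real.exp_pos _).le))
  calc p t ^ 2 + s t ^ 2 = (k * (p t ^ 2 + s t ^ 2)) / k := by field_simp
    _ ≤ (K * (p t₀ ^ 2 + s t₀ ^ 2) * Real.exp (-c * (t - t₀))) / k := by gcongr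
    _ = _ := by ring

/-- In the oscillatory case, solutions of a small perturbation of `p'' + b p' + a p = 0` vanish
somewhere in every interval of a fixed length. -/
lemma exists_oscillator_zero {a b : ℝ} (ha : 0 < a) (hab : b ^ 2 < 4 * a) :
    ∃ ε > 0, ∃ τ > 0, ∀ (p s s' : ℝ → ℝ) (t₀ : ℝ),
      (∀ x ∈ Icc t₀ (t₀ + τ), HasDerivAt p (s x) x) →
      (∀ x ∈ Icc t₀ (t₀ + τ), HasDerivAt s (s' x) x) →
      (∀ x ∈ Icc t₀ (t₀ + τ), |s' x + a * p x + b * s x| ≤ ε * (|p x| + |s x|)) →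
      ∃ x ∈ Icc t₀ (t₀ + τ), p x = 0 := by
  -- With this m one has 4(1-2m)(a-2m) = b² + 16m², so κ² + bκ + a dominates 2m(1 + κ²).
  set m := (4 * a - b ^ 2) / (8 * (1 + a)) with hm
  have hmpos : 0 < m := div_pos (by linarith) (by linarith)
  have hm8 : m * (8 * (1 + a)) = 4 * a - b ^ 2 := by rw [hm]; field_simp
  have hm1 : 2 * m < 1 := by nlinarith [sq_nonneg b]
  have hquad : ∀ κ : ℝ, 2 * m * (1 + κ ^ 2) ≤ κ ^ 2 + b * κ + a := by
    intro κ
    have h1 : b ^ 2 ≤ 4 * (1 - 2 * m) * (a - 2 * m) := by nlinarith [sq_nonneg m]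
    have h2 : 0 ≤ 4 * (1 - 2 * m) * ((1 - 2 * m) * κ ^ 2 + b * κ + (a - 2 * m)) := by
      nlinarith [sq_nonneg (2 * (1 - 2 * m) * κ + b)]
    have h3 := nonneg_of_mul_nonneg_right h2 (by linarith : 0 < 4 * (1 - 2 * m))
    linarith
  refine ⟨m / 2, by positivity, Real.pi / m, by positivity, ?_⟩
  intro p s s' t₀ hp hs hbd
  by_contra! hne
  have hτ : 0 < Real.pi / m := by positivity
  -- While p does not vanish, the angle arctan(p'/p) decreases at rate at least m, hence by at least
  -- π over a length π/m; but it takes values in an open interval of length π.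
  have hd : ∀ x ∈ Icc t₀ (t₀ + Real.pi / m), HasDerivAt (fun x => Real.arctan (s x / p x) + m * x)
      (1 / (1 + (s x / p x) ^ 2) * ((s' x * p x - s x * s x) / p x ^ 2) + m) x := fun x hx =>
    ((hs x hx).div (hp x hx) (hne x hx)).arctan.add
      (by simpa using (hasDerivAt_id x).const_mul m)
  have hanti := antitoneOn_of_hasDerivAt_nonpos (convex_Icc _ _) hd (by
    intro x hx
    obtain ⟨κ, hκ⟩ : ∃ κ, κ = s x / p x := ⟨_, rfl⟩
    obtain ⟨e, he⟩ : ∃ e, e = (s' x + a * p x + b * s x) / p x := ⟨_, rfl⟩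
    have hpx := hne x hx
    have h1 : (s' x * p x - s x * s x) / p x ^ 2 = -(κ ^ 2 + b * κ + a) + e := by
      rw [hκ, he]; field_simp; ring
    have h2 : |e| ≤ m / 2 * (1 + |κ|) := by
      rw [he, hκ, abs_div, abs_div, div_le_iff₀ (abs_pos.2 hpx)]
      refine (hbd x hx).trans (le_of_eq ?_)
      have := abs_pos.2 hpx
      field_simp
    have h3 : 1 + |κ| ≤ 2 * (1 + κ ^ 2) := by
      rw [← sq_abs κ]; nlinarith [sq_nonneg (|κ| - 1), sq_nonneg |κ|]
    have h4 : e ≤ m * (1 + κ ^ 2) := by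
      have := le_abs_self e
      nlinarith
    have h5 := hquad κ
    rw [← hκ, h1]
    have h6 : 0 < 1 + κ ^ 2 := by positivity
    have h7 : 1 / (1 + κ ^ 2) * (-(κ ^ 2 + b * κ + a) + e) ≤ -m := by
      rw [one_div_mul_eq_div, div_le_iff₀ h6]; linarith
    linarith)
  have h1 := hanti (left_mem_Icc.2 (by linarith)) (right_mem_Icc.2 (by linarith)) (by linarith)
  simp only at h1
  have h2 := Real.arctan_lt_pi_div_two (s t₀ / p t₀)
  have h3 := Real.neg_pi_div_two_lt_arctan (s (t₀ + Real.pi / m) / p (t₀ + Real.pi / m))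
  have h4 : m * (t₀ + Real.pi / m) = m * t₀ + Real.pi := by field_simp
  linarith

/-- The right-hand side of the limiting second-order equation, as a function of `X` and `η`. -/
def limitField (β θ γ L : ℝ) (q : ℝ × ℝ) : ℝ :=
  q.2 * (θ - γ / β + Real.exp (-β * (q.1 + Real.log q.2)) / β - (1 - L) * q.2)

/-- Strict differentiability compares two arbitrary points near the equilibrium, so the
linearization applies to the difference of two trajectories with an error relative to that
difference. The coefficients are -a and -b of the oscillator. -/
lemma hasStrictFDerivAt_limitField {β θ γ L : ℝ} (hβ : 0 < β) (hθ : 0 < θ)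
    (hw₀ : 0 < γ - L * β * θ) :
    HasStrictFDerivAt (limitField β θ γ L)
      (-(θ * (γ - L * β * θ)) • ContinuousLinearMap.fst ℝ ℝ ℝ
        - ((1 - L) * θ + (γ - L * β * θ)) • ContinuousLinearMap.snd ℝ ℝ ℝ)
      (-(Real.log (γ - L * β * θ) / β) - Real.log θ, θ) := by
  obtain ⟨X₀, hX₀⟩ : ∃ X₀, X₀ = -(Real.log (γ - L * β * θ) / β) - Real.log θ := ⟨_, rfl⟩
  rw [← hX₀]
  obtain ⟨q₀, hq₀⟩ : ∃ q₀ : ℝ × ℝ, q₀ = (X₀, θ) := ⟨_, rfl⟩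
  rw [← hq₀]
  have h1 : HasStrictFDerivAt (fun q : ℝ × ℝ => q.1) (ContinuousLinearMap.fst ℝ ℝ ℝ) q₀ :=
    hasStrictFDerivAt_fst
  have h2 : HasStrictFDerivAt (fun q : ℝ × ℝ => q.2) (ContinuousLinearMap.snd ℝ ℝ ℝ) q₀ :=
    hasStrictFDerivAt_snd
  have h3 := ((h1.add (h2.log (show q₀.2 ≠ 0 by rw [hq₀]; exact hθ.ne'))).const_mul (-β)).exp
  have h4 := ((h3.mul_const (1 / β)).const_add (θ - γ / β)).sub (h2.const_mul (1 - L))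
  have h5 := h2.mul h4
  have he : Real.exp (-(β * (X₀ + Real.log θ))) = γ - L * β * θ := by
    have : -(β * (X₀ + Real.log θ)) = Real.log (γ - L * β * θ) := by
      rw [hX₀]; field_simp; ring
    rw [this, Real.exp_log hw₀]
  have heq : (fun q : ℝ × ℝ => q.2 * (θ - γ / β + Real.exp (-β * (q.1 + Real.log q.2)) * (1 / β)
      - (1 - L) * q.2)) = limitField β θ γ L := by
    funext q
    simp only [limitField, div_eq_mul_one_div (Real.exp _) β]
  have h6 := h5.congr_of_eventuallyEq (Eventually.of_forall (congrFun heq))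
  refine h6.congr_fderiv ?_
  ext
  · simp [hq₀]
    rw [he]
    left
    field_simp
  · simp [hq₀]
    rw [he]
    field_simp
    ring

/-- The relation between log w, y and log η recovers y - θt continuously from (w, η), so closeness
in those coordinates passes to the coordinates of `limitField`. -/
lemma exists_dist_lt {β θ γ M L : ℝ} (hβ : 0 < β) (hθ : 0 < θ)
    (hw₀ : 0 < γ - L * β * θ) {r : ℝ} (hr : 0 < r) :
    ∃ δ > 0, ∀ (T : ℝ) (y η w l : ℝ → ℝ), Traj β θ γ M T y η w l → ∀ t < T,
      (w t - (γ - L * β * θ)) ^ 2 + (η t - θ) ^ 2 ≤ δ →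
      dist ((y t - θ * t, η t) : ℝ × ℝ)
        (-(Real.log (γ - L * β * θ) / β) - Real.log θ, θ) < r := by
  set w₀ := γ - L * β * θ with hw₀d
  have hcont : ContinuousAt (fun q : ℝ × ℝ => ((-(Real.log q.1 / β) - Real.log q.2, q.2) : ℝ × ℝ))
      (w₀, θ) := by
    have e1 : ContinuousAt (fun q : ℝ × ℝ => Real.log q.1) (w₀, θ) :=
      continuousAt_fst.log hw₀.ne'
    have e2 : ContinuousAt (fun q : ℝ × ℝ => Real.log q.2) (w₀, θ) :=
      continuousAt_snd.log hθ.ne'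
    exact ((e1.div_const β).neg.sub e2).prodMk continuousAt_snd
  obtain ⟨d, hd, hdball⟩ := Metric.continuousAt_iff.1 hcont r hr
  refine ⟨(d / 2) ^ 2, by positivity, ?_⟩
  intro T y η w l h t ht hD
  have hX : y t - θ * t = -(Real.log (w t) / β) - Real.log (η t) := by
    rw [h.rel t ht]; field_simp; ring
  rw [hX]
  refine hdball (x := (w t, η t)) ?_
  have a1 : |w t - w₀| ≤ d / 2 := abs_le_of_sq_le_sq (by nlinarith [sq_nonneg (η t - θ)])
    (by positivity)
  have a2 : |η t - θ| ≤ d / 2 := abs_le_of_sq_le_sq (by nlinarith [sq_nonneg (w t - w₀)])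
    (by positivity)
  rw [Prod.dist_eq]
  simp only [Real.dist_eq]
  exact max_lt (by linarith) (by linarith)

/-- The difference of two trajectories near the equilibrium obeys a perturbed damped oscillator
equation. -/
lemma exists_oscillator_of_near {β θ γ M L : ℝ} (hβ : 0 < β) (hθ : 0 < θ) (hM : 0 < M)
    (hw₀ : 0 < γ - L * β * θ) {ε : ℝ} (hε : 0 < ε) :
    ∃ δ > 0, ∃ μ > 0, ∀ (T : ℝ) (y₁ η₁ w₁ l₁ y₂ η₂ w₂ l₂ : ℝ → ℝ),
      Traj β θ γ M T y₁ η₁ w₁ l₁ → Traj β θ γ M T y₂ η₂ w₂ l₂ → ∀ t < T,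
      |l₂ t - L| ≤ μ → |l₁ t - l₂ t| ≤ μ * |y₁ t - y₂ t| →
      (w₁ t - (γ - L * β * θ)) ^ 2 + (η₁ t - θ) ^ 2 ≤ δ →
      (w₂ t - (γ - L * β * θ)) ^ 2 + (η₂ t - θ) ^ 2 ≤ δ →
      |(η₁ t * (θ - γ / β + w₁ t / β - (1 - l₁ t) * η₁ t)
        - η₂ t * (θ - γ / β + w₂ t / β - (1 - l₂ t) * η₂ t))
        + θ * (γ - L * β * θ) * (y₁ t - y₂ t)
        + ((1 - L) * θ + (γ - L * β * θ)) * (η₁ t - η₂ t)|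
      ≤ ε * (|y₁ t - y₂ t| + |η₁ t - η₂ t|) := by
  set w₀ := γ - L * β * θ with hw₀d
  set X₀ := -(Real.log w₀ / β) - Real.log θ with hX₀
  have hstrict := (hasStrictFDerivAt_limitField (L := L) (γ := γ) hβ hθ hw₀).isLittleO
  have hbd := hstrict.def (half_pos hε)
  obtain ⟨r, hr, hball⟩ := Metric.eventually_nhds_iff_ball.1 hbd
  obtain ⟨d, hd, hdball⟩ := exists_dist_lt (M := M) hβ hθ hw₀ hr
  refine ⟨d, hd, min (ε / (2 * M ^ 2)) (ε / (4 * M)), by positivity, ?_⟩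
  intro T y₁ η₁ w₁ l₁ y₂ η₂ w₂ l₂ h₁ h₂ t ht hl₂ hl hD₁ hD₂
  have hexp : ∀ {y η w l : ℝ → ℝ}, Traj β θ γ M T y η w l →
      Real.exp (-β * (y t - θ * t + Real.log (η t))) = w t := fun h => by
    rw [← h.rel t ht, Real.exp_log (h.w_pos t ht)]
  have hmain := hball (((y₁ t - θ * t, η₁ t), (y₂ t - θ * t, η₂ t)) : (ℝ × ℝ) × (ℝ × ℝ)) (by
    rw [Metric.mem_ball, Prod.dist_eq]
    exact max_lt (hdball T _ _ _ _ h₁ t ht hD₁) (hdball T _ _ _ _ h₂ t ht hD₂))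
  simp only [limitField, hexp h₁, hexp h₂, Prod.mk_sub_mk, Prod.norm_mk, Real.norm_eq_abs,
    sub_apply, smul_apply, ContinuousLinearMap.coe_fst',
    ContinuousLinearMap.coe_snd', smul_eq_mul] at hmain
  obtain ⟨p, hp⟩ : ∃ p, p = y₁ t - y₂ t := ⟨_, rfl⟩
  obtain ⟨s, hs⟩ : ∃ s, s = η₁ t - η₂ t := ⟨_, rfl⟩
  have hp' : y₁ t - θ * t - (y₂ t - θ * t) = p := by rw [hp]; ring
  rw [hp', ← hs] at hmain
  rw [← hp, ← hs]
  rw [← hp] at hl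
  have hmax : max |p| |s| ≤ |p| + |s| :=
    max_le (by linarith [abs_nonneg s]) (by linarith [abs_nonneg p])
  -- The contribution of the varying coefficients, (l₁ - L)η₁² - (l₂ - L)η₂², is split so that one
  -- term is bounded by a multiple of |p| and the other carries the factor s.
  have e3 : |(l₁ t - l₂ t) * η₁ t ^ 2 + (l₂ t - L) * (s * (η₁ t + η₂ t))|
      ≤ ε / 2 * (|p| + |s|) := by
    have i1 := h₁.η_pos t ht
    have i2 := h₂.η_pos t ht
    have i3 := h₁.η_le t ht
    have i4 := h₂.η_le t ht
    refine (abs_add_le _ _).trans ?_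
    rw [abs_mul, abs_mul, abs_mul, abs_of_pos (pow_pos i1 2), abs_of_pos (add_pos i1 i2)]
    have b1 : |l₁ t - l₂ t| * η₁ t ^ 2 ≤ (ε / (2 * M ^ 2) * |p|) * M ^ 2 := by
      gcongr
      exact hl.trans (mul_le_mul_of_nonneg_right (min_le_left _ _) (abs_nonneg _))
    have b2 : |l₂ t - L| * (|s| * (η₁ t + η₂ t)) ≤ ε / (4 * M) * (|s| * (M + M)) := by
      gcongr
      exact hl₂.trans (min_le_right _ _)
    have b3 : (ε / (2 * M ^ 2) * |p|) * M ^ 2 = ε / 2 * |p| := by field_simp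
    have b4 : ε / (4 * M) * (|s| * (M + M)) = ε / 2 * |s| := by field_simp; ring
    linarith
  have e4 := (hmain.trans (mul_le_mul_of_nonneg_left hmax (half_pos hε).le))
  have e5 := add_le_add e4 e3
  refine le_trans (le_trans (le_of_eq ?_) (abs_add_le _ _)) (e5.trans (le_of_eq (by ring)))
  congr 1
  rw [hs]; ring

end MEMS

end

/-! ### Uniform estimates for one and for two trajectories -/

noncomputable section

namespace MEMS

/-- Trajectories with small initial value approach the equilibrium, uniformly. -/
lemma exists_approach {β θ γ M L : ℝ} (C₀ : ℝ) (hβ : 1 ≤ β) (hθ : 0 < θ) (hc : β * θ < γ)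
    (hL : 0 < L) (hL1 : L ≤ 1) (hM : 0 < M) :
    ∃ K : ℝ, ∃ C > 0, ∃ c > 0, ∃ μ₀ > 0, ∀ (T μ v₀ : ℝ) (y η w l : ℝ → ℝ),
      Traj β θ γ M T y η w l →
      0 ≤ μ → μ ≤ μ₀ → (∀ t < T, |l t - L| ≤ μ) → (∀ t < T, θ * t - C₀ ≤ y t) →
      Tendsto (fun t => Real.exp (y t)) atBot (𝓝 v₀) →
      ∀ T₀ < T, v₀ < Real.exp (θ * T₀ - K) → ∀ t < T, T₀ ≤ t →
        (w t - (γ - L * β * θ)) ^ 2 + (η t - θ) ^ 2 ≤ C * (Real.exp (-c * (t - T₀)) + μ) := by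
  have hκ : 0 < θ / 4 := by positivity
  obtain ⟨C, hC, c, hcpos, μ₀, hμ₀, H⟩ := Traj.exists_decay (κ := θ / 4) hβ hθ hc hL hL1 hM hκ
  -- The loss in `Traj.exists_away` for κ = θ/4, the largest value allowed there.
  refine ⟨C₀ + 2 * (θ / 4) / θ, C, hC, c, hcpos, μ₀, hμ₀, ?_⟩
  intro T μ v₀ y η w l h hμ hμ₀' hl hy hv T₀ hT₀ hv₀ t ht hTt
  obtain ⟨t₀, ht₀, hw, hη⟩ := h.exists_away hβ hθ hc hκ le_rfl hT₀ hy hv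
    (by rwa [sub_sub])
  refine (H T μ y η w l h hμ hμ₀' hl t₀ (ht₀.trans_lt hT₀) hw hη t ht (ht₀.trans hTt)).trans ?_
  gcongr C * (?_ + _)
  apply Real.exp_le_exp.2
  nlinarith

lemma exists_exp_le {c δ : ℝ} (hc : 0 < c) (hδ : 0 < δ) :
    ∃ T > 0, ∀ t, T ≤ t → Real.exp (-c * t) ≤ δ := by
  refine ⟨max 1 (-Real.log δ / c), by positivity, fun t ht => ?_⟩
  rw [← Real.le_log_iff_exp_le hδ] at *
  have := (le_max_right 1 (-Real.log δ / c)).trans ht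
  rw [div_le_iff₀ hc] at this
  linarith

/-- Two trajectories with small initial values approach each other exponentially; in the
oscillatory case they cross in every interval of a fixed length. -/
lemma exists_pair {β θ γ M L : ℝ} (C₀ : ℝ) (hβ : 1 ≤ β) (hθ : 0 < θ) (hc : β * θ < γ)
    (hL : 0 < L) (hL1 : L ≤ 1) (hM : 0 < M) :
    ∃ K : ℝ, ∃ C > 0, ∃ c > 0, ∃ μ > 0, ∃ T₁ > 0, ∃ τ > 0, ∀ (T v₁ v₂ : ℝ)
      (y₁ η₁ w₁ l₁ y₂ η₂ w₂ l₂ : ℝ → ℝ),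
      Traj β θ γ M T y₁ η₁ w₁ l₁ → Traj β θ γ M T y₂ η₂ w₂ l₂ →
      (∀ t < T, |l₁ t - L| ≤ μ) → (∀ t < T, |l₂ t - L| ≤ μ) →
      (∀ t < T, |l₁ t - l₂ t| ≤ μ * |y₁ t - y₂ t|) →
      (∀ t < T, θ * t - C₀ ≤ y₁ t) → (∀ t < T, θ * t - C₀ ≤ y₂ t) →
      Tendsto (fun t => Real.exp (y₁ t)) atBot (𝓝 v₁) →
      Tendsto (fun t => Real.exp (y₂ t)) atBot (𝓝 v₂) →
      ∀ T₀, v₁ < Real.exp (θ * T₀ - K) → v₂ < Real.exp (θ * T₀ - K) →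
        (∀ t < T, T₀ + T₁ ≤ t → (y₁ t - y₂ t) ^ 2 ≤ C * Real.exp (-c * (t - (T₀ + T₁)))) ∧
        (((1 - L) * θ + (γ - L * β * θ)) ^ 2 < 4 * (θ * (γ - L * β * θ)) →
          ∀ t, T₀ + T₁ ≤ t → t + τ < T → ∃ x ∈ Icc t (t + τ), y₁ x = y₂ x) := by
  have hβ0 : 0 < β := by linarith
  have hγ : 0 < γ := by nlinarith
  have hw₀ : 0 < γ - L * β * θ := by
    have : L * (β * θ) ≤ 1 * (β * θ) := mul_le_mul_of_nonneg_right hL1 (by positivity)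
    linarith
  set a := θ * (γ - L * β * θ) with ha
  have hapos : 0 < a := by positivity
  set b := (1 - L) * θ + (γ - L * β * θ) with hb
  have hbpos : 0 < b := by
    have : 0 ≤ (1 - L) * θ := mul_nonneg (by linarith) hθ.le
    linarith
  obtain ⟨ε₁, hε₁, c, hcpos, Cd, hCd, hdecay⟩ := exists_oscillator_decay hapos hbpos
  -- Crossings are available only in the underdamped case; otherwise ε and τ are dummies.
  obtain ⟨ε₂, hε₂, τ, hτ, hzero⟩ : ∃ ε > 0, ∃ τ > 0, b ^ 2 < 4 * a →
      ∀ (p s s' : ℝ → ℝ) (t₀ : ℝ),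
      (∀ x ∈ Icc t₀ (t₀ + τ), HasDerivAt p (s x) x) →
      (∀ x ∈ Icc t₀ (t₀ + τ), HasDerivAt s (s' x) x) →
      (∀ x ∈ Icc t₀ (t₀ + τ), |s' x + a * p x + b * s x| ≤ ε * (|p x| + |s x|)) →
      ∃ x ∈ Icc t₀ (t₀ + τ), p x = 0 := by
    by_cases hab : b ^ 2 < 4 * a
    · obtain ⟨ε, hε, τ, hτ, H⟩ := exists_oscillator_zero hapos hab
      exact ⟨ε, hε, τ, hτ, fun _ => H⟩
    · exact ⟨1, one_pos, 1, one_pos, fun h => absurd h hab⟩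
  obtain ⟨δ₁, hδ₁, μ₁, hμ₁, hosc⟩ := exists_oscillator_of_near (M := M) (L := L) hβ0 hθ hM hw₀
    (lt_min hε₁ hε₂)
  obtain ⟨δ₂, hδ₂, hdist⟩ := exists_dist_lt (M := M) (L := L) hβ0 hθ hw₀ one_pos
  obtain ⟨K, Ca, hCa, ca, hca, μ₂, hμ₂, happr⟩ := exists_approach (M := M) C₀ hβ hθ hc hL hL1 hM
  set δ := min δ₁ δ₂ with hδ
  have hδpos : 0 < δ := lt_min hδ₁ hδ₂
  obtain ⟨T₁, hT₁, hexp⟩ := exists_exp_le hca (show 0 < δ / (2 * Ca) by positivity)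
  set μ := min μ₁ (min μ₂ (δ / (2 * Ca))) with hμ
  have hμpos : 0 < μ := lt_min hμ₁ (lt_min hμ₂ (by positivity))
  -- The factor 8 is 2² + 2²: at time T₀ + T₁ both trajectories are within distance 1 of the
  -- equilibrium, so |p| and |s| are at most 2.
  refine ⟨K, Cd * 8, by positivity, c, hcpos, μ, hμpos, T₁, hT₁, τ, hτ, ?_⟩
  intro T v₁ v₂ y₁ η₁ w₁ l₁ y₂ η₂ w₂ l₂ h₁ h₂ hl₁ hl₂ hl hy₁ hy₂ hv₁ hv₂ T₀ hv₁' hv₂'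
  have hD : ∀ {v : ℝ} {y η w l : ℝ → ℝ}, Traj β θ γ M T y η w l → (∀ t < T, |l t - L| ≤ μ) →
      (∀ t < T, θ * t - C₀ ≤ y t) → Tendsto (fun t => Real.exp (y t)) atBot (𝓝 v) →
      v < Real.exp (θ * T₀ - K) → ∀ t < T, T₀ + T₁ ≤ t →
      (w t - (γ - L * β * θ)) ^ 2 + (η t - θ) ^ 2 ≤ δ := by
    intro v y η w l h hl hy hv hv' t ht hTt
    refine (happr T μ v y η w l h hμpos.le ((min_le_right _ _).trans (min_le_left _ _)) hl hy hv
      T₀ (by linarith) hv' t ht (by linarith)).trans ?_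
    have e1 := hexp (t - T₀) (by linarith)
    have e2 : μ ≤ δ / (2 * Ca) := (min_le_right _ _).trans (min_le_right _ _)
    calc Ca * (Real.exp (-ca * (t - T₀)) + μ) ≤ Ca * (δ / (2 * Ca) + δ / (2 * Ca)) := by gcongr
      _ = δ := by field_simp; ring
  have hD₁ := hD h₁ hl₁ hy₁ hv₁ hv₁'
  have hD₂ := hD h₂ hl₂ hy₂ hv₂ hv₂'
  set p : ℝ → ℝ := fun t => y₁ t - y₂ t with hp
  set s : ℝ → ℝ := fun t => η₁ t - η₂ t with hs
  set s' : ℝ → ℝ := fun t => η₁ t * (θ - γ / β + w₁ t / β - (1 - l₁ t) * η₁ t)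
        - η₂ t * (θ - γ / β + w₂ t / β - (1 - l₂ t) * η₂ t) with hs'
  have hpd : ∀ t < T, HasDerivAt p (s t) t := fun t ht => (h₁.hy t ht).sub (h₂.hy t ht)
  have hsd : ∀ t < T, HasDerivAt s (s' t) t := fun t ht => (h₁.hη t ht).sub (h₂.hη t ht)
  have hrel : ∀ t < T, T₀ + T₁ ≤ t → |s' t + a * p t + b * s t| ≤
      min ε₁ ε₂ * (|p t| + |s t|) := fun t ht hTt =>
    hosc T y₁ η₁ w₁ l₁ y₂ η₂ w₂ l₂ h₁ h₂ t ht ((hl₂ t ht).trans (min_le_left _ _))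
      ((hl t ht).trans (mul_le_mul_of_nonneg_right (min_le_left _ _) (abs_nonneg _)))
      ((hD₁ t ht hTt).trans (min_le_left _ _)) ((hD₂ t ht hTt).trans (min_le_left _ _))
  constructor
  · intro t ht hTt
    have hTT : T₀ + T₁ < T := hTt.trans_lt ht
    have e1 := hdecay p s s' (T₀ + T₁) t hTt (fun x hx => hpd x (hx.2.trans_lt ht))
      (fun x hx => hsd x (hx.2.trans_lt ht)) (fun x hx =>
        (hrel x (hx.2.trans_lt ht) hx.1).trans
          (mul_le_mul_of_nonneg_right (min_le_left _ _) (by positivity)))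
    have e2 := hdist T y₁ η₁ w₁ l₁ h₁ _ hTT ((hD₁ _ hTT le_rfl).trans (min_le_right _ _))
    have e3 := hdist T y₂ η₂ w₂ l₂ h₂ _ hTT ((hD₂ _ hTT le_rfl).trans (min_le_right _ _))
    rw [Prod.dist_eq, max_lt_iff, Real.dist_eq, Real.dist_eq, abs_lt, abs_lt] at e2 e3
    have e4 : p (T₀ + T₁) ^ 2 ≤ 2 ^ 2 := by
      apply sq_le_sq' <;> simp only [hp] <;> linarith [e2.1.1, e2.1.2, e3.1.1, e3.1.2]
    have e5 : s (T₀ + T₁) ^ 2 ≤ 2 ^ 2 := by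
      apply sq_le_sq' <;> simp only [hs] <;> linarith [e2.2.1, e2.2.2, e3.2.1, e3.2.2]
    have e6 : p t ^ 2 ≤ p t ^ 2 + s t ^ 2 := by linarith [sq_nonneg (s t)]
    refine (e6.trans e1).trans ?_
    gcongr
    linarith
  · intro hab t hTt htT
    obtain ⟨x, hx, hpx⟩ := hzero hab p s s' t (fun x hx => hpd x (hx.2.trans_lt htT))
      (fun x hx => hsd x (hx.2.trans_lt htT)) (fun x hx =>
        (hrel x (hx.2.trans_lt htT) (hTt.trans hx.1)).trans
          (mul_le_mul_of_nonneg_right (min_le_right _ _) (by positivity)))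
    exact ⟨x, hx, sub_eq_zero.1 hpx⟩

end MEMS

end

/-! ### Asymptotics of g, G and ℓ = g'G/g² at the origin -/

noncomputable section

namespace MEMS

/-- The primitive of `g` vanishing at the origin. -/
def prim (g : ℝ → ℝ) (u : ℝ) : ℝ := ∫ s in (0 : ℝ)..u, g s

/-- The quotient `g' G / g²`. -/
def ell (g : ℝ → ℝ) (u : ℝ) : ℝ := deriv g u * prim g u / g u ^ 2

/-- A positive, increasing and strictly convex `g` on `(0, ū)` with `g(0) = 0`. -/
structure Convexlike (ubar : ℝ) (g : ℝ → ℝ) : Prop where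
  ubar_pos : 0 < ubar
  zero : g 0 = 0
  cont : ContinuousOn g (Ico 0 ubar)
  pos : ∀ u ∈ Ioo 0 ubar, 0 < g u
  d1 : ∀ u ∈ Ioo 0 ubar, HasDerivAt g (deriv g u) u
  d2 : ∀ u ∈ Ioo 0 ubar, HasDerivAt (deriv g) (deriv (deriv g) u) u
  d1_pos : ∀ u ∈ Ioo 0 ubar, 0 < deriv g u
  d2_pos : ∀ u ∈ Ioo 0 ubar, 0 < deriv (deriv g) u

namespace Convexlike

variable {ubar : ℝ} {g : ℝ → ℝ}

lemma strictMonoOn (h : Convexlike ubar g) : StrictMonoOn g (Ico 0 ubar) := by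
  apply strictMonoOn_of_deriv_pos (convex_Ico 0 ubar) h.cont
  rw [interior_Ico]
  exact h.d1_pos

lemma strictMonoOn_deriv (h : Convexlike ubar g) : StrictMonoOn (deriv g) (Ioo 0 ubar) :=
  strictMonoOn_of_deriv_pos (convex_Ioo 0 ubar)
    (fun x hx => (h.d2 x hx).continuousAt.continuousWithinAt)
    (fun x hx => h.d2_pos x (interior_subset hx))

lemma le_mul_deriv (h : Convexlike ubar g) {u : ℝ} (hu : u ∈ Ioo 0 ubar) :
    g u ≤ u * deriv g u := by
  obtain ⟨ξ, hξ, he⟩ := exists_hasDerivAt_eq_slope g (deriv g) hu.1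
    (h.cont.mono (fun x hx => ⟨hx.1, hx.2.trans_lt hu.2⟩))
    (fun x hx => h.d1 x ⟨hx.1, hx.2.trans hu.2⟩)
  have h1 := (h.strictMonoOn_deriv ⟨hξ.1, hξ.2.trans hu.2⟩ hu hξ.2).le
  rw [he, h.zero, sub_zero, sub_zero, div_le_iff₀ hu.1] at h1
  linarith

lemma intervalIntegrable (h : Convexlike ubar g) {u : ℝ} (hu : u ∈ Ico 0 ubar) :
    IntervalIntegrable g MeasureTheory.volume 0 u := by
  apply ContinuousOn.intervalIntegrable
  rw [uIcc_of_le hu.1]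
  exact h.cont.mono (fun x hx => ⟨hx.1, hx.2.trans_lt hu.2⟩)

lemma hasDerivAt_prim (h : Convexlike ubar g) {u : ℝ} (hu : u ∈ Ioo 0 ubar) :
    HasDerivAt (prim g) (g u) u :=
  intervalIntegral.integral_hasDerivAt_right (h.intervalIntegrable ⟨hu.1.le, hu.2⟩)
    ((h.cont.mono Ioo_subset_Ico_self).stronglyMeasurableAtFilter isOpen_Ioo u hu)
    (h.d1 u hu).continuousAt

@[simp] lemma _root_.MEMS.prim_zero (g : ℝ → ℝ) : prim g 0 = 0 := by simp [prim]

lemma continuousOn_prim (h : Convexlike ubar g) : ContinuousOn (prim g) (Ico 0 ubar) := by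
  intro u hu
  obtain ⟨v, hv⟩ := exists_between hu.2
  have h1 := intervalIntegral.continuousOn_primitive_interval'
    (h.intervalIntegrable ⟨hu.1.trans hv.1.le, hv.2⟩) left_mem_uIcc
  rw [uIcc_of_le (hu.1.trans hv.1.le)] at h1
  have h2 : ContinuousWithinAt (prim g) (Icc 0 v) u := h1 u ⟨hu.1, hv.1.le⟩
  refine h2.mono_of_mem_nhdsWithin ?_
  have : Iio v ∈ 𝓝 u := Iio_mem_nhds hv.1
  filter_upwards [self_mem_nhdsWithin, mem_nhdsWithin_of_mem_nhds this] with x hx hx'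
  exact ⟨hx.1, le_of_lt hx'⟩

lemma strictMonoOn_prim (h : Convexlike ubar g) : StrictMonoOn (prim g) (Ico 0 ubar) := by
  apply strictMonoOn_of_deriv_pos (convex_Ico 0 ubar) h.continuousOn_prim
  rw [interior_Ico]
  intro x hx
  rw [(h.hasDerivAt_prim hx).deriv]
  exact h.pos x hx

lemma prim_pos (h : Convexlike ubar g) {u : ℝ} (hu : u ∈ Ioo 0 ubar) : 0 < prim g u := by
  have := h.strictMonoOn_prim ⟨le_rfl, h.ubar_pos⟩ ⟨hu.1.le, hu.2⟩ hu.1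
  simpa using this

lemma prim_le (h : Convexlike ubar g) {u : ℝ} (hu : u ∈ Ioo 0 ubar) : prim g u ≤ u * g u := by
  obtain ⟨ξ, hξ, he⟩ := exists_hasDerivAt_eq_slope (prim g) g hu.1
    (h.continuousOn_prim.mono (fun x hx => ⟨hx.1, hx.2.trans_lt hu.2⟩))
    (fun x hx => h.hasDerivAt_prim ⟨hx.1, hx.2.trans hu.2⟩)
  have h1 := (h.strictMonoOn ⟨hξ.1.le, hξ.2.trans hu.2⟩ ⟨hu.1.le, hu.2⟩ hξ.2).le
  rw [he, prim_zero, sub_zero, sub_zero, div_le_iff₀ hu.1] at h1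
  linarith

lemma ell_pos (h : Convexlike ubar g) {u : ℝ} (hu : u ∈ Ioo 0 ubar) : 0 < ell g u := by
  have := h.d1_pos u hu
  have := h.prim_pos hu
  have := h.pos u hu
  unfold ell; positivity

lemma Ioo_mem (h : Convexlike ubar g) : Ioo 0 ubar ∈ 𝓝[>] (0 : ℝ) := Ioo_mem_nhdsGT h.ubar_pos

lemma tendsto_zero (h : Convexlike ubar g) : Tendsto g (𝓝[>] 0) (𝓝 0) := by
  have := (h.cont 0 ⟨le_rfl, h.ubar_pos⟩)
  rw [ContinuousWithinAt, h.zero] at this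
  refine this.mono_left (nhdsWithin_le_of_mem ?_)
  filter_upwards [h.Ioo_mem] with x hx using ⟨hx.1.le, hx.2⟩

lemma tendsto_prim_zero (h : Convexlike ubar g) : Tendsto (prim g) (𝓝[>] 0) (𝓝 0) := by
  have := (h.continuousOn_prim 0 ⟨le_rfl, h.ubar_pos⟩)
  rw [ContinuousWithinAt, prim_zero] at this
  refine this.mono_left (nhdsWithin_le_of_mem ?_)
  filter_upwards [h.Ioo_mem] with x hx using ⟨hx.1.le, hx.2⟩

lemma tendsto_id_zero : Tendsto (fun u : ℝ => u) (𝓝[>] 0) (𝓝 0) :=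
  tendsto_id.mono_left nhdsWithin_le_nhds

/-- The derivative of g/g' is 1 - g g''/g'², which would be negative near 0 if q < 1. But g/g' is
positive and tends to 0, since g ≤ u g' by convexity. -/
lemma one_le_q (h : Convexlike ubar g) {q : ℝ}
    (hq : Tendsto (fun u => deriv g u ^ 2 / (g u * deriv (deriv g) u)) (𝓝[>] 0) (𝓝 q)) :
    1 ≤ q := by
  by_contra! hlt
  have h1 : ∀ᶠ u in 𝓝[>] (0 : ℝ), deriv g u ^ 2 / (g u * deriv (deriv g) u) < 1 :=
    hq.eventually_lt_const hlt
  obtain ⟨δ, hδ, hsub⟩ := (mem_nhdsGT_iff_exists_Ioo_subset' h.ubar_pos).1 (h1.and h.Ioo_mem)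
  have hδ0 : (0 : ℝ) < δ := hδ
  have hanti : AntitoneOn (fun u => g u / deriv g u) (Ioo 0 δ) := by
    refine antitoneOn_of_hasDerivAt_nonpos (convex_Ioo 0 δ) (fun x hx =>
      (h.d1 x (hsub hx).2).div (h.d2 x (hsub hx).2) (h.d1_pos x (hsub hx).2).ne') ?_
    intro x hx
    obtain ⟨hx1, hx2⟩ := hsub hx
    have a1 := h.d1_pos x hx2
    have a2 := h.d2_pos x hx2
    have a3 := h.pos x hx2
    have hx1' : deriv g x ^ 2 / (g x * deriv (deriv g) x) < 1 := hx1
    rw [div_lt_one (by positivity)] at hx1'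
    apply div_nonpos_of_nonpos_of_nonneg _ (by positivity)
    nlinarith
  have hlim : Tendsto (fun u => g u / deriv g u) (𝓝[>] 0) (𝓝 0) := by
    refine tendsto_of_tendsto_of_tendsto_of_le_of_le' tendsto_const_nhds tendsto_id_zero ?_ ?_
    · filter_upwards [h.Ioo_mem] with u hu using div_nonneg (h.pos u hu).le (h.d1_pos u hu).le
    · filter_upwards [h.Ioo_mem] with u hu
      rw [div_le_iff₀ (h.d1_pos u hu)]; exact h.le_mul_deriv hu
  have hm : δ / 2 ∈ Ioo 0 δ := ⟨by linarith, by linarith⟩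
  have hpos : 0 < g (δ / 2) / deriv g (δ / 2) :=
    div_pos (h.pos _ (hsub hm).2) (h.d1_pos _ (hsub hm).2)
  have : g (δ / 2) / deriv g (δ / 2) ≤ 0 := by
    refine ge_of_tendsto hlim ?_
    filter_upwards [Ioo_mem_nhdsGT hm.1] with u hu
    exact hanti ⟨hu.1, hu.2.trans hm.2⟩ hm hu.2.le
  linarith

lemma tendsto_inv_q {q : ℝ} (hq1 : 1 ≤ q)
    (hq : Tendsto (fun u => deriv g u ^ 2 / (g u * deriv (deriv g) u)) (𝓝[>] 0) (𝓝 q)) :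
    Tendsto (fun u => g u * deriv (deriv g) u / deriv g u ^ 2) (𝓝[>] 0) (𝓝 (1 / q)) := by
  have := hq.inv₀ (by linarith)
  rw [one_div]
  refine this.congr (fun u => ?_)
  rw [inv_div]

/-- L'Hôpital's rule for 1/ℓ = (g²/g')/G: the quotient of derivatives is 2 - g g''/g'². -/
lemma tendsto_ell (h : Convexlike ubar g) {q : ℝ}
    (hq : Tendsto (fun u => deriv g u ^ 2 / (g u * deriv (deriv g) u)) (𝓝[>] 0) (𝓝 q)) :
    Tendsto (ell g) (𝓝[>] 0) (𝓝 (1 / (2 - 1 / q))) := by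
  have hq1 := h.one_le_q hq
  have hinv := tendsto_inv_q hq1 hq
  have hne : 2 - 1 / q ≠ 0 := by
    have : 1 / q ≤ 1 := by rw [div_le_one (by linarith)]; exact hq1
    linarith
  have key : Tendsto (fun u => (g u ^ 2 / deriv g u) / prim g u) (𝓝[>] 0) (𝓝 (2 - 1 / q)) := by
    refine HasDerivAt.lhopital_zero_right_on_Ioo h.ubar_pos
      (f' := fun u => (2 * g u * deriv g u * deriv g u - g u ^ 2 * deriv (deriv g) u)
        / deriv g u ^ 2) (g' := g) ?_ (fun x hx => h.hasDerivAt_prim hx)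
      (fun x hx => (h.pos x hx).ne') ?_ h.tendsto_prim_zero ?_
    · intro x hx
      have h1 : HasDerivAt (fun u => g u ^ 2) (2 * g x * deriv g x) x := by
        simpa using (h.d1 x hx).fun_pow 2
      exact h1.div (h.d2 x hx) (h.d1_pos x hx).ne'
    · have : Tendsto (fun u => u * g u) (𝓝[>] 0) (𝓝 (0 * 0)) := tendsto_id_zero.mul h.tendsto_zero
      rw [zero_mul] at this
      refine tendsto_of_tendsto_of_tendsto_of_le_of_le' tendsto_const_nhds this ?_ ?_
      · filter_upwards [h.Ioo_mem] with u hu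
          using div_nonneg (sq_nonneg _) (h.d1_pos u hu).le
      · filter_upwards [h.Ioo_mem] with u hu
        rw [div_le_iff₀ (h.d1_pos u hu)]
        nlinarith [h.le_mul_deriv hu, h.pos u hu]
    · refine (hinv.const_sub 2).congr' ?_
      filter_upwards [h.Ioo_mem] with u hu
      have a1 := (h.d1_pos u hu).ne'
      have a2 := (h.pos u hu).ne'
      field_simp
  have := key.inv₀ hne
  rw [one_div]
  refine this.congr (fun u => ?_)
  unfold ell
  rw [inv_div, div_div_eq_mul_div, mul_comm]

/-- L'Hôpital's rule again, since (G/g)' = 1 - ℓ. This limit governs u' at the origin. -/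
lemma tendsto_prim_div (h : Convexlike ubar g) {L : ℝ} (hL : Tendsto (ell g) (𝓝[>] 0) (𝓝 L)) :
    Tendsto (fun u => prim g u / (g u * u)) (𝓝[>] 0) (𝓝 (1 - L)) := by
  have key : Tendsto (fun u => (prim g u / g u) / u) (𝓝[>] 0) (𝓝 (1 - L)) := by
    refine HasDerivAt.lhopital_zero_right_on_Ioo h.ubar_pos
      (f' := fun u => (g u * g u - prim g u * deriv g u) / g u ^ 2) (g' := fun _ => 1)
      (fun x hx => (h.hasDerivAt_prim hx).div (h.d1 x hx) (h.pos x hx).ne')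
      (fun x hx => hasDerivAt_id x)
      (fun x hx => one_ne_zero) ?_ tendsto_id_zero ?_
    · refine tendsto_of_tendsto_of_tendsto_of_le_of_le' tendsto_const_nhds tendsto_id_zero ?_ ?_
      · filter_upwards [h.Ioo_mem] with u hu
          using div_nonneg (h.prim_pos hu).le (h.pos u hu).le
      · filter_upwards [h.Ioo_mem] with u hu
        rw [div_le_iff₀ (h.pos u hu)]
        exact h.prim_le hu
    · refine (hL.const_sub 1).congr' ?_
      filter_upwards [h.Ioo_mem] with u hu
      have a2 := (h.pos u hu).ne'
      unfold ell
      field_simp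
  refine key.congr (fun u => ?_)
  rw [div_div]

/-- `(G / g) ℓ'`, the derivative of `ℓ` with respect to `log G`. -/
def ellDeriv (g : ℝ → ℝ) (u : ℝ) : ℝ :=
  ell g u ^ 2 * (g u * deriv (deriv g) u / deriv g u ^ 2) + ell g u - 2 * ell g u ^ 2

lemma hasDerivAt_ell (h : Convexlike ubar g) {u : ℝ} (hu : u ∈ Ioo 0 ubar) :
    HasDerivAt (ell g) (ellDeriv g u * (g u / prim g u)) u := by
  have h1 : HasDerivAt (fun u => g u ^ 2) (2 * g u * deriv g u) u := by
    simpa using (h.d1 u hu).fun_pow 2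
  have h2 := ((h.d2 u hu).mul (h.hasDerivAt_prim hu)).div h1 (pow_pos (h.pos u hu) 2).ne'
  refine h2.congr_deriv ?_
  have a1 := (h.d1_pos u hu).ne'
  have a2 := (h.pos u hu).ne'
  have a3 := (h.prim_pos hu).ne'
  simp only [ellDeriv, ell, Pi.mul_apply]
  field_simp

/-- The limit L²/q + L - 2L² vanishes because L(2 - 1/q) = 1. This slow variation of ℓ in log G
makes the perturbation of the difference equation relative. -/
lemma tendsto_ellDeriv (h : Convexlike ubar g) {q : ℝ}
    (hq : Tendsto (fun u => deriv g u ^ 2 / (g u * deriv (deriv g) u)) (𝓝[>] 0) (𝓝 q)) :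
    Tendsto (ellDeriv g) (𝓝[>] 0) (𝓝 0) := by
  have hq1 := h.one_le_q hq
  have h1 := h.tendsto_ell hq
  have h2 := (((h1.pow 2).mul (tendsto_inv_q hq1 hq)).add h1).sub ((h1.pow 2).const_mul 2)
  refine h2.trans (le_of_eq ?_)
  congr 1
  have : 2 - 1 / q ≠ 0 := by
    have : 1 / q ≤ 1 := by rw [div_le_one (by linarith)]; exact hq1
    linarith
  have hq0 : q ≠ 0 := by linarith
  have : 2 * q - 1 ≠ 0 := by linarith
  field_simp
  ring

/-- For q > 1 the limit L is already below 1. For q = 1 it equals 1, and the sign condition decides: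
it gives (g²/g')' ≥ g, and integration from 0 yields g²/g' ≥ G. -/
lemma eventually_ell_le_one (h : Convexlike ubar g) {q : ℝ}
    (hq : Tendsto (fun u => deriv g u ^ 2 / (g u * deriv (deriv g) u)) (𝓝[>] 0) (𝓝 q))
    (hq3 : q = 1 → ∀ᶠ u in 𝓝[>] (0 : ℝ), 1 ≤ deriv g u ^ 2 / (g u * deriv (deriv g) u)) :
    ∀ᶠ u in 𝓝[>] (0 : ℝ), ell g u ≤ 1 := by
  have hq1 := h.one_le_q hq
  rcases hq1.eq_or_lt with he | hlt
  · obtain ⟨δ, hδ, hsub⟩ :=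
      (mem_nhdsGT_iff_exists_Ioo_subset' h.ubar_pos).1 ((hq3 he.symm).and h.Ioo_mem)
    have hδ0 : (0 : ℝ) < δ := hδ
    have hmono : MonotoneOn (fun u => g u ^ 2 / deriv g u - prim g u) (Ioo 0 δ) := by
      refine monotoneOn_of_hasDerivAt_nonneg (convex_Ioo 0 δ) (f' := fun u =>
        (2 * g u * deriv g u * deriv g u - g u ^ 2 * deriv (deriv g) u) / deriv g u ^ 2 - g u)
        ?_ ?_
      · intro x hx
        have hx2 := (hsub hx).2
        have h1 : HasDerivAt (fun u => g u ^ 2) (2 * g x * deriv g x) x := by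
          simpa using (h.d1 x hx2).fun_pow 2
        exact (h1.div (h.d2 x hx2) (h.d1_pos x hx2).ne').sub (h.hasDerivAt_prim hx2)
      · intro x hx
        obtain ⟨hx1, hx2⟩ := hsub hx
        have a1 := h.d1_pos x hx2
        have a2 := h.d2_pos x hx2
        have a3 := h.pos x hx2
        have hx1' : 1 ≤ deriv g x ^ 2 / (g x * deriv (deriv g) x) := hx1
        rw [one_le_div (by positivity)] at hx1'
        rw [sub_nonneg, le_div_iff₀ (by positivity)]
        nlinarith
    filter_upwards [Ioo_mem_nhdsGT hδ0] with u hu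
    have hu2 := (hsub hu).2
    have hlim : Tendsto (fun u => -prim g u) (𝓝[>] 0) (𝓝 0) := by
      simpa using h.tendsto_prim_zero.neg
    have : 0 ≤ g u ^ 2 / deriv g u - prim g u := by
      refine le_of_tendsto hlim ?_
      filter_upwards [Ioo_mem_nhdsGT hu.1] with s hs
      have hsδ : s ∈ Ioo 0 δ := ⟨hs.1, hs.2.trans hu.2⟩
      have h1 := hmono hsδ hu hs.2.le
      simp only at h1
      have h2 : 0 ≤ g s ^ 2 / deriv g s := div_nonneg (sq_nonneg _) (h.d1_pos s (hsub hsδ).2).le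
      linarith
    rw [sub_nonneg, le_div_iff₀ (h.d1_pos u hu2)] at this
    unfold ell
    rw [div_le_one (pow_pos (h.pos u hu2) 2)]
    linarith
  · refine ((h.tendsto_ell hq).eventually_lt_const ?_).mono (fun u hu => hu.le)
    have : 1 / q < 1 := by rw [div_lt_one (by linarith)]; exact hlt
    rw [div_lt_one (by linarith)]
    linarith

/-- Control of `ℓ` on `(0, u₁)`. -/
structure Regime (ubar : ℝ) (g : ℝ → ℝ) (L μ u₁ : ℝ) : Prop where
  pos : 0 < u₁
  lt : u₁ < ubar
  ell_le : ∀ u ∈ Ioo 0 u₁, ell g u ≤ 1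
  near : ∀ u ∈ Ioo 0 u₁, |ell g u - L| ≤ μ
  deriv_le : ∀ u ∈ Ioo 0 u₁, |ellDeriv g u| ≤ μ

lemma exists_regime (h : Convexlike ubar g) {q : ℝ}
    (hq : Tendsto (fun u => deriv g u ^ 2 / (g u * deriv (deriv g) u)) (𝓝[>] 0) (𝓝 q))
    (hq3 : q = 1 → ∀ᶠ u in 𝓝[>] (0 : ℝ), 1 ≤ deriv g u ^ 2 / (g u * deriv (deriv g) u))
    {μ : ℝ} (hμ : 0 < μ) : ∃ u₁, Regime ubar g (1 / (2 - 1 / q)) μ u₁ := by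
  have e1 := h.eventually_ell_le_one hq hq3
  have e2 := (h.tendsto_ell hq).eventually (Metric.closedBall_mem_nhds _ hμ)
  have e3 := (h.tendsto_ellDeriv hq).eventually (Metric.closedBall_mem_nhds _ hμ)
  obtain ⟨δ, hδ, hsub⟩ :=
    (mem_nhdsGT_iff_exists_Ioo_subset' h.ubar_pos).1 (e1.and (e2.and e3))
  have hδ0 : (0 : ℝ) < δ := hδ
  refine ⟨min δ (ubar / 2), lt_min hδ0 (by linarith [h.ubar_pos]),
    (min_le_right _ _).trans_lt (by linarith [h.ubar_pos]), ?_, ?_, ?_⟩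
  · exact fun u hu => (hsub ⟨hu.1, hu.2.trans_le (min_le_left _ _)⟩).1
  · intro u hu
    have := (hsub ⟨hu.1, hu.2.trans_le (min_le_left _ _)⟩).2.1
    rwa [Real.dist_eq] at this
  · intro u hu
    have := (hsub ⟨hu.1, hu.2.trans_le (min_le_left _ _)⟩).2.2
    rwa [Real.dist_eq, sub_zero] at this

/-- A mean value estimate in the variable log G, carried out through the monotonicity of μ log G ±
ℓ. It supplies the bound on l₁ - l₂ by a multiple of y₁ - y₂ in `exists_pair`. -/
lemma Regime.abs_sub_le (h : Convexlike ubar g) {L μ u₁ : ℝ} (hr : Regime ubar g L μ u₁)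
    {u v : ℝ} (hu : u ∈ Ioo 0 u₁) (hv : v ∈ Ioo 0 u₁) :
    |ell g u - ell g v| ≤ μ * |Real.log (prim g u) - Real.log (prim g v)| := by
  wlog huv : u ≤ v generalizing u v
  · rw [abs_sub_comm, abs_sub_comm (Real.log _)]
    exact this hv hu (le_of_not_ge huv)
  have hsub : ∀ x ∈ Ioo 0 u₁, x ∈ Ioo 0 ubar := fun x hx => ⟨hx.1, hx.2.trans hr.lt⟩
  have hlog : ∀ x ∈ Ioo 0 u₁, HasDerivAt (fun x => μ * Real.log (prim g x))
      (μ * (g x / prim g x)) x := fun x hx =>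
    ((h.hasDerivAt_prim (hsub x hx)).log (h.prim_pos (hsub x hx)).ne').const_mul μ
  have hm1 : MonotoneOn (fun x => μ * Real.log (prim g x) - ell g x) (Ioo 0 u₁) := by
    refine monotoneOn_of_hasDerivAt_nonneg (convex_Ioo 0 u₁)
      (fun x hx => (hlog x hx).sub (h.hasDerivAt_ell (hsub x hx))) ?_
    intro x hx
    have h1 := (abs_le.1 (hr.deriv_le x hx)).2
    have h2 : 0 < g x / prim g x := div_pos (h.pos x (hsub x hx)) (h.prim_pos (hsub x hx))
    nlinarith
  have hm2 : MonotoneOn (fun x => μ * Real.log (prim g x) + ell g x) (Ioo 0 u₁) := by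
    refine monotoneOn_of_hasDerivAt_nonneg (convex_Ioo 0 u₁)
      (fun x hx => (hlog x hx).add (h.hasDerivAt_ell (hsub x hx))) ?_
    intro x hx
    have h1 := (abs_le.1 (hr.deriv_le x hx)).1
    have h2 : 0 < g x / prim g x := div_pos (h.pos x (hsub x hx)) (h.prim_pos (hsub x hx))
    nlinarith
  have h1 := hm1 hu hv huv
  have h2 := hm2 hu hv huv
  simp only at h1 h2
  have h3 : Real.log (prim g u) ≤ Real.log (prim g v) :=
    Real.log_le_log (h.prim_pos (hsub u hu)) (h.strictMonoOn_prim.monotoneOn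
      ⟨hu.1.le, (hsub u hu).2⟩ ⟨hv.1.le, (hsub v hv).2⟩ huv)
  rw [abs_of_nonpos (by linarith : Real.log (prim g u) - Real.log (prim g v) ≤ 0), abs_le]
  constructor <;> linarith

end Convexlike

end MEMS

end

/-! ### The first-order system and a priori bounds independent of the initial value -/

noncomputable section

namespace MEMS

/-- The range of the exponents. -/
structure Exponents (α β γ : ℝ) : Prop where
  one_le : 1 ≤ β
  lt_α : β < α
  lt_γ : α < γ

namespace Exponents

variable {α β γ : ℝ}

lemma β_pos (e : Exponents α β γ) : 0 < β := by linarith [e.one_le]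

lemma γ_pos (e : Exponents α β γ) : 0 < γ := by linarith [e.one_le, e.lt_α, e.lt_γ]

lemma one_lt_theta (e : Exponents α β γ) : 1 < theta α β γ := by
  have : 0 < (γ - α) / β := div_pos (by linarith [e.lt_γ]) e.β_pos
  unfold theta; linarith

lemma theta_pos (e : Exponents α β γ) : 0 < theta α β γ := by linarith [e.one_lt_theta]

lemma mul_theta (e : Exponents α β γ) : β * theta α β γ = β + γ - α := by
  have := e.β_pos.ne'
  unfold theta; field_simp; ring

lemma mul_theta_lt (e : Exponents α β γ) : β * theta α β γ < γ := by
  rw [e.mul_theta]; linarith [e.lt_α]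

end Exponents

/-- Integrates differential inequalities from the origin. The minorant ψ serves when φ is not known
to have a limit there. -/
lemma le_of_monotoneOn_of_tendsto {φ ψ : ℝ → ℝ} {c r₀ r : ℝ} (hm : MonotoneOn φ (Ioo 0 r₀))
    (hr : r ∈ Ioo 0 r₀) (hψ : ∀ s ∈ Ioo 0 r₀, ψ s ≤ φ s) (hlim : Tendsto ψ (𝓝[>] 0) (𝓝 c)) :
    c ≤ φ r := by
  refine le_of_tendsto hlim ?_
  filter_upwards [Ioo_mem_nhdsGT hr.1] with s hs
  have hs' : s ∈ Ioo 0 r₀ := ⟨hs.1, hs.2.trans hr.2⟩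
  exact (hψ s hs').trans (hm hs' hr hs.2.le)

lemma tendsto_rpow_zero {p : ℝ} (hp : 0 < p) (c : ℝ) :
    Tendsto (fun s : ℝ => -(c * s ^ p)) (𝓝[>] 0) (𝓝 0) := by
  have h1 : ContinuousAt (fun s : ℝ => -(c * s ^ p)) 0 :=
    ((Real.continuousAt_rpow_const 0 p (Or.inr hp.le)).const_mul c).neg
  have h2 := h1.tendsto
  rw [Real.zero_rpow hp.ne', mul_zero, neg_zero] at h2
  exact h2.mono_left nhdsWithin_le_nhds

/-- The slope `u'` expressed through the radius and the flux. -/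
def slope (α β r F : ℝ) : ℝ := r ^ (-(α / β)) * F ^ (1 / β)

lemma slope_pos {α β r F : ℝ} (hr : 0 < r) (hF : 0 < F) : 0 < slope α β r F := by
  unfold slope; positivity

lemma slope_mono {α β r F F' : ℝ} (hβ : 0 < β) (hr : 0 < r) (hF : 0 ≤ F) (h : F ≤ F') :
    slope α β r F ≤ slope α β r F' := by
  unfold slope
  have : 0 ≤ 1 / β := by positivity
  gcongr

lemma mul_slope {α β g r F : ℝ} (hβ : 0 < β) (hg : 0 < g) (hF : 0 < F) :
    g * slope α β r F = slope α β r (g ^ β * F) := by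
  unfold slope
  rw [Real.mul_rpow (by positivity) hF.le, ← Real.rpow_mul hg.le, mul_one_div_cancel hβ.ne',
    Real.rpow_one]
  ring

lemma slope_power {α β γ r c : ℝ} (hr : 0 < r) (hc : 0 < c) :
    slope α β r (c * r ^ γ) = c ^ (1 / β) * r ^ (theta α β γ - 1) := by
  unfold slope
  have h : theta α β γ - 1 = -(α / β) + γ * (1 / β) := by unfold theta; ring
  rw [Real.mul_rpow hc.le (by positivity), ← Real.rpow_mul hr.le, h, Real.rpow_add hr]
  ring

lemma slope_rpow {α β r F : ℝ} (hβ : 0 < β) (hr : 0 < r) (hF : 0 < F) :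
    slope α β r F ^ β = r ^ (-α) * F := by
  unfold slope
  rw [Real.mul_rpow (by positivity) (by positivity), ← Real.rpow_mul hr.le, ← Real.rpow_mul hF.le,
    one_div_mul_cancel hβ.ne', Real.rpow_one, neg_mul, div_mul_cancel₀ _ hβ.ne']

/-- The constant in the lower bound `G(u(r)) ≥ c r ^ θ`. -/
def lowConst (α β γ : ℝ) : ℝ := (1 / γ) ^ (1 / β) / theta α β γ

lemma lowConst_pos {α β γ : ℝ} (e : Exponents α β γ) : 0 < lowConst α β γ := by
  have := e.theta_pos
  have := e.γ_pos
  unfold lowConst; positivity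

lemma lowConst_mul {α β γ : ℝ} (e : Exponents α β γ) :
    lowConst α β γ * theta α β γ = (1 / γ) ^ (1 / β) := by
  have := e.theta_pos
  unfold lowConst; field_simp

/-- The equation written as a first-order system for `u` and the flux `F`. -/
structure Sol (α β γ ubar : ℝ) (g : ℝ → ℝ) (a r₀ : ℝ) (u F : ℝ → ℝ) : Prop where
  mem : ∀ r ∈ Ioo 0 r₀, u r ∈ Ioo 0 ubar
  F_pos : ∀ r ∈ Ioo 0 r₀, 0 < F r
  dF : ∀ r ∈ Ioo 0 r₀, HasDerivAt F (r ^ (γ - 1) / g (u r) ^ β) r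
  du : ∀ r ∈ Ioo 0 r₀, HasDerivAt u (slope α β r (F r)) r
  F_lim : Tendsto F (𝓝[>] 0) (𝓝 0)
  u_lim : Tendsto u (𝓝[>] 0) (𝓝 a)
  init : u 0 = a

namespace Sol

variable {α β γ ubar a r₀ : ℝ} {g u F : ℝ → ℝ}

lemma restrict (h : Sol α β γ ubar g a r₀ u F) {r₁ : ℝ} (hr : r₁ ≤ r₀) :
    Sol α β γ ubar g a r₁ u F :=
  ⟨fun r h' => h.mem r ⟨h'.1, h'.2.trans_le hr⟩, fun r h' => h.F_pos r ⟨h'.1, h'.2.trans_le hr⟩,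
    fun r h' => h.dF r ⟨h'.1, h'.2.trans_le hr⟩, fun r h' => h.du r ⟨h'.1, h'.2.trans_le hr⟩,
    h.F_lim, h.u_lim, h.init⟩

lemma strictMonoOn (h : Sol α β γ ubar g a r₀ u F) : StrictMonoOn u (Ioo 0 r₀) := by
  apply strictMonoOn_of_deriv_pos (convex_Ioo 0 r₀)
  · exact fun x hx => (h.du x hx).continuousAt.continuousWithinAt
  · intro x hx
    rw [interior_Ioo] at hx
    rw [(h.du x hx).deriv]
    exact slope_pos hx.1 (h.F_pos x hx)

lemma le (h : Sol α β γ ubar g a r₀ u F) {r : ℝ} (hr : r ∈ Ioo 0 r₀) : a ≤ u r :=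
  le_of_monotoneOn_of_tendsto h.strictMonoOn.monotoneOn hr (fun _ _ => le_rfl) h.u_lim

/-- As g(u)^β is nondecreasing, (g(u)^β F)' ≥ g(u)^β F' = r^(γ-1). In logarithmic time this is w ≤
γ. -/
lemma pow_le_flux (h : Sol α β γ ubar g a r₀ u F) (e : Exponents α β γ) (hg : Convexlike ubar g)
    {r : ℝ} (hr : r ∈ Ioo 0 r₀) : 1 / γ * r ^ γ ≤ g (u r) ^ β * F r := by
  have hm : MonotoneOn (fun r => g (u r) ^ β * F r - 1 / γ * r ^ γ) (Ioo 0 r₀) := by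
    refine monotoneOn_of_hasDerivAt_nonneg (convex_Ioo 0 r₀) (fun x hx =>
      ((((hg.d1 _ (h.mem x hx)).comp x (h.du x hx)).rpow_const (p := β)
        (Or.inl (hg.pos _ (h.mem x hx)).ne')).mul (h.dF x hx)).sub
        ((Real.hasDerivAt_rpow_const (p := γ) (Or.inl hx.1.ne')).const_mul (1 / γ))) ?_
    intro x hx
    have h1 := hg.pos _ (h.mem x hx)
    have h2 := hg.d1_pos _ (h.mem x hx)
    have h3 := slope_pos (α := α) (β := β) hx.1 (h.F_pos x hx)
    have h4 := h.F_pos x hx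
    have h5 := e.β_pos
    have h6 := e.γ_pos.ne'
    have h7 : (g ∘ u) x = g (u x) := rfl
    have h8 : 0 < g (u x) ^ β := by positivity
    have h9 : (g ∘ u) x ^ β * (x ^ (γ - 1) / g (u x) ^ β) = x ^ (γ - 1) := by
      rw [h7]; field_simp
    have h10 : 1 / γ * (γ * x ^ (γ - 1)) = x ^ (γ - 1) := by field_simp
    rw [h9, h10, add_sub_cancel_right, h7]
    positivity
  have := le_of_monotoneOn_of_tendsto hm hr (ψ := fun s => -(1 / γ * s ^ γ)) (fun s hs => by
    have h1 : 0 < g (u s) ^ β := Real.rpow_pos_of_pos (hg.pos _ (h.mem s hs)) _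
    have h2 := mul_pos h1 (h.F_pos s hs)
    linarith) (tendsto_rpow_zero e.γ_pos _)
  linarith

/-- The derivative of G(u) is g(u)u', the slope belonging to the flux g(u)^β F; `pow_le_flux` bounds
it below by a power of r, which is integrated. -/
lemma prim_ge (h : Sol α β γ ubar g a r₀ u F) (e : Exponents α β γ) (hg : Convexlike ubar g)
    {r : ℝ} (hr : r ∈ Ioo 0 r₀) : lowConst α β γ * r ^ theta α β γ ≤ prim g (u r) := by
  have hm : MonotoneOn (fun r => prim g (u r) - lowConst α β γ * r ^ theta α β γ) (Ioo 0 r₀) := by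
    refine monotoneOn_of_hasDerivAt_nonneg (convex_Ioo 0 r₀) (fun x hx =>
      ((hg.hasDerivAt_prim (h.mem x hx)).comp x (h.du x hx)).sub
        ((Real.hasDerivAt_rpow_const (Or.inl hx.1.ne')).const_mul _)) ?_
    intro x hx
    have h1 := hg.pos _ (h.mem x hx)
    rw [mul_slope e.β_pos h1 (h.F_pos x hx), ← mul_assoc, lowConst_mul e, sub_nonneg,
      ← slope_power hx.1 (by have := e.γ_pos; positivity)]
    apply slope_mono e.β_pos hx.1 _ (h.pow_le_flux e hg hx)
    have := e.γ_pos
    have := hx.1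
    positivity
  have := le_of_monotoneOn_of_tendsto hm hr (ψ := fun s => -(lowConst α β γ * s ^ theta α β γ))
    (fun s hs => by linarith [hg.prim_pos (h.mem s hs)]) (tendsto_rpow_zero e.theta_pos _)
  linarith

/-- Since γ - 1 = (α-β-1) + βθ and G(u) ≥ c r^θ, F' is at most a constant times r^(α-β-1) (G/g)^β.
The condition ℓ ≤ 1 makes G/g nondecreasing along u, so this is at most the derivative of the bound.
-/
lemma flux_le (h : Sol α β γ ubar g a r₀ u F) (e : Exponents α β γ) (hg : Convexlike ubar g)
    (hell : ∀ r ∈ Ioo 0 r₀, ell g (u r) ≤ 1) {r : ℝ} (hr : r ∈ Ioo 0 r₀) :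
    F r ≤ 1 / ((α - β) * lowConst α β γ ^ β) * (r ^ (α - β) * (prim g (u r) / g (u r)) ^ β) := by
  set C := 1 / ((α - β) * lowConst α β γ ^ β) with hC
  have hαβ : 0 < α - β := by linarith [e.lt_α]
  have hc := lowConst_pos e
  have hCpos : 0 < C := by positivity
  have hm : MonotoneOn (fun r => C * (r ^ (α - β) * (prim g (u r) / g (u r)) ^ β) - F r)
      (Ioo 0 r₀) := by
    refine monotoneOn_of_hasDerivAt_nonneg (convex_Ioo 0 r₀) (fun x hx =>
      (((Real.hasDerivAt_rpow_const (p := α - β) (Or.inl hx.1.ne')).mul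
        ((((hg.hasDerivAt_prim (h.mem x hx)).comp x (h.du x hx)).div
          ((hg.d1 _ (h.mem x hx)).comp x (h.du x hx)) (hg.pos _ (h.mem x hx)).ne').rpow_const
          (p := β) (Or.inl (div_pos (hg.prim_pos (h.mem x hx)) (hg.pos _ (h.mem x hx))).ne'))
        ).const_mul C).sub (h.dF x hx)) ?_
    intro x hx
    have hx0 := hx.1
    have h1 := hg.pos _ (h.mem x hx)
    have h2 := hg.d1_pos _ (h.mem x hx)
    have h3 := hg.prim_pos (h.mem x hx)
    have h4 := slope_pos (α := α) (β := β) hx.1 (h.F_pos x hx)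
    have h5 := e.β_pos
    simp only [Pi.div_apply, Function.comp_apply]
    have e1 : (g (u x) * slope α β x (F x) * g (u x)
        - prim g (u x) * (deriv g (u x) * slope α β x (F x))) / g (u x) ^ 2
        = slope α β x (F x) * (1 - ell g (u x)) := by
      unfold ell; field_simp
    rw [e1]
    have e2 : 0 ≤ slope α β x (F x) * (1 - ell g (u x)) :=
      mul_nonneg h4.le (by linarith [hell x hx])
    have e3 : 0 ≤ x ^ (α - β) * (slope α β x (F x) * (1 - ell g (u x)) * β
        * (prim g (u x) / g (u x)) ^ (β - 1)) := by positivity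
    have e4 : x ^ (γ - 1) / g (u x) ^ β
        ≤ C * ((α - β) * x ^ (α - β - 1) * (prim g (u x) / g (u x)) ^ β) := by
      rw [Real.div_rpow h3.le h1.le, hC]
      have e5 : lowConst α β γ ^ β * x ^ (γ - 1) ≤ x ^ (α - β - 1) * prim g (u x) ^ β := by
        have e6 : (lowConst α β γ * x ^ theta α β γ) ^ β ≤ prim g (u x) ^ β := by
          gcongr; exact h.prim_ge e hg hx
        have e7 : γ - 1 = (α - β - 1) + theta α β γ * β := by
          have := e.mul_theta; linarith
        calc lowConst α β γ ^ β * x ^ (γ - 1)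
            = x ^ (α - β - 1) * (lowConst α β γ * x ^ theta α β γ) ^ β := by
              rw [e7, Real.rpow_add hx0, Real.mul_rpow hc.le (by positivity),
                ← Real.rpow_mul hx0.le]; ring
          _ ≤ _ := by gcongr
      have e8 : 1 / ((α - β) * lowConst α β γ ^ β) *
          ((α - β) * x ^ (α - β - 1) * (prim g (u x) ^ β / g (u x) ^ β))
          = (x ^ (α - β - 1) * prim g (u x) ^ β) / lowConst α β γ ^ β / g (u x) ^ β := by
        field_simp
      rw [e8]
      gcongr
      rw [le_div_iff₀ (by positivity)]
      linarith
    have e9 := mul_nonneg hCpos.le e3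
    linarith
  have hlim : Tendsto (fun s => -F s) (𝓝[>] 0) (𝓝 0) := by simpa using h.F_lim.neg
  have := le_of_monotoneOn_of_tendsto hm hr (ψ := fun s => -F s) (fun s hs => by
    have h1 := hg.prim_pos (h.mem s hs)
    have h2 := hg.pos _ (h.mem s hs)
    have h3 := hs.1
    have : 0 ≤ C * (s ^ (α - β) * (prim g (u s) / g (u s)) ^ β) := by positivity
    linarith) hlim
  linarith

/-- The bound on `η = r g(u) u' / G(u)`. -/
def etaBound (α β γ : ℝ) : ℝ := (1 / ((α - β) * lowConst α β γ ^ β)) ^ (1 / β)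

/-- The β-th power of η is r^(β-α) (g/G)^β F, in which every variable factor cancels after
`flux_le`. -/
lemma eta_le (h : Sol α β γ ubar g a r₀ u F) (e : Exponents α β γ) (hg : Convexlike ubar g)
    (hell : ∀ r ∈ Ioo 0 r₀, ell g (u r) ≤ 1) {r : ℝ} (hr : r ∈ Ioo 0 r₀) :
    r * g (u r) * slope α β r (F r) / prim g (u r) ≤ etaBound α β γ := by
  have hαβ : 0 < α - β := by linarith [e.lt_α]
  have hc := lowConst_pos e
  have hβ := e.β_pos
  have hr0 := hr.1
  have h1 := hg.pos _ (h.mem r hr)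
  have h3 := hg.prim_pos (h.mem r hr)
  have h2 := h.F_pos r hr
  have h4 := slope_pos (α := α) (β := β) hr.1 h2
  unfold etaBound
  rw [one_div β, Real.le_rpow_inv_iff_of_pos (by positivity) (by positivity) hβ,
    Real.div_rpow (by positivity) h3.le, Real.mul_rpow (by positivity) h4.le,
    Real.mul_rpow hr0.le h1.le, slope_rpow hβ hr0 h2, div_le_iff₀ (by positivity)]
  have h5 := h.flux_le e hg hell hr
  rw [Real.div_rpow h3.le h1.le] at h5
  calc r ^ β * g (u r) ^ β * (r ^ (-α) * F r)
      ≤ r ^ β * g (u r) ^ β * (r ^ (-α) * (1 / ((α - β) * lowConst α β γ ^ β) *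
        (r ^ (α - β) * (prim g (u r) ^ β / g (u r) ^ β)))) := by gcongr
    _ = (r ^ β * r ^ (-α) * r ^ (α - β)) * (1 / ((α - β) * lowConst α β γ ^ β)
        * prim g (u r) ^ β) := by field_simp
    _ = _ := by
      rw [← Real.rpow_add hr0, ← Real.rpow_add hr0, show β + -α + (α - β) = 0 by ring,
        Real.rpow_zero, one_mul]

end Sol

end MEMS

end

/-! ### Lower barrier and comparison bounds -/

noncomputable section

namespace MEMS

/-- The inverse of the primitive of `g`. -/
def invPrim (ubar : ℝ) (g : ℝ → ℝ) : ℝ → ℝ := Function.invFunOn (prim g) (Ico 0 ubar)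

/-- The lower barrier `G⁻¹(c r ^ θ)` of all solutions. -/
def ulow (α β γ ubar : ℝ) (g : ℝ → ℝ) (r : ℝ) : ℝ :=
  invPrim ubar g (lowConst α β γ * r ^ theta α β γ)

namespace Convexlike

variable {ubar : ℝ} {g : ℝ → ℝ}

lemma invPrim_prim (h : Convexlike ubar g) {u : ℝ} (hu : u ∈ Ico 0 ubar) :
    invPrim ubar g (prim g u) = u :=
  h.strictMonoOn_prim.injOn.leftInvOn_invFunOn hu

lemma exists_prim_eq (h : Convexlike ubar g) {u₁ v : ℝ} (hu₁ : u₁ ∈ Ioo 0 ubar) (hv : 0 < v)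
    (hv₁ : v < prim g u₁) : ∃ u ∈ Ioo 0 u₁, prim g u = v := by
  have hc : ContinuousOn (prim g) (Icc 0 u₁) :=
    h.continuousOn_prim.mono (fun x hx => ⟨hx.1, hx.2.trans_lt hu₁.2⟩)
  have := intermediate_value_Ioo hu₁.1.le hc
  rw [prim_zero] at this
  exact this ⟨hv, hv₁⟩

lemma hasDerivAt_invPrim (h : Convexlike ubar g) {u : ℝ} (hu : u ∈ Ioo 0 ubar) :
    HasDerivAt (invPrim ubar g) (g u)⁻¹ (prim g u) := by
  have hnhds : Ioo 0 ubar ∈ 𝓝 u := Ioo_mem_nhds hu.1 hu.2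
  have h1 : HasStrictDerivAt (prim g) (g u) u := by
    refine hasStrictDerivAt_of_hasDerivAt_of_continuousAt (f' := g) ?_ (h.d1 u hu).continuousAt
    filter_upwards [hnhds] with x hx using h.hasDerivAt_prim hx
  refine (h1.to_local_left_inverse (h.pos u hu).ne' ?_).hasDerivAt
  filter_upwards [hnhds] with x hx using h.invPrim_prim ⟨hx.1.le, hx.2⟩

variable {α β γ u₁ r : ℝ}

lemma ulow_spec (h : Convexlike ubar g) (e : Exponents α β γ) (hu₁ : u₁ ∈ Ioo 0 ubar) (hr : 0 < r)
    (hr₁ : lowConst α β γ * r ^ theta α β γ < prim g u₁) :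
    ulow α β γ ubar g r ∈ Ioo 0 u₁ ∧
      prim g (ulow α β γ ubar g r) = lowConst α β γ * r ^ theta α β γ := by
  have := lowConst_pos e
  obtain ⟨u, hu, he⟩ := h.exists_prim_eq hu₁ (by positivity) hr₁
  have : ulow α β γ ubar g r = u := by
    unfold ulow
    rw [← he, h.invPrim_prim ⟨hu.1.le, hu.2.trans hu₁.2⟩]
  rw [this]
  exact ⟨hu, he⟩

lemma hasDerivAt_ulow (h : Convexlike ubar g) (e : Exponents α β γ) (hu₁ : u₁ ∈ Ioo 0 ubar)
    (hr : 0 < r) (hr₁ : lowConst α β γ * r ^ theta α β γ < prim g u₁) :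
    HasDerivAt (ulow α β γ ubar g)
      ((1 / γ) ^ (1 / β) * r ^ (theta α β γ - 1) / g (ulow α β γ ubar g r)) r := by
  obtain ⟨h1, h2⟩ := h.ulow_spec e hu₁ hr hr₁
  have h3 := h.hasDerivAt_invPrim ⟨h1.1, h1.2.trans hu₁.2⟩
  rw [h2] at h3
  have h4 : HasDerivAt (fun r => lowConst α β γ * r ^ theta α β γ)
      (lowConst α β γ * (theta α β γ * r ^ (theta α β γ - 1))) r :=
    (Real.hasDerivAt_rpow_const (Or.inl hr.ne')).const_mul _
  refine (h3.comp r h4).congr_deriv ?_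
  rw [← lowConst_mul e]
  ring

lemma _root_.MEMS.exists_radius {α β γ : ℝ} (e : Exponents α β γ) {v : ℝ} (hv : 0 < v) :
    ∃ R > 0, ∀ r ∈ Ioc 0 R, lowConst α β γ * r ^ theta α β γ < v := by
  have := (tendsto_rpow_zero e.theta_pos (lowConst α β γ)).neg
  simp only [neg_neg, neg_zero] at this
  obtain ⟨R, hR, hsub⟩ := mem_nhdsGT_iff_exists_Ioc_subset.1 (this.eventually_lt_const hv)
  exact ⟨R, hR, fun r hr => hsub hr⟩

end Convexlike

namespace Sol

variable {α β γ ubar a r₀ u₁ : ℝ} {g u F : ℝ → ℝ}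

lemma ulow_le (h : Sol α β γ ubar g a r₀ u F) (e : Exponents α β γ) (hg : Convexlike ubar g)
    (hu₁ : u₁ ∈ Ioo 0 ubar) {r : ℝ} (hr : r ∈ Ioo 0 r₀)
    (hr₁ : lowConst α β γ * r ^ theta α β γ < prim g u₁) : ulow α β γ ubar g r ≤ u r := by
  obtain ⟨h1, h2⟩ := hg.ulow_spec e hu₁ hr.1 hr₁
  have h3 := h.prim_ge e hg hr
  rw [← h2] at h3
  have h4 := h.mem r hr
  exact (hg.strictMonoOn_prim.le_iff_le ⟨h1.1.le, h1.2.trans hu₁.2⟩ ⟨h4.1.le, h4.2⟩).1 h3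

/-- The logarithmic derivative of r^γ / g(ulow)^β is (γ - βθℓ)/r, at least (α-β)/r because ℓ ≤ 1 and
γ - βθ = α - β. On the other side, F' is estimated by u ≥ ulow. -/
lemma flux_le_ulow (h : Sol α β γ ubar g a r₀ u F) (e : Exponents α β γ) (hg : Convexlike ubar g)
    (hu₁ : u₁ ∈ Ioo 0 ubar) (hell : ∀ x ∈ Ioo 0 u₁, ell g x ≤ 1)
    (hr₁ : ∀ r ∈ Ioo 0 r₀, lowConst α β γ * r ^ theta α β γ < prim g u₁)
    {r : ℝ} (hr : r ∈ Ioo 0 r₀) :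
    F r ≤ 1 / (α - β) * (r ^ γ / g (ulow α β γ ubar g r) ^ β) := by
  have hαβ : 0 < α - β := by linarith [e.lt_α]
  have hβ := e.β_pos
  set ul := ulow α β γ ubar g with hul
  have hspec : ∀ x ∈ Ioo 0 r₀, ul x ∈ Ioo 0 ubar := fun x hx =>
    have := (hg.ulow_spec e hu₁ hx.1 (hr₁ x hx)).1
    ⟨this.1, this.2.trans hu₁.2⟩
  have hm : MonotoneOn (fun r => 1 / (α - β) * (r ^ γ / g (ul r) ^ β) - F r) (Ioo 0 r₀) := by
    refine monotoneOn_of_hasDerivAt_nonneg (convex_Ioo 0 r₀) (fun x hx =>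
      (((Real.hasDerivAt_rpow_const (p := γ) (Or.inl hx.1.ne')).div
        (((hg.d1 _ (hspec x hx)).comp x (hg.hasDerivAt_ulow e hu₁ hx.1 (hr₁ x hx))).rpow_const
          (p := β) (Or.inl (hg.pos _ (hspec x hx)).ne'))
        (Real.rpow_pos_of_pos (hg.pos _ (hspec x hx)) _).ne').const_mul (1 / (α - β))).sub
        (h.dF x hx)) ?_
    intro x hx
    have hx0 := hx.1
    have hspec' := hg.ulow_spec e hu₁ hx.1 (hr₁ x hx)
    have hk := hg.pos _ (hspec x hx)
    have hle := h.ulow_le e hg hu₁ hx (hr₁ x hx)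
    rw [← hul] at hle hspec' ⊢
    simp only [Function.comp_apply]
    set k := g (ul x) with hkd
    have hell' := hell _ hspec'.1
    have hP := hspec'.2
    have e0 : k ^ (β - 1) = k ^ β / k := by rw [Real.rpow_sub hk, Real.rpow_one]
    have e1 : x ^ γ = x ^ (γ - 1) * x := by
      rw [Real.rpow_sub hx0, Real.rpow_one]; field_simp
    have e2 : x ^ theta α β γ = x ^ (theta α β γ - 1) * x := by
      rw [Real.rpow_sub hx0, Real.rpow_one]; field_simp
    have e3 : (γ * x ^ (γ - 1) * k ^ β
        - x ^ γ * (deriv g (ul x) * ((1 / γ) ^ (1 / β) * x ^ (theta α β γ - 1) / k) * β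
          * k ^ (β - 1))) / (k ^ β) ^ 2
        = x ^ (γ - 1) / k ^ β * (γ - β * theta α β γ * ell g (ul x)) := by
      unfold ell
      rw [hP, ← lowConst_mul e, e0, e1, e2, ← hkd]
      have : (0 : ℝ) < k ^ β := by positivity
      field_simp
    rw [e3]
    have e4 : α - β ≤ γ - β * theta α β γ * ell g (ul x) := by
      have h1 : β * theta α β γ * ell g (ul x) ≤ β * theta α β γ * 1 := by
        have := e.theta_pos
        gcongr
      have := e.mul_theta
      linarith
    have e5 : x ^ (γ - 1) / g (u x) ^ β ≤ x ^ (γ - 1) / k ^ β := by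
      gcongr
      exact hg.strictMonoOn.monotoneOn ⟨(hspec x hx).1.le, (hspec x hx).2⟩
        ⟨(h.mem x hx).1.le, (h.mem x hx).2⟩ hle
    have e6 : x ^ (γ - 1) / k ^ β ≤ 1 / (α - β) * (x ^ (γ - 1) / k ^ β *
        (γ - β * theta α β γ * ell g (ul x))) := by
      calc x ^ (γ - 1) / k ^ β = 1 / (α - β) * (x ^ (γ - 1) / k ^ β * (α - β)) := by field_simp
        _ ≤ _ := by gcongr
    linarith
  have hlim : Tendsto (fun s => -F s) (𝓝[>] 0) (𝓝 0) := by simpa using h.F_lim.neg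
  have := le_of_monotoneOn_of_tendsto hm hr (ψ := fun s => -F s) (fun s hs => by
    have h2 := hg.pos _ (hspec s hs)
    have h3 := hs.1
    have : 0 ≤ 1 / (α - β) * (s ^ γ / g (ul s) ^ β) := by positivity
    linarith) hlim
  linarith

/-- A bound on the slope of all solutions. -/
def slopeBound (α β γ ubar : ℝ) (g : ℝ → ℝ) (r : ℝ) : ℝ :=
  (1 / (α - β)) ^ (1 / β) * (r ^ (theta α β γ - 1) / g (ulow α β γ ubar g r))

/-- The constant in the upper bound `u(r) ≤ a + C G⁻¹(c r ^ θ)`. -/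
def upConst (α β γ : ℝ) : ℝ := (1 / (α - β)) ^ (1 / β) / (1 / γ) ^ (1 / β)

lemma slope_le (h : Sol α β γ ubar g a r₀ u F) (e : Exponents α β γ) (hg : Convexlike ubar g)
    (hu₁ : u₁ ∈ Ioo 0 ubar) (hell : ∀ x ∈ Ioo 0 u₁, ell g x ≤ 1)
    (hr₁ : ∀ r ∈ Ioo 0 r₀, lowConst α β γ * r ^ theta α β γ < prim g u₁)
    {r : ℝ} (hr : r ∈ Ioo 0 r₀) : slope α β r (F r) ≤ slopeBound α β γ ubar g r := by
  have hαβ : 0 < α - β := by linarith [e.lt_α]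
  have hβ := e.β_pos
  have hr0 := hr.1
  have h1 := (hg.ulow_spec e hu₁ hr.1 (hr₁ r hr)).1
  have hk := hg.pos _ ⟨h1.1, h1.2.trans hu₁.2⟩
  have hF := h.F_pos r hr
  unfold slopeBound
  rw [← mul_div_assoc, le_div_iff₀ hk, mul_comm, mul_slope hβ hk hF,
    ← slope_power hr0 (by positivity)]
  apply slope_mono hβ hr0 (by positivity)
  have := h.flux_le_ulow e hg hu₁ hell hr₁ hr
  calc g (ulow α β γ ubar g r) ^ β * F r
      ≤ g (ulow α β γ ubar g r) ^ β * (1 / (α - β) * (r ^ γ / g (ulow α β γ ubar g r) ^ β)) := by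
        gcongr
    _ = _ := by field_simp

lemma hasDerivAt_upConst_mul_ulow (e : Exponents α β γ) (hg : Convexlike ubar g)
    (hu₁ : u₁ ∈ Ioo 0 ubar) {r : ℝ} (hr : 0 < r)
    (hr₁ : lowConst α β γ * r ^ theta α β γ < prim g u₁) :
    HasDerivAt (fun r => upConst α β γ * ulow α β γ ubar g r) (slopeBound α β γ ubar g r) r := by
  refine ((hg.hasDerivAt_ulow e hu₁ hr hr₁).const_mul _).congr_deriv ?_
  have := e.γ_pos
  have : (0 : ℝ) < (1 / γ) ^ (1 / β) := by positivity
  unfold upConst slopeBound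
  field_simp

/-- The slope bound is exactly the derivative of a multiple of the lower barrier, so barrier and
upper bound have the same order. This makes all solutions with small initial value uniformly small
near the origin. -/
lemma le_ulow (h : Sol α β γ ubar g a r₀ u F) (e : Exponents α β γ) (hg : Convexlike ubar g)
    (hu₁ : u₁ ∈ Ioo 0 ubar) (hell : ∀ x ∈ Ioo 0 u₁, ell g x ≤ 1)
    (hr₁ : ∀ r ∈ Ioo 0 r₀, lowConst α β γ * r ^ theta α β γ < prim g u₁)
    {r : ℝ} (hr : r ∈ Ioo 0 r₀) : u r ≤ a + upConst α β γ * ulow α β γ ubar g r := by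
  have hαβ : 0 < α - β := by linarith [e.lt_α]
  have hγ := e.γ_pos
  have hm : MonotoneOn (fun r => upConst α β γ * ulow α β γ ubar g r - u r) (Ioo 0 r₀) := by
    refine monotoneOn_of_hasDerivAt_nonneg (convex_Ioo 0 r₀) (fun x hx =>
      (hasDerivAt_upConst_mul_ulow e hg hu₁ hx.1 (hr₁ x hx)).sub (h.du x hx)) ?_
    intro x hx
    have := h.slope_le e hg hu₁ hell hr₁ hx
    linarith
  have := le_of_monotoneOn_of_tendsto hm hr (ψ := fun s => -u s) (fun s hs => by
    have h2 := (hg.ulow_spec e hu₁ hs.1 (hr₁ s hs)).1.1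
    have h3 : 0 ≤ upConst α β γ * ulow α β γ ubar g s := by unfold upConst; positivity
    linarith) h.u_lim.neg
  linarith

end Sol

/-! ### Passage to logarithmic time -/

namespace Sol

variable {α β γ ubar a r₀ u₁ : ℝ} {g u F : ℝ → ℝ}

/-- `log G(u)` in logarithmic time. -/
def yT (g u : ℝ → ℝ) (t : ℝ) : ℝ := Real.log (prim g (u (Real.exp t)))

/-- `η = r (G(u))' / G(u)` in logarithmic time. -/
def etaT (α β : ℝ) (g u F : ℝ → ℝ) (t : ℝ) : ℝ :=
  Real.exp ((1 - α / β) * t + Real.log (g (u (Real.exp t)))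
    + 1 / β * Real.log (F (Real.exp t)) - yT g u t)

/-- `w = r ^ γ / (f(u) F)` in logarithmic time. -/
def wT (β γ : ℝ) (g u F : ℝ → ℝ) (t : ℝ) : ℝ :=
  Real.exp (γ * t - β * Real.log (g (u (Real.exp t))) - Real.log (F (Real.exp t)))

lemma exp_mem {t : ℝ} (hr₀ : 0 < r₀) (ht : t < Real.log r₀) : Real.exp t ∈ Ioo 0 r₀ :=
  ⟨Real.exp_pos t, (Real.lt_log_iff_exp_lt hr₀).1 ht⟩

lemma exp_log_slope {r : ℝ} (hr : 0 < r) {F : ℝ} (hF : 0 < F) :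
    slope α β r F = Real.exp (-(α / β) * Real.log r + 1 / β * Real.log F) := by
  unfold slope
  rw [Real.exp_add, Real.rpow_def_of_pos hr, Real.rpow_def_of_pos hF, mul_comm (Real.log r),
    mul_comm (Real.log F)]

lemma etaT_eq (h : Sol α β γ ubar g a r₀ u F) (hg : Convexlike ubar g)
    {r : ℝ} (hr : r ∈ Ioo 0 r₀) :
    etaT α β g u F (Real.log r) = r * g (u r) * slope α β r (F r) / prim g (u r) := by
  have h1 := hg.pos _ (h.mem r hr)
  have h2 := hg.prim_pos (h.mem r hr)
  have h3 := h.F_pos r hr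
  unfold etaT yT
  rw [exp_log_slope hr.1 h3, Real.exp_sub, Real.exp_log hr.1, Real.exp_log h2]
  congr 1
  rw [show (1 - α / β) * Real.log r + Real.log (g (u r)) + 1 / β * Real.log (F r)
    = Real.log r + Real.log (g (u r)) + (-(α / β) * Real.log r + 1 / β * Real.log (F r)) by ring,
    Real.exp_add, Real.exp_add, Real.exp_log hr.1, Real.exp_log h1]

lemma wT_eq (h : Sol α β γ ubar g a r₀ u F) (hg : Convexlike ubar g)
    {r : ℝ} (hr : r ∈ Ioo 0 r₀) :
    wT β γ g u F (Real.log r) = r ^ γ / (g (u r) ^ β * F r) := by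
  have h1 := hg.pos _ (h.mem r hr)
  have h3 := h.F_pos r hr
  unfold wT
  rw [Real.exp_log hr.1, Real.exp_sub, Real.exp_sub, Real.exp_log h3, Real.rpow_def_of_pos hr.1,
    Real.rpow_def_of_pos h1, mul_comm (Real.log r), mul_comm (Real.log (g _)), div_div]

/-- Both η and w are exponentials of linear combinations of t, log g(u), log F and y, whose
t-derivatives are 1, ℓη, w and η; the system is read off by adding these. -/
lemma traj (h : Sol α β γ ubar g a r₀ u F) (e : Exponents α β γ) (hg : Convexlike ubar g)
    (hr₀ : 0 < r₀) (hell : ∀ r ∈ Ioo 0 r₀, ell g (u r) ≤ 1) :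
    Traj β (theta α β γ) γ (etaBound α β γ) (Real.log r₀) (yT g u) (etaT α β g u F)
      (wT β γ g u F) (fun t => ell g (u (Real.exp t))) := by
  have hβ := e.β_pos
  have hγ := e.γ_pos
  have hu : ∀ t < Real.log r₀, HasDerivAt (fun t => u (Real.exp t))
      (slope α β (Real.exp t) (F (Real.exp t)) * Real.exp t) t := fun t ht =>
    (h.du _ (exp_mem hr₀ ht)).comp t (Real.hasDerivAt_exp t)
  have heta : ∀ t < Real.log r₀, etaT α β g u F t = Real.exp t * g (u (Real.exp t))
      * slope α β (Real.exp t) (F (Real.exp t)) / prim g (u (Real.exp t)) := fun t ht => by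
    have := h.etaT_eq hg (exp_mem hr₀ ht)
    rwa [Real.log_exp] at this
  have hweq : ∀ t < Real.log r₀, wT β γ g u F t
      = Real.exp t ^ γ / (g (u (Real.exp t)) ^ β * F (Real.exp t)) := fun t ht => by
    have := h.wT_eq hg (exp_mem hr₀ ht)
    rwa [Real.log_exp] at this
  have hy : ∀ t < Real.log r₀, HasDerivAt (yT g u) (etaT α β g u F t) t := fun t ht => by
    have hm := h.mem _ (exp_mem hr₀ ht)
    have h1 : HasDerivAt (fun t => prim g (u (Real.exp t))) _ t :=
      HasDerivAt.comp (h := fun t => u (Real.exp t)) (h₂ := prim g) t (hg.hasDerivAt_prim hm) (hu t ht)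
    refine (h1.log (hg.prim_pos hm).ne').congr_deriv ?_
    rw [heta t ht]
    ring
  have hlg : ∀ t < Real.log r₀, HasDerivAt (fun t => Real.log (g (u (Real.exp t))))
      (ell g (u (Real.exp t)) * etaT α β g u F t) t := fun t ht => by
    have hm := h.mem _ (exp_mem hr₀ ht)
    have h0 : HasDerivAt (fun t => g (u (Real.exp t))) _ t :=
      HasDerivAt.comp (h := fun t => u (Real.exp t)) (h₂ := g) t (hg.d1 _ hm) (hu t ht)
    refine (h0.log (hg.pos _ hm).ne').congr_deriv ?_
    have h1 := hg.pos _ hm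
    have h2 := hg.prim_pos hm
    rw [heta t ht]
    unfold ell
    field_simp
  have hlF : ∀ t < Real.log r₀, HasDerivAt (fun t => Real.log (F (Real.exp t)))
      (wT β γ g u F t) t := fun t ht => by
    have hm := h.mem _ (exp_mem hr₀ ht)
    have hF := h.F_pos _ (exp_mem hr₀ ht)
    have h0 : HasDerivAt (fun t => F (Real.exp t)) _ t :=
      HasDerivAt.comp (h := Real.exp) (h₂ := F) t (h.dF _ (exp_mem hr₀ ht)) (Real.hasDerivAt_exp t)
    refine (h0.log hF.ne').congr_deriv ?_
    have h1 := hg.pos _ hm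
    have h2 := Real.exp_pos t
    rw [hweq t ht, Real.rpow_sub h2, Real.rpow_one]
    have : (0 : ℝ) < g (u (Real.exp t)) ^ β := by positivity
    field_simp
  have hid : ∀ (c t : ℝ), HasDerivAt (fun t => c * t) c t := fun c t => by
    simpa using (hasDerivAt_id t).const_mul c
  refine ⟨hy, fun t ht => ?_, fun t ht => ?_, fun t ht => Real.exp_pos _, fun t ht => ?_,
    fun t ht => Real.exp_pos _, fun t ht => ?_, fun t ht => hell _ (exp_mem hr₀ ht),
    fun t ht => (hg.ell_pos (h.mem _ (exp_mem hr₀ ht))).le, fun t ht => ?_⟩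
  · refine (((((hid (1 - α / β) t).add (hlg t ht)).add ((hlF t ht).const_mul (1 / β))).sub
      (hy t ht)).exp).congr_deriv ?_
    have : theta α β γ - γ / β = 1 - α / β := by unfold theta; ring
    rw [this]
    change etaT α β g u F t * _ = _
    ring
  · refine ((((hid γ t).sub ((hlg t ht).const_mul β)).sub (hlF t ht)).exp).congr_deriv ?_
    change wT β γ g u F t * _ = _
    ring
  · rw [heta t ht]
    exact h.eta_le e hg hell (exp_mem hr₀ ht)
  · have hm := exp_mem hr₀ ht
    have h1 := hg.pos _ (h.mem _ hm)
    have h3 := h.F_pos _ hm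
    have h2 := h.pow_le_flux e hg hm
    rw [hweq t ht, div_le_iff₀ (by positivity)]
    calc Real.exp t ^ γ = γ * (1 / γ * Real.exp t ^ γ) := by field_simp
      _ ≤ _ := by gcongr
  · have : theta α β γ = 1 + γ / β - α / β := by unfold theta; ring
    unfold wT etaT
    rw [Real.log_exp, Real.log_exp, this]
    field_simp
    ring

lemma yT_ge (h : Sol α β γ ubar g a r₀ u F) (e : Exponents α β γ) (hg : Convexlike ubar g)
    (hr₀ : 0 < r₀) (t : ℝ) (ht : t < Real.log r₀) :
    theta α β γ * t - (-Real.log (lowConst α β γ)) ≤ yT g u t := by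
  have h1 := h.prim_ge e hg (exp_mem hr₀ ht)
  have hc := lowConst_pos e
  have h2 := Real.log_le_log (by positivity) h1
  rw [Real.log_mul hc.ne' (by positivity), Real.log_rpow (Real.exp_pos t), Real.log_exp] at h2
  unfold yT
  linarith

lemma tendsto_exp_yT (h : Sol α β γ ubar g a r₀ u F) (hg : Convexlike ubar g)
    (hr₀ : 0 < r₀) (ha : a ∈ Ico 0 ubar) :
    Tendsto (fun t => Real.exp (yT g u t)) atBot (𝓝 (prim g a)) := by
  have h1 : Tendsto (fun r => prim g (u r)) (𝓝[>] 0) (𝓝 (prim g a)) := by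
    refine (hg.continuousOn_prim a ha).tendsto.comp (tendsto_nhdsWithin_iff.2 ⟨h.u_lim, ?_⟩)
    filter_upwards [Ioo_mem_nhdsGT hr₀] with r hr using ⟨(h.mem r hr).1.le, (h.mem r hr).2⟩
  have h2 : Tendsto (fun t => prim g (u (Real.exp t))) atBot (𝓝 (prim g a)) :=
    h1.comp Real.tendsto_exp_atBot_nhdsGT
  refine h2.congr' ?_
  filter_upwards [Iio_mem_atBot (Real.log r₀)] with t ht
  exact (Real.exp_log (hg.prim_pos (h.mem _ (exp_mem hr₀ ht)))).symm

end Sol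

end MEMS

end

/-! ### Equivalence of the second-order problem and the first-order system -/

noncomputable section

namespace MEMS

variable {α β γ ubar a r₀ : ℝ} {f u F : ℝ → ℝ}

lemma g_rpow (hβ : 0 < β) {x : ℝ} (hx : 0 < f x) : g f β x ^ β = f x := by
  unfold g
  rw [← Real.rpow_mul hx.le, one_div_mul_cancel hβ.ne', Real.rpow_one]

/-- The flux `r ^ α |u'| ^ (β - 1) u'`. -/
def flux (α β : ℝ) (u : ℝ → ℝ) (s : ℝ) : ℝ := s ^ α * |deriv u s| ^ (β - 1) * deriv u s

lemma deriv_eq_slope_of_flux_pos (hβ : 0 < β) {r : ℝ} (hr : 0 < r) (hF : 0 < flux α β u r) :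
    deriv u r = slope α β r (flux α β u r) := by
  have h1 : 0 ≤ r ^ α * |deriv u r| ^ (β - 1) := by positivity
  have h2 : 0 < deriv u r := by
    by_contra! hcon
    have := mul_nonpos_of_nonneg_of_nonpos h1 hcon
    unfold flux at hF
    linarith
  have h3 : flux α β u r = r ^ α * deriv u r ^ β := by
    unfold flux
    rw [abs_of_pos h2, Real.rpow_sub h2, Real.rpow_one]
    field_simp
  have h4 := slope_pos (α := α) (β := β) hr hF
  have h5 : slope α β r (flux α β u r) ^ β = deriv u r ^ β := by
    rw [slope_rpow hβ hr hF, h3, ← mul_assoc, ← Real.rpow_add hr, neg_add_cancel, Real.rpow_zero,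
      one_mul]
  exact (Real.rpow_left_injOn hβ.ne' h4.le h2.le h5).symm

lemma flux_neg (u : ℝ → ℝ) (r : ℝ) : flux α β (fun s => -u s) r = -flux α β u r := by
  unfold flux
  have : deriv (fun s => -u s) r = -deriv u r := deriv.fun_neg
  rw [this, abs_neg, mul_neg]

/-- A flux bounded below by a positive constant near the origin forces a logarithmic singularity. -/
lemma not_bddBelow_of_flux_ge (hβ : 0 < β) (hαβ : β < α) {r₂ c B : ℝ} (hr₂ : 0 < r₂)
    (hr₂1 : r₂ ≤ 1) (hc : 0 < c) (hd : ∀ r ∈ Ioo 0 r₂, DifferentiableAt ℝ u r)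
    (hF : ∀ r ∈ Ioo 0 r₂, c ≤ flux α β u r) (hB : ∀ r ∈ Ioo 0 r₂, B ≤ u r) : False := by
  set c' := c ^ (1 / β) with hc'
  have hc'pos : 0 < c' := by positivity
  have hm : MonotoneOn (fun r => u r - c' * Real.log r) (Ioo 0 r₂) := by
    refine monotoneOn_of_hasDerivAt_nonneg (convex_Ioo 0 r₂) (fun x hx =>
      ((hd x hx).hasDerivAt).sub ((Real.hasDerivAt_log hx.1.ne').const_mul c')) ?_
    intro x hx
    have hx1 : x ≤ 1 := hx.2.le.trans hr₂1
    rw [deriv_eq_slope_of_flux_pos hβ hx.1 (hc.trans_le (hF x hx))]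
    have h1 := slope_mono (α := α) hβ hx.1 hc.le (hF x hx)
    have h2 : c' * x⁻¹ ≤ slope α β x c := by
      unfold slope
      rw [mul_comm]
      gcongr
      rw [← Real.rpow_neg_one]
      apply Real.rpow_le_rpow_of_exponent_ge hx.1 hx1
      rw [neg_le_neg_iff, one_le_div hβ]
      exact hαβ.le
    linarith
  have hx : r₂ / 2 ∈ Ioo 0 r₂ := ⟨by linarith, by linarith⟩
  have hlim : Tendsto (fun s => B - c' * Real.log s) (𝓝[>] 0) atTop := by
    have h1 : Tendsto (fun s => -c' * Real.log s) (𝓝[>] 0) atTop :=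
      Real.tendsto_log_nhdsGT_zero.const_mul_atBot_of_neg (by linarith)
    refine (tendsto_atTop_add_const_left _ B h1).congr (fun s => by ring)
  have hev := hlim.eventually_gt_atTop (u (r₂ / 2) - c' * Real.log (r₂ / 2))
  obtain ⟨s, hs1, hs2⟩ := (hev.and (Ioo_mem_nhdsGT hx.1)).exists
  have h1 := hm ⟨hs2.1, hs2.2.trans hx.2⟩ hx hs2.2.le
  simp only at h1
  have h2 := hB s ⟨hs2.1, hs2.2.trans hx.2⟩
  linarith

/-- The flux is increasing. Were it nonpositive somewhere, or positive in the limit at 0, it would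
be bounded away from 0 near the origin; then |u'| ≥ c/r because α > β, and u would be unbounded.
Hence it is positive and vanishes at 0. -/
lemma IsSolution.sol (h : IsSolution α β γ ubar f a r₀ u) (e : Exponents α β γ) (hr₀ : 0 < r₀)
    (hf : ∀ x ∈ Ioo 0 ubar, 0 < f x) : Sol α β γ ubar (g f β) a r₀ u (flux α β u) := by
  have hβ := e.β_pos
  have hd : ∀ r ∈ Ioo 0 r₀, DifferentiableAt ℝ u r := fun r hr =>
    (h.contDiffOn.differentiableOn (by norm_num)).differentiableAt (Ioo_mem_nhds hr.1 hr.2)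
  have hdF : ∀ r ∈ Ioo 0 r₀, HasDerivAt (flux α β u) (r ^ (γ - 1) / f (u r)) r := fun r hr => by
    have h1 : DifferentiableAt ℝ (flux α β u) r := h.differentiableAt_flux r hr
    refine h1.hasDerivAt.congr_deriv ?_
    have h2 : r ^ (-(γ - 1)) * deriv (flux α β u) r = 1 / f (u r) := h.equation r hr
    have h3 : (0 : ℝ) < r ^ (γ - 1) := Real.rpow_pos_of_pos hr.1 _
    rw [Real.rpow_neg hr.1.le] at h2
    field_simp at h2 ⊢
    linarith
  have hmono : StrictMonoOn (flux α β u) (Ioo 0 r₀) := by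
    apply strictMonoOn_of_deriv_pos (convex_Ioo 0 r₀)
    · exact fun x hx => (hdF x hx).continuousAt.continuousWithinAt
    · intro x hx
      rw [interior_Ioo] at hx
      rw [(hdF x hx).deriv]
      exact div_pos (Real.rpow_pos_of_pos hx.1 _) (hf _ (h.mem_Ioo x hx))
  have hpos : ∀ r ∈ Ioo 0 r₀, 0 < flux α β u r := by
    intro r hr
    by_contra! hcon
    set r₂ := min (r / 2) 1 with hr₂
    have hr₂pos : 0 < r₂ := lt_min (by linarith [hr.1]) one_pos
    have hr₂r : r₂ < r := (min_le_left _ _).trans_lt (by linarith [hr.1])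
    have hr₂mem : r₂ ∈ Ioo 0 r₀ := ⟨hr₂pos, hr₂r.trans hr.2⟩
    have hneg : flux α β u r₂ < 0 := (hmono hr₂mem hr hr₂r).trans_le hcon
    have hsub : ∀ x ∈ Ioo 0 r₂, x ∈ Ioo 0 r₀ := fun x hx => ⟨hx.1, hx.2.trans hr₂mem.2⟩
    refine not_bddBelow_of_flux_ge (u := fun s => -u s) (B := -ubar) hβ e.lt_α hr₂pos
      (min_le_right _ _) (neg_pos.2 hneg) (fun x hx => (hd x (hsub x hx)).neg)
      (fun x hx => ?_) (fun x hx => ?_)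
    · rw [flux_neg]
      exact neg_le_neg (hmono (hsub x hx) hr₂mem hx.2).le
    · exact neg_le_neg (h.mem_Ioo x (hsub x hx)).2.le
  have hlim : Tendsto (flux α β u) (𝓝[>] 0) (𝓝 0) := by
    rw [Metric.tendsto_nhds]
    intro ε hε
    obtain ⟨r, hr, hrε⟩ : ∃ r ∈ Ioo 0 (min r₀ 1), flux α β u r < ε := by
      by_contra! hcon
      refine not_bddBelow_of_flux_ge (u := u) (B := 0) hβ e.lt_α (lt_min hr₀ one_pos)
        (min_le_right _ _) hε (fun x hx => hd x ⟨hx.1, hx.2.trans_le (min_le_left _ _)⟩) hcon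
        (fun x hx => (h.mem_Ioo x ⟨hx.1, hx.2.trans_le (min_le_left _ _)⟩).1.le)
    have hr' : r ∈ Ioo 0 r₀ := ⟨hr.1, hr.2.trans_le (min_le_left _ _)⟩
    filter_upwards [Ioo_mem_nhdsGT hr.1] with s hs
    have hs' : s ∈ Ioo 0 r₀ := ⟨hs.1, hs.2.trans hr'.2⟩
    rw [Real.dist_eq, sub_zero, abs_of_pos (hpos s hs')]
    exact (hmono hs' hr' hs.2).trans hrε
  refine ⟨h.mem_Ioo, hpos, fun r hr => ?_, fun r hr => ?_, hlim, ?_, h.initial⟩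
  · rw [g_rpow hβ (hf _ (h.mem_Ioo r hr))]
    exact hdF r hr
  · rw [← deriv_eq_slope_of_flux_pos hβ hr.1 (hpos r hr)]
    exact (hd r hr).hasDerivAt
  · have h1 := (h.continuousOn 0 ⟨le_rfl, hr₀⟩).tendsto
    rw [h.initial] at h1
    refine h1.mono_left (nhdsWithin_le_of_mem ?_)
    filter_upwards [Ioo_mem_nhdsGT hr₀] with x hx using ⟨hx.1.le, hx.2⟩

/-- The second derivative of a solution. -/
def curvature (α β γ : ℝ) (f : ℝ → ℝ) (r u F : ℝ) : ℝ :=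
  -(α / β) * r ^ (-(α / β) - 1) * F ^ (1 / β)
    + r ^ (-(α / β)) * (r ^ (γ - 1) / f u * (1 / β) * F ^ (1 / β - 1))

lemma Sol.hasDerivAt_slope {g : ℝ → ℝ} (h : Sol α β γ ubar g a r₀ u F) {r : ℝ}
    (hr : r ∈ Ioo 0 r₀) : HasDerivAt (fun r => slope α β r (F r))
      (curvature α β γ (fun x => g x ^ β) r (u r) (F r)) r :=
  (Real.hasDerivAt_rpow_const (Or.inl hr.1.ne')).mul
    ((h.dF r hr).rpow_const (Or.inl (h.F_pos r hr).ne'))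

lemma Sol.continuousOn {g : ℝ → ℝ} (h : Sol α β γ ubar g a r₀ u F) :
    ContinuousOn u (Ico 0 r₀) := by
  intro r hr
  rcases hr.1.eq_or_lt with h0 | h0
  · rw [← h0]
    have h1 : ContinuousWithinAt u (Ioi 0) 0 := by
      rw [ContinuousWithinAt, h.init]; exact h.u_lim
    exact (continuousWithinAt_Ioi_iff_Ici.1 h1).mono (fun x hx => hx.1)
  · exact (h.du r ⟨h0, hr.2⟩).continuousAt.continuousWithinAt

/-- The explicit u' = `slope` can be differentiated, and the resulting `curvature` is continuous
along u and F; this gives the C² regularity. -/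
lemma Sol.isSolution (h : Sol α β γ ubar (g f β) a r₀ u F) (e : Exponents α β γ)
    (hg : Convexlike ubar (g f β)) (hf : ∀ x ∈ Ioo 0 ubar, 0 < f x) :
    IsSolution α β γ ubar f a r₀ u := by
  have hβ := e.β_pos
  have hder : ∀ r ∈ Ioo 0 r₀, deriv u r = slope α β r (F r) := fun r hr => (h.du r hr).deriv
  have hflux : ∀ r ∈ Ioo 0 r₀, flux α β u r = F r := fun r hr => by
    have hs := slope_pos (α := α) (β := β) hr.1 (h.F_pos r hr)
    unfold flux
    rw [hder r hr, abs_of_pos hs, mul_assoc, ← Real.rpow_add_one hs.ne', sub_add_cancel,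
      slope_rpow hβ hr.1 (h.F_pos r hr), ← mul_assoc, ← Real.rpow_add hr.1, add_neg_cancel,
      Real.rpow_zero, one_mul]
  have hfluxd : ∀ r ∈ Ioo 0 r₀, HasDerivAt (flux α β u) (r ^ (γ - 1) / f (u r)) r :=
    fun r hr => by
    have h1 := h.dF r hr
    rw [g_rpow hβ (hf _ (h.mem r hr))] at h1
    refine h1.congr_of_eventuallyEq ?_
    filter_upwards [Ioo_mem_nhds hr.1 hr.2] with s hs using hflux s hs
  refine ⟨?_, h.continuousOn, h.mem, h.init, fun r hr => (hfluxd r hr).differentiableAt,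
    fun r hr => ?_⟩
  · have h1 : ContDiffOn ℝ 1 (deriv u) (Ioo 0 r₀) := by
      rw [show (1 : WithTop ℕ∞) = 0 + 1 from rfl, contDiffOn_succ_iff_deriv_of_isOpen isOpen_Ioo]
      have hdd : ∀ r ∈ Ioo 0 r₀, HasDerivAt (deriv u)
          (curvature α β γ (fun x => g f β x ^ β) r (u r) (F r)) r := fun r hr => by
        refine (h.hasDerivAt_slope hr).congr_of_eventuallyEq ?_
        filter_upwards [Ioo_mem_nhds hr.1 hr.2] with s hs using hder s hs
      refine ⟨fun r hr => (hdd r hr).differentiableAt.differentiableWithinAt, by simp, ?_⟩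
      rw [contDiffOn_zero]
      have hcongr : EqOn (deriv (deriv u))
          (fun r => curvature α β γ (fun x => g f β x ^ β) r (u r) (F r)) (Ioo 0 r₀) :=
        fun r hr => (hdd r hr).deriv
      refine ContinuousOn.congr ?_ hcongr
      intro r hr
      have c1 := h.F_pos r hr
      have c2 := (h.dF r hr).continuousAt
      have c3 := (h.du r hr).continuousAt
      have c4 : ContinuousAt (fun r => g f β (u r)) r :=
        ContinuousAt.comp (g := g f β) (hg.d1 _ (h.mem r hr)).continuousAt c3
      have c5 := hg.pos _ (h.mem r hr)
      have c6 : ∀ p : ℝ, ContinuousAt (fun r : ℝ => r ^ p) r := fun p =>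
        Real.continuousAt_rpow_const r p (Or.inl hr.1.ne')
      have c7 : ∀ p : ℝ, ContinuousAt (fun r : ℝ => F r ^ p) r := fun p =>
        c2.rpow_const (Or.inl c1.ne')
      unfold curvature
      refine ContinuousAt.continuousWithinAt ?_
      exact ((continuousAt_const.mul (c6 _)).mul (c7 _)).add ((c6 _).mul
        ((((c6 _).div (c4.rpow_const (Or.inl c5.ne'))
          (Real.rpow_pos_of_pos c5 _).ne').mul continuousAt_const).mul (c7 _)))
    rw [show (2 : WithTop ℕ∞) = 1 + 1 from rfl, contDiffOn_succ_iff_deriv_of_isOpen isOpen_Ioo]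
    exact ⟨fun r hr => (h.du r hr).differentiableAt.differentiableWithinAt, by simp, h1⟩
  · change r ^ (-(γ - 1)) * deriv (flux α β u) r = _
    rw [(hfluxd r hr).deriv, Real.rpow_neg hr.1.le]
    have h3 : (0 : ℝ) < r ^ (γ - 1) := Real.rpow_pos_of_pos hr.1 _
    field_simp

end MEMS

end

/-! ### The integral operator for regular solutions -/

noncomputable section

namespace MEMS

/-- The bounds under which the integral operator is a contraction. -/
structure Kernel (Φ : ℝ → ℝ) (m K : ℝ) : Prop where
  m_pos : 0 < m
  lower : ∀ x, m ≤ Φ x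
  lip : ∀ x y, |Φ x - Φ y| ≤ K * |x - y|

/-- The averaged source `∫₀¹ σ ^ (γ - 1) Φ(u(sσ)) dσ`. -/
def avg (γ : ℝ) (Φ u : ℝ → ℝ) (s : ℝ) : ℝ := ∫ σ in (0 : ℝ)..1, σ ^ (γ - 1) * Φ (u (s * σ))

/-- The integral operator whose fixed points are the regular solutions. -/
def volt (α β γ a : ℝ) (Φ u : ℝ → ℝ) (r : ℝ) : ℝ :=
  a + ∫ s in (0 : ℝ)..r, s ^ (theta α β γ - 1) * avg γ Φ u s ^ (1 / β)

variable {α β γ a m K : ℝ} {Φ u v : ℝ → ℝ}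

namespace Kernel

lemma continuous (k : Kernel Φ m K) : Continuous Φ := by
  have hK : 0 ≤ K := by
    have := (abs_nonneg _).trans (k.lip 1 0)
    simpa using this
  refine (LipschitzWith.of_dist_le_mul (K := K.toNNReal) fun x y => ?_).continuous
  rw [Real.dist_eq, Real.dist_eq, Real.coe_toNNReal _ hK]
  exact k.lip x y

lemma K_nonneg (k : Kernel Φ m K) : 0 ≤ K := by
  have := (abs_nonneg _).trans (k.lip 1 0)
  simpa using this

end Kernel

lemma integral_rpow_unit (hγ : 0 < γ) : ∫ σ in (0 : ℝ)..1, σ ^ (γ - 1) = 1 / γ := by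
  rw [integral_rpow (Or.inl (by linarith)), sub_add_cancel, Real.one_rpow,
    Real.zero_rpow hγ.ne', sub_zero]

lemma continuous_avg_integrand (hγ : 1 ≤ γ) (hΦ : Continuous Φ) (hu : Continuous u) :
    Continuous (fun p : ℝ × ℝ => p.2 ^ (γ - 1) * Φ (u (p.1 * p.2))) := by
  have h1 : Continuous (fun p : ℝ × ℝ => p.2 ^ (γ - 1)) :=
    continuous_snd.rpow_const (fun _ => Or.inr (by linarith))
  exact h1.mul (hΦ.comp (hu.comp (continuous_fst.mul continuous_snd)))

lemma continuous_avg (hγ : 1 ≤ γ) (hΦ : Continuous Φ) (hu : Continuous u) :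
    Continuous (avg γ Φ u) :=
  intervalIntegral.continuous_parametric_intervalIntegral_of_continuous'
    (f := fun s σ => σ ^ (γ - 1) * Φ (u (s * σ))) (continuous_avg_integrand hγ hΦ hu) 0 1

lemma intervalIntegrable_avg (hγ : 1 ≤ γ) (hΦ : Continuous Φ) (hu : Continuous u) (s : ℝ) :
    IntervalIntegrable (fun σ => σ ^ (γ - 1) * Φ (u (s * σ))) MeasureTheory.volume 0 1 :=
  ((continuous_avg_integrand hγ hΦ hu).comp (by fun_prop : Continuous fun σ : ℝ => (s, σ))
    ).intervalIntegrable 0 1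

lemma avg_ge (hγ : 1 ≤ γ) (k : Kernel Φ m K) (hu : Continuous u) (s : ℝ) :
    m / γ ≤ avg γ Φ u s := by
  have h1 : ∫ σ in (0 : ℝ)..1, σ ^ (γ - 1) * m = m / γ := by
    rw [intervalIntegral.integral_mul_const, integral_rpow_unit (by linarith)]; ring
  rw [← h1]
  refine intervalIntegral.integral_mono_on zero_le_one
    (((continuous_id.rpow_const (fun _ => Or.inr (by linarith))).mul
      continuous_const).intervalIntegrable 0 1)
    (intervalIntegrable_avg hγ k.continuous hu s) (fun σ hσ => ?_)
  exact mul_le_mul_of_nonneg_left (k.lower _) (Real.rpow_nonneg hσ.1 _)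

lemma avg_pos (hγ : 1 ≤ γ) (k : Kernel Φ m K) (hu : Continuous u) (s : ℝ) :
    0 < avg γ Φ u s :=
  (div_pos k.m_pos (by linarith)).trans_le (avg_ge hγ k hu s)

lemma abs_avg_sub_le (hγ : 1 ≤ γ) (k : Kernel Φ m K) (hu : Continuous u) (hv : Continuous v)
    {s d : ℝ} (hd : ∀ x ∈ Icc 0 s, |u x - v x| ≤ d) (hs : 0 ≤ s) :
    |avg γ Φ u s - avg γ Φ v s| ≤ K * d / γ := by
  unfold avg
  rw [← intervalIntegral.integral_sub (intervalIntegrable_avg hγ k.continuous hu s)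
    (intervalIntegrable_avg hγ k.continuous hv s)]
  have h1 : ∫ σ in (0 : ℝ)..1, σ ^ (γ - 1) * (K * d) = K * d / γ := by
    rw [intervalIntegral.integral_mul_const, integral_rpow_unit (by linarith)]; ring
  rw [← h1, ← Real.norm_eq_abs]
  refine intervalIntegral.norm_integral_le_of_norm_le zero_le_one
    (Eventually.of_forall fun σ hσ => ?_) (((continuous_id.rpow_const
      (fun _ => Or.inr (by linarith))).mul continuous_const).intervalIntegrable 0 1)
  rw [← mul_sub, norm_mul, Real.norm_eq_abs, Real.norm_eq_abs,
    abs_of_nonneg (Real.rpow_nonneg hσ.1.le _)]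
  apply mul_le_mul_of_nonneg_left _ (Real.rpow_nonneg hσ.1.le _)
  refine (k.lip _ _).trans (mul_le_mul_of_nonneg_left (hd _ ⟨mul_nonneg hs hσ.1.le, ?_⟩)
    k.K_nonneg)
  exact mul_le_of_le_one_right hs hσ.2

lemma abs_rpow_sub_le {p b : ℝ} (hp : 0 < p) (hp1 : p ≤ 1) (hb : 0 < b) {x y : ℝ} (hx : b ≤ x)
    (hy : b ≤ y) : |x ^ p - y ^ p| ≤ p * b ^ (p - 1) * |x - y| := by
  have := (convex_Ici b).norm_image_sub_le_of_norm_hasDerivWithin_le (f := fun x : ℝ => x ^ p)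
    (f' := fun x => p * x ^ (p - 1)) (C := p * b ^ (p - 1)) (x := y) (y := x)
    (fun z hz => (Real.hasDerivAt_rpow_const (Or.inl (hb.trans_le hz).ne')).hasDerivWithinAt)
    (fun z hz => ?_) hy hx
  · simpa [Real.norm_eq_abs] using this
  · have hz0 : 0 < z := hb.trans_le hz
    rw [Real.norm_eq_abs, abs_of_nonneg (by positivity)]
    exact mul_le_mul_of_nonneg_left (Real.rpow_le_rpow_of_nonpos hb hz (by linarith)) hp.le

lemma continuous_volt_integrand (e : Exponents α β γ) (k : Kernel Φ m K) (hu : Continuous u) :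
    Continuous (fun s => s ^ (theta α β γ - 1) * avg γ Φ u s ^ (1 / β)) := by
  have hγ : 1 ≤ γ := by linarith [e.one_le, e.lt_α, e.lt_γ]
  have hβ := e.β_pos
  exact (continuous_id.rpow_const (fun _ => Or.inr (by linarith [e.one_lt_theta]))).mul
    ((continuous_avg hγ k.continuous hu).rpow_const (fun _ => Or.inr (by positivity)))

lemma continuous_volt (e : Exponents α β γ) (k : Kernel Φ m K) (hu : Continuous u) :
    Continuous (volt α β γ a Φ u) :=
  continuous_const.add (intervalIntegral.continuous_primitive
    (fun _ _ => (continuous_volt_integrand e k hu).intervalIntegrable _ _) 0)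

/-- The weight e^(κx), with κ large against the Lipschitz constant of the integrand, gives the
contraction factor 1/2 on all of [0, R] and for every a. The lower bound on Φ keeps x^(1/β)
Lipschitz. -/
lemma exists_volt_lipschitz (e : Exponents α β γ) (k : Kernel Φ m K) {R : ℝ} (hR : 0 < R) :
    ∃ κ > 0, ∀ (a : ℝ) (u v : ℝ → ℝ) (D : ℝ), Continuous u → Continuous v → 0 ≤ D →
      (∀ x ∈ Icc 0 R, |u x - v x| ≤ D * Real.exp (κ * x)) → ∀ r ∈ Icc 0 R,
        |volt α β γ a Φ u r - volt α β γ a Φ v r| ≤ 1 / 2 * D * Real.exp (κ * r) := by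
  have hγ : 1 ≤ γ := by linarith [e.one_le, e.lt_α, e.lt_γ]
  have hβ := e.β_pos
  have hθ := e.one_lt_theta
  have hb : 0 < m / γ := div_pos k.m_pos (by linarith)
  set C := R ^ (theta α β γ - 1) * (1 / β * (m / γ) ^ (1 / β - 1) * (K / γ)) with hC
  have hK := k.K_nonneg
  have hC0 : 0 ≤ C := by
    have := e.γ_pos
    positivity
  refine ⟨2 * C + 1, by linarith, ?_⟩
  set κ := 2 * C + 1 with hκ
  have hκpos : 0 < κ := by linarith
  intro a u v D hu hv hD huv r hr
  have h1 : volt α β γ a Φ u r - volt α β γ a Φ v r = ∫ s in (0 : ℝ)..r,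
      (s ^ (theta α β γ - 1) * avg γ Φ u s ^ (1 / β)
        - s ^ (theta α β γ - 1) * avg γ Φ v s ^ (1 / β)) := by
    unfold volt
    rw [intervalIntegral.integral_sub ((continuous_volt_integrand e k hu).intervalIntegrable _ _)
      ((continuous_volt_integrand e k hv).intervalIntegrable _ _)]
    ring
  have h2 : ∫ s in (0 : ℝ)..r, C * D * Real.exp (κ * s)
      = C * D * ((Real.exp (κ * r) - 1) / κ) := by
    rw [intervalIntegral.integral_const_mul,
      intervalIntegral.integral_comp_mul_left (fun x => Real.exp x) hκpos.ne', integral_exp,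
      mul_zero, Real.exp_zero, smul_eq_mul, inv_mul_eq_div]
  have h3 : ‖∫ s in (0 : ℝ)..r, (s ^ (theta α β γ - 1) * avg γ Φ u s ^ (1 / β)
        - s ^ (theta α β γ - 1) * avg γ Φ v s ^ (1 / β))‖
      ≤ ∫ s in (0 : ℝ)..r, C * D * Real.exp (κ * s) := by
    refine intervalIntegral.norm_integral_le_of_norm_le hr.1
      (Eventually.of_forall fun s hs => ?_)
      ((by fun_prop : Continuous fun s => C * D * Real.exp (κ * s)).intervalIntegrable _ _)
    have hs0 := hs.1
    have hsR := hs.2.trans hr.2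
    have i1 : |avg γ Φ u s - avg γ Φ v s| ≤ K * (D * Real.exp (κ * s)) / γ :=
      abs_avg_sub_le hγ k hu hv (fun x hx => (huv x ⟨hx.1, hx.2.trans hsR⟩).trans (by
        have := hx.2
        gcongr)) hs0.le
    have i2 := abs_rpow_sub_le (p := 1 / β) (by positivity)
      (by rw [div_le_one hβ]; exact e.one_le) hb (avg_ge hγ k hu s) (avg_ge hγ k hv s)
    have i3 : s ^ (theta α β γ - 1) ≤ R ^ (theta α β γ - 1) := by
      apply Real.rpow_le_rpow hs0.le hsR; linarith
    have := e.γ_pos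
    rw [← mul_sub, norm_mul, Real.norm_eq_abs, Real.norm_eq_abs,
      abs_of_nonneg (Real.rpow_nonneg hs0.le _)]
    calc s ^ (theta α β γ - 1) * |avg γ Φ u s ^ (1 / β) - avg γ Φ v s ^ (1 / β)|
        ≤ R ^ (theta α β γ - 1) * (1 / β * (m / γ) ^ (1 / β - 1)
          * (K * (D * Real.exp (κ * s)) / γ)) := by
          gcongr
          exact i2.trans (by gcongr)
      _ = C * D * Real.exp (κ * s) := by rw [hC]; ring
  rw [h1, ← Real.norm_eq_abs]
  refine h3.trans ?_
  rw [h2]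
  have h4 : C / κ ≤ 1 / 2 := by rw [div_le_iff₀ hκpos]; linarith
  have h5 := Real.exp_pos (κ * r)
  calc C * D * ((Real.exp (κ * r) - 1) / κ) = C / κ * D * (Real.exp (κ * r) - 1) := by ring
    _ ≤ C / κ * D * Real.exp (κ * r) := by gcongr; linarith
    _ ≤ 1 / 2 * D * Real.exp (κ * r) := by gcongr

/-- Uniqueness of fixed points of the integral operator. -/
lemma volt_unique (e : Exponents α β γ) (k : Kernel Φ m K) {R : ℝ} (hR : 0 < R)
    (hu : Continuous u) (hv : Continuous v) (hu' : ∀ r ∈ Icc 0 R, u r = volt α β γ a Φ u r)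
    (hv' : ∀ r ∈ Icc 0 R, v r = volt α β γ a Φ v r) : EqOn u v (Icc 0 R) := by
  obtain ⟨κ, hκ, H⟩ := exists_volt_lipschitz e k hR
  obtain ⟨x₀, hx₀, hmax⟩ := (isCompact_Icc (a := (0 : ℝ)) (b := R)).exists_isMaxOn
    ⟨0, le_rfl, hR.le⟩ (f := fun x => |u x - v x| * Real.exp (-(κ * x)))
    (by fun_prop : Continuous _).continuousOn
  set D := |u x₀ - v x₀| * Real.exp (-(κ * x₀)) with hD
  have hD0 : 0 ≤ D := by positivity
  have hbd : ∀ x ∈ Icc 0 R, |u x - v x| ≤ D * Real.exp (κ * x) := by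
    intro x hx
    have h1 : |u x - v x| * Real.exp (-(κ * x)) ≤ D := hmax hx
    rw [Real.exp_neg] at h1
    exact (mul_inv_le_iff₀ (Real.exp_pos _)).1 h1
  have h2 := H a u v D hu hv hD0 hbd x₀ hx₀
  rw [← hu' x₀ hx₀, ← hv' x₀ hx₀] at h2
  have h3 : |u x₀ - v x₀| = D * Real.exp (κ * x₀) := by
    rw [hD, Real.exp_neg]; field_simp
  have h4 : D = 0 := by
    have h5 := Real.exp_pos (κ * x₀)
    rw [h3] at h2
    nlinarith
  intro x hx
  have h5 := hbd x hx
  rw [h4, zero_mul] at h5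
  exact sub_eq_zero.1 (abs_nonpos_iff.1 h5)

/-- Existence of fixed points of the integral operator. -/
lemma volt_exists (e : Exponents α β γ) (k : Kernel Φ m K) {R : ℝ} (hR : 0 < R) (a : ℝ) :
    ∃ u : ℝ → ℝ, Continuous u ∧ ∀ r ∈ Icc 0 R, u r = volt α β γ a Φ u r := by
  obtain ⟨κ, hκ, H⟩ := exists_volt_lipschitz e k hR
  -- The unknown is w = e^(-κx) u, so that the usual sup metric of w is the weighted metric of u.
  set E : C(Icc (0 : ℝ) R, ℝ) → ℝ → ℝ :=
    fun w x => Real.exp (κ * x) * IccExtend hR.le w x with hE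
  have hEc : ∀ w, Continuous (E w) := fun w =>
    (by fun_prop : Continuous fun x => Real.exp (κ * x)).mul w.continuous.Icc_extend'
  set N : C(Icc (0 : ℝ) R, ℝ) → C(Icc (0 : ℝ) R, ℝ) := fun w =>
    ⟨fun x => Real.exp (-(κ * x)) * volt α β γ a Φ (E w) x,
      (by fun_prop : Continuous fun x : Icc (0 : ℝ) R => Real.exp (-(κ * (x : ℝ)))).mul
        ((continuous_volt e k (hEc w)).comp continuous_subtype_val)⟩ with hN
  have hcontr : ContractingWith (1 / 2) N := by
    refine ⟨by rw [← NNReal.coe_lt_coe]; norm_num, LipschitzWith.of_dist_le_mul fun w w' => ?_⟩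
    rw [ContinuousMap.dist_le (by positivity)]
    intro x
    have h1 := H a (E w) (E w') (dist w w') (hEc w) (hEc w') dist_nonneg (fun y hy => by
      simp only [hE]
      rw [← mul_sub, abs_mul, abs_of_pos (Real.exp_pos _), mul_comm, IccExtend_of_mem _ _ hy,
        IccExtend_of_mem _ _ hy, ← Real.dist_eq]
      exact mul_le_mul_of_nonneg_right (ContinuousMap.dist_apply_le_dist _) (Real.exp_pos _).le)
      x x.2
    simp only [hN, ContinuousMap.coe_mk, Real.dist_eq]
    rw [← mul_sub, abs_mul, abs_of_pos (Real.exp_pos _), Real.exp_neg]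
    rw [inv_mul_le_iff₀ (Real.exp_pos _)]
    refine h1.trans (le_of_eq ?_)
    push_cast
    ring
  set w := hcontr.fixedPoint N
  have hw : N w = w := hcontr.fixedPoint_isFixedPt
  refine ⟨E w, hEc w, fun r hr => ?_⟩
  have h1 := congrArg (fun w' : C(Icc (0 : ℝ) R, ℝ) => w' ⟨r, hr⟩) hw
  simp only [hN, ContinuousMap.coe_mk] at h1
  have h2 : E w r = Real.exp (κ * r) * w ⟨r, hr⟩ := by
    simp only [hE]; rw [IccExtend_of_mem _ _ hr]
  rw [h2, ← h1, Real.exp_neg]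
  field_simp

/-- The substitution t = rσ identifies r^γ times the average with the flux. The averaged form
removes the singular weight r^(-(α/β)) and is continuous up to r = 0. -/
lemma pow_mul_avg {r : ℝ} (hr : 0 < r) :
    r ^ γ * avg γ Φ u r = ∫ t in (0 : ℝ)..r, t ^ (γ - 1) * Φ (u t) := by
  have h1 := intervalIntegral.integral_comp_mul_left (a := 0) (b := 1)
    (fun t => t ^ (γ - 1) * Φ (u t)) hr.ne'
  rw [mul_zero, mul_one, smul_eq_mul] at h1
  have h2 : ∫ σ in (0 : ℝ)..1, (r * σ) ^ (γ - 1) * Φ (u (r * σ)) = r ^ (γ - 1) * avg γ Φ u r := by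
    unfold avg
    rw [← intervalIntegral.integral_const_mul]
    refine intervalIntegral.integral_congr (fun σ hσ => ?_)
    rw [uIcc_of_le zero_le_one] at hσ
    rw [Real.mul_rpow hr.le hσ.1]; ring
  rw [h2] at h1
  have h3 : r ^ γ = r * r ^ (γ - 1) := by rw [Real.rpow_sub hr, Real.rpow_one]; field_simp
  rw [h3, mul_assoc, h1]
  field_simp

lemma hasDerivAt_pow_mul_avg (hγ : 1 ≤ γ) (hΦ : Continuous Φ) (hu : Continuous u) {r : ℝ}
    (hr : 0 < r) :
    HasDerivAt (fun r => r ^ γ * avg γ Φ u r) (r ^ (γ - 1) * Φ (u r)) r := by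
  have hc : Continuous (fun t => t ^ (γ - 1) * Φ (u t)) :=
    (continuous_id.rpow_const (fun _ => Or.inr (by linarith))).mul (hΦ.comp hu)
  have h1 : HasDerivAt (fun r => ∫ t in (0 : ℝ)..r, t ^ (γ - 1) * Φ (u t))
      (r ^ (γ - 1) * Φ (u r)) r :=
    intervalIntegral.integral_hasDerivAt_right (hc.intervalIntegrable _ _)
      hc.stronglyMeasurable.stronglyMeasurableAtFilter hc.continuousAt
  refine h1.congr_of_eventuallyEq ?_
  filter_upwards [Ioi_mem_nhds hr] with s hs using pow_mul_avg hs

lemma hasDerivAt_volt (e : Exponents α β γ) (k : Kernel Φ m K) (hu : Continuous u) {r : ℝ}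
    (hr : 0 < r) :
    HasDerivAt (volt α β γ a Φ u) (slope α β r (r ^ γ * avg γ Φ u r)) r := by
  have hγ : 1 ≤ γ := by linarith [e.one_le, e.lt_α, e.lt_γ]
  have hc := continuous_volt_integrand e k hu
  rw [mul_comm (r ^ γ), slope_power hr (avg_pos hγ k hu r), mul_comm]
  exact (intervalIntegral.integral_hasDerivAt_right (hc.intervalIntegrable _ _)
    hc.stronglyMeasurable.stronglyMeasurableAtFilter hc.continuousAt).const_add a

lemma tendsto_pow_mul_avg (hγ : 1 ≤ γ) (hΦ : Continuous Φ) (hu : Continuous u) :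
    Tendsto (fun r => r ^ γ * avg γ Φ u r) (𝓝[>] 0) (𝓝 0) := by
  have h1 : Continuous (fun r : ℝ => r ^ γ * avg γ Φ u r) :=
    (continuous_id.rpow_const (fun _ => Or.inr (by linarith))).mul (continuous_avg hγ hΦ hu)
  have h2 := h1.tendsto 0
  simp only [Real.zero_rpow (by linarith : γ ≠ 0), zero_mul] at h2
  exact h2.mono_left nhdsWithin_le_nhds

lemma eq_of_hasDerivAt_zero {φ : ℝ → ℝ} {c r₀ r : ℝ} (hd : ∀ x ∈ Ioo 0 r₀, HasDerivAt φ 0 x)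
    (hlim : Tendsto φ (𝓝[>] 0) (𝓝 c)) (hr : r ∈ Ioo 0 r₀) : φ r = c := by
  apply le_antisymm
  · have := le_of_monotoneOn_of_tendsto (φ := fun x => -φ x) (ψ := fun x => -φ x) (c := -c)
      (monotoneOn_of_hasDerivAt_nonneg (convex_Ioo 0 r₀) (fun x hx => (hd x hx).neg) (by simp))
      hr (fun _ _ => le_rfl) hlim.neg
    linarith
  · exact le_of_monotoneOn_of_tendsto
      (monotoneOn_of_hasDerivAt_nonneg (convex_Ioo 0 r₀) hd (by simp))
      hr (fun _ _ => le_rfl) hlim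

end MEMS

end

/-! ### Existence and uniqueness of regular solutions on a common interval -/

noncomputable section

namespace MEMS

/-- A radius `R` up to which all solutions with small initial value stay below `u₁`. -/
structure Setup (α β γ ubar : ℝ) (g : ℝ → ℝ) (u₁ R : ℝ) : Prop where
  e : Exponents α β γ
  hg : Convexlike ubar g
  hu₁ : u₁ ∈ Ioo 0 ubar
  hell : ∀ x ∈ Ioo 0 u₁, ell g x ≤ 1
  R_pos : 0 < R
  hR : ∀ r ∈ Ioc 0 R, lowConst α β γ * r ^ theta α β γ < prim g u₁
  hsmall : ∀ r ∈ Ioc 0 R, Sol.upConst α β γ * ulow α β γ ubar g r ≤ u₁ / 3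

variable {α β γ ubar a u₁ R r₀ : ℝ} {g : ℝ → ℝ}

lemma tendsto_ulow (e : Exponents α β γ) (hg : Convexlike ubar g) :
    Tendsto (ulow α β γ ubar g) (𝓝[>] 0) (𝓝 0) := by
  rw [Metric.tendsto_nhds]
  intro ε hε
  set x := min (ε / 2) (ubar / 2) with hx
  have hub := hg.ubar_pos
  have hx0 : x ∈ Ioo 0 ubar := ⟨lt_min (by linarith) (by linarith),
    (min_le_right _ _).trans_lt (by linarith)⟩
  obtain ⟨R, hR, H⟩ := exists_radius e (hg.prim_pos hx0)
  filter_upwards [Ioc_mem_nhdsGT hR] with r hr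
  have h1 := (hg.ulow_spec e hx0 hr.1 (H r hr)).1
  rw [Real.dist_eq, sub_zero, abs_of_pos h1.1]
  exact (h1.2.trans_le (min_le_left _ _)).trans (by linarith)

lemma exists_setup (e : Exponents α β γ) (hg : Convexlike ubar g) (hu₁ : u₁ ∈ Ioo 0 ubar)
    (hell : ∀ x ∈ Ioo 0 u₁, ell g x ≤ 1) : ∃ R, Setup α β γ ubar g u₁ R := by
  obtain ⟨R, hR, H⟩ := exists_radius e (hg.prim_pos hu₁)
  have h1 := (tendsto_ulow e hg).const_mul (Sol.upConst α β γ)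
  rw [mul_zero] at h1
  obtain ⟨R', hR', H'⟩ := mem_nhdsGT_iff_exists_Ioc_subset.1
    (h1.eventually_lt_const (show 0 < u₁ / 3 by linarith [hu₁.1]))
  refine ⟨min R R', e, hg, hu₁, hell, lt_min hR hR', fun r hr => ?_, fun r hr => ?_⟩
  · exact H r ⟨hr.1, hr.2.trans (min_le_left _ _)⟩
  · exact le_of_lt (H' ⟨hr.1, hr.2.trans (min_le_right _ _)⟩)

namespace Setup

variable {u F v F' : ℝ → ℝ}

lemma sol_le (s : Setup α β γ ubar g u₁ R) (h : Sol α β γ ubar g a r₀ u F) (hr₀ : r₀ ≤ R)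
    {r : ℝ} (hr : r ∈ Ioo 0 r₀) : u r ≤ a + u₁ / 3 := by
  have := h.le_ulow s.e s.hg s.hu₁ s.hell
    (fun r hr => s.hR r ⟨hr.1, hr.2.le.trans hr₀⟩) hr
  linarith [s.hsmall r ⟨hr.1, hr.2.le.trans hr₀⟩]

lemma sol_mem (s : Setup α β γ ubar g u₁ R) (h : Sol α β γ ubar g a r₀ u F) (hr₀ : r₀ ≤ R)
    (ha : a < u₁ / 2) {r : ℝ} (hr : r ∈ Ioo 0 r₀) : u r ∈ Ioo 0 u₁ :=
  ⟨(h.mem r hr).1, (s.sol_le h hr₀ hr).trans_lt (by linarith [s.hu₁.1])⟩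

/-- The truncated source. -/
def truncSource (β : ℝ) (g : ℝ → ℝ) (a u₁ x : ℝ) : ℝ := (g (max a (min x u₁)) ^ β)⁻¹

lemma truncSource_eq {x : ℝ} (h1 : a ≤ x) (h2 : x ≤ u₁) :
    truncSource β g a u₁ x = (g x ^ β)⁻¹ := by
  unfold truncSource
  rw [min_eq_left h2, max_eq_right h1]

/-- Clamping the argument to [a, u₁] keeps g away from 0; monotonicity of g and g' puts the extreme
values at the endpoints. -/
lemma exists_kernel (s : Setup α β γ ubar g u₁ R) (ha : a ∈ Ioo 0 u₁) :
    ∃ m K, Kernel (truncSource β g a u₁) m K := by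
  have hβ := s.e.β_pos
  have hsub : ∀ x ∈ Icc a u₁, x ∈ Ioo 0 ubar := fun x hx =>
    ⟨ha.1.trans_le hx.1, hx.2.trans_lt s.hu₁.2⟩
  have hclamp : ∀ x, max a (min x u₁) ∈ Icc a u₁ := fun x =>
    ⟨le_max_left _ _, max_le ha.2.le (min_le_right _ _)⟩
  have hga := s.hg.pos a ⟨ha.1, ha.2.trans s.hu₁.2⟩
  have hgu := s.hg.pos u₁ s.hu₁
  have hmono : ∀ x ∈ Icc a u₁, g x ≤ g u₁ := fun x hx => s.hg.strictMonoOn.monotoneOn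
    ⟨(hsub x hx).1.le, (hsub x hx).2⟩ ⟨s.hu₁.1.le, s.hu₁.2⟩ hx.2
  have hmono' : ∀ x ∈ Icc a u₁, g a ≤ g x := fun x hx => s.hg.strictMonoOn.monotoneOn
    ⟨ha.1.le, ha.2.trans s.hu₁.2⟩ ⟨(hsub x hx).1.le, (hsub x hx).2⟩ hx.1
  set K := deriv g u₁ * (β * g a ^ (-β - 1)) with hK
  have hd1 := s.hg.d1_pos u₁ s.hu₁
  have hKpos : 0 < K := by positivity
  refine ⟨(g u₁ ^ β)⁻¹, K, by positivity, fun x => ?_, fun x y => ?_⟩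
  · unfold truncSource
    have := s.hg.pos _ (hsub _ (hclamp x))
    gcongr
    exact hmono _ (hclamp x)
  · have h1 := (convex_Icc a u₁).norm_image_sub_le_of_norm_hasDerivWithin_le
      (f := fun x => g x ^ (-β)) (f' := fun x => deriv g x * (-β) * g x ^ (-β - 1)) (C := K)
      (x := max a (min y u₁)) (y := max a (min x u₁))
      (fun z hz => ((s.hg.d1 z (hsub z hz)).rpow_const
        (Or.inl (s.hg.pos z (hsub z hz)).ne')).hasDerivWithinAt)
      (fun z hz => ?_) (hclamp y) (hclamp x)
    · have h2 : |max a (min x u₁) - max a (min y u₁)| ≤ |x - y| := by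
        have := ((LipschitzWith.id (α := ℝ)).min_const u₁).const_max a
        have := this.dist_le_mul x y
        simpa [Real.dist_eq] using this
      have h3 : ∀ x, truncSource β g a u₁ x = g (max a (min x u₁)) ^ (-β) := fun x => by
        unfold truncSource
        rw [Real.rpow_neg (s.hg.pos _ (hsub _ (hclamp x))).le]
      rw [h3, h3, ← Real.norm_eq_abs]
      exact h1.trans (mul_le_mul_of_nonneg_left h2 hKpos.le)
    · have i1 := s.hg.pos z (hsub z hz)
      have i2 := s.hg.d1_pos z (hsub z hz)
      have i3 : deriv g z ≤ deriv g u₁ := s.hg.strictMonoOn_deriv.monotoneOn (hsub z hz) s.hu₁ hz.2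
      have i4 : g z ^ (-β - 1) ≤ g a ^ (-β - 1) :=
        Real.rpow_le_rpow_of_nonpos hga (hmono' z hz) (by linarith)
      rw [norm_mul, norm_mul, norm_neg, Real.norm_of_nonneg i2.le, Real.norm_of_nonneg hβ.le,
        Real.norm_of_nonneg (Real.rpow_nonneg i1.le _), mul_assoc]
      exact mul_le_mul i3 (mul_le_mul_of_nonneg_left i4 hβ.le) (by positivity) hd1.le

lemma sol_of_fixed (s : Setup α β γ ubar g u₁ R) (ha : a ∈ Ioo 0 u₁) {m K : ℝ}
    (k : Kernel (truncSource β g a u₁) m K) (hu : Continuous u)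
    (hfix : ∀ r ∈ Icc 0 R, u r = volt α β γ a (truncSource β g a u₁) u r) {r₁ : ℝ}
    (hr₁ : r₁ ≤ R) (hlt : ∀ r ∈ Ioo 0 r₁, u r < u₁) :
    Sol α β γ ubar g a r₁ u (fun r => r ^ γ * avg γ (truncSource β g a u₁) u r) := by
  have hγ : 1 ≤ γ := by linarith [s.e.one_le, s.e.lt_α, s.e.lt_γ]
  have h0 : u 0 = a := by
    rw [hfix 0 ⟨le_rfl, s.R_pos.le⟩]; simp [volt]
  have hdu : ∀ r ∈ Ioo 0 R, HasDerivAt u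
      (slope α β r (r ^ γ * avg γ (truncSource β g a u₁) u r)) r := fun r hr => by
    refine (hasDerivAt_volt (a := a) s.e k hu hr.1).congr_of_eventuallyEq ?_
    filter_upwards [Ioo_mem_nhds hr.1 hr.2] with x hx using hfix x ⟨hx.1.le, hx.2.le⟩
  have hFpos : ∀ r, 0 < r → 0 < r ^ γ * avg γ (truncSource β g a u₁) u r := fun r hr =>
    mul_pos (Real.rpow_pos_of_pos hr _) (avg_pos hγ k hu r)
  have hlim : Tendsto u (𝓝[>] 0) (𝓝 a) := by
    rw [← h0]
    exact (hu.tendsto 0).mono_left nhdsWithin_le_nhds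
  have hge : ∀ r ∈ Ioo 0 R, a ≤ u r := fun r hr =>
    le_of_monotoneOn_of_tendsto (monotoneOn_of_hasDerivAt_nonneg (convex_Ioo 0 R) hdu
      (fun x hx => (slope_pos hx.1 (hFpos x hx.1)).le)) hr (fun _ _ => le_rfl) hlim
  have hsub : ∀ r ∈ Ioo 0 r₁, r ∈ Ioo 0 R := fun r hr => ⟨hr.1, hr.2.trans_le hr₁⟩
  refine ⟨fun r hr => ⟨ha.1.trans_le (hge r (hsub r hr)), (hlt r hr).trans s.hu₁.2⟩,
    fun r hr => hFpos r hr.1, fun r hr => ?_, fun r hr => hdu r (hsub r hr),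
    tendsto_pow_mul_avg hγ k.continuous hu, hlim, h0⟩
  refine (hasDerivAt_pow_mul_avg hγ k.continuous hu hr.1).congr_deriv ?_
  rw [truncSource_eq (hge r (hsub r hr)) (hlt r hr).le, div_eq_mul_inv]

/-- Existence of regular solutions on a common interval. -/
lemma exists_regular (s : Setup α β γ ubar g u₁ R) (ha : 0 < a) (ha₁ : a < u₁ / 2) :
    ∃ u F, Sol α β γ ubar g a R u F := by
  have hu₁ := s.hu₁.1
  have ha' : a ∈ Ioo 0 u₁ := ⟨ha, by linarith⟩
  obtain ⟨m, K, k⟩ := s.exists_kernel ha'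
  obtain ⟨u, hu, hfix⟩ := volt_exists s.e k s.R_pos a
  refine ⟨u, _, s.sol_of_fixed ha' k hu hfix le_rfl ?_⟩
  intro r₂ hr₂
  by_contra! hcon
  -- The first radius at which u reaches u₁. Before it u solves the untruncated problem, so `sol_le`
  -- caps it at a + u₁/3 < u₁, a contradiction.
  have hcomp : IsCompact (Icc 0 r₂ ∩ u ⁻¹' (Ici u₁)) :=
    isCompact_Icc.inter_right (isClosed_Ici.preimage hu)
  obtain ⟨r₁, ⟨hr₁I, hr₁u⟩, hmin⟩ := hcomp.exists_isLeast ⟨r₂, ⟨hr₂.1.le, le_rfl⟩, hcon⟩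
  have hr₁u' : u₁ ≤ u r₁ := hr₁u
  have h0 : u 0 = a := by
    rw [hfix 0 ⟨le_rfl, s.R_pos.le⟩]; simp [volt]
  have hr₁pos : 0 < r₁ := by
    rcases hr₁I.1.eq_or_lt with h | h
    · rw [← h, h0] at hr₁u'; linarith
    · exact h
  have hr₁R : r₁ ≤ R := hr₁I.2.trans hr₂.2.le
  have hlt : ∀ r ∈ Ioo 0 r₁, u r < u₁ := by
    intro r hr
    by_contra! hc
    exact absurd (hmin ⟨⟨hr.1.le, hr.2.le.trans hr₁I.2⟩, hc⟩) (not_le.2 hr.2)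
  have hs := s.sol_of_fixed ha' k hu hfix hr₁R hlt
  have hle : u r₁ ≤ a + u₁ / 3 := by
    refine le_of_tendsto ((hu.tendsto r₁).mono_left nhdsWithin_le_nhds : Tendsto u (𝓝[<] r₁) _) ?_
    filter_upwards [Ioo_mem_nhdsLT hr₁pos] with r hr using s.sol_le hs hr₁R hr
  linarith

/-- Every regular solution is a fixed point of the integral operator. -/
lemma fixed_of_sol (s : Setup α β γ ubar g u₁ R) (ha₁ : a < u₁ / 2) {m K : ℝ}
    (k : Kernel (truncSource β g a u₁) m K) (h : Sol α β γ ubar g a r₀ u F) (hr₀ : r₀ ≤ R)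
    (hv : Continuous v) {r₂ : ℝ} (hr₂ : r₂ ≤ r₀) (huv : EqOn v u (Ico 0 r₂)) {r : ℝ}
    (hr : r ∈ Ico 0 r₂) : v r = volt α β γ a (truncSource β g a u₁) v r := by
  have hγ : 1 ≤ γ := by linarith [s.e.one_le, s.e.lt_α, s.e.lt_γ]
  have hsub : ∀ x ∈ Ioo 0 r₂, x ∈ Ioo 0 r₀ := fun x hx => ⟨hx.1, hx.2.trans_le hr₂⟩
  have hΦ : ∀ x ∈ Ioo 0 r₂, truncSource β g a u₁ (v x) = (g (u x) ^ β)⁻¹ := fun x hx => by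
    rw [huv ⟨hx.1.le, hx.2⟩, truncSource_eq (h.le (hsub x hx))
      (s.sol_mem h hr₀ ha₁ (hsub x hx)).2.le]
  have hF : ∀ x ∈ Ioo 0 r₂, F x = x ^ γ * avg γ (truncSource β g a u₁) v x := by
    intro x hx
    have := eq_of_hasDerivAt_zero (r₀ := r₂) (c := 0 - 0)
      (φ := fun x => F x - x ^ γ * avg γ (truncSource β g a u₁) v x)
      (fun z hz => ?_) (h.F_lim.sub (tendsto_pow_mul_avg hγ k.continuous hv)) hx
    · linarith
    · refine ((h.dF z (hsub z hz)).sub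
        (hasDerivAt_pow_mul_avg hγ k.continuous hv hz.1)).congr_deriv ?_
      rw [hΦ z hz, div_eq_mul_inv, sub_self]
  have hcv := continuous_volt (a := a) s.e k hv
  have hv0 : volt α β γ a (truncSource β g a u₁) v 0 = a := by simp [volt]
  rw [huv hr]
  rcases hr.1.eq_or_lt with h0 | h0
  · rw [← h0, hv0, h.init]
  · have hlim : Tendsto (volt α β γ a (truncSource β g a u₁) v) (𝓝[>] 0) (𝓝 a) := by
      have := hcv.tendsto 0
      rw [hv0] at this
      exact this.mono_left nhdsWithin_le_nhds
    have := eq_of_hasDerivAt_zero (r₀ := r₂) (c := a - a)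
      (φ := fun x => u x - volt α β γ a (truncSource β g a u₁) v x)
      (fun z hz => ?_) (h.u_lim.sub hlim) ⟨h0, hr.2⟩
    · linarith
    · refine ((h.du z (hsub z hz)).sub (hasDerivAt_volt s.e k hv hz.1)).congr_deriv ?_
      rw [hF z hz, sub_self]

/-- Uniqueness of regular solutions. -/
lemma regular_unique (s : Setup α β γ ubar g u₁ R) (ha : 0 < a) (ha₁ : a < u₁ / 2)
    (h : Sol α β γ ubar g a r₀ u F) (h' : Sol α β γ ubar g a r₀ v F') (hr₀ : r₀ ≤ R) :
    EqOn u v (Ico 0 r₀) := by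
  intro r hr
  rcases hr.1.eq_or_lt with h0 | h0
  · rw [← h0, h.init, h'.init]
  obtain ⟨m, K, k⟩ := s.exists_kernel (a := a) ⟨ha, by linarith [s.hu₁.1]⟩
  obtain ⟨r₂, hr₂⟩ := exists_between hr.2
  have h2 : (0 : ℝ) ≤ r₂ := h0.le.trans hr₂.1.le
  have hsub : Icc 0 r₂ ⊆ Ico 0 r₀ := fun x hx => ⟨hx.1, hx.2.trans_lt hr₂.2⟩
  -- The operator acts on functions continuous on the whole line, while a solution is controlled
  -- only on [0, r₀); it is extended from [0, r₂] by constants.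
  have ext : ∀ {w F : ℝ → ℝ}, Sol α β γ ubar g a r₀ w F → ∃ w', Continuous w' ∧
      EqOn w' w (Ico 0 r₂) := fun {w F} hw =>
    ⟨IccExtend h2 ((Icc 0 r₂).domRestrict w), (continuousOn_iff_continuous_domRestrict.1
      (hw.continuousOn.mono hsub)).Icc_extend', fun x hx => by
      rw [IccExtend_of_mem _ _ ⟨hx.1, hx.2.le⟩]; rfl⟩
  obtain ⟨u', hu', huu⟩ := ext h
  obtain ⟨v', hv', hvv⟩ := ext h'
  have := volt_unique s.e k h0 hu' hv'
    (fun x hx => s.fixed_of_sol ha₁ k h hr₀ hu' hr₂.2.le huu ⟨hx.1, hx.2.trans_lt hr₂.1⟩)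
    (fun x hx => s.fixed_of_sol ha₁ k h' hr₀ hv' hr₂.2.le hvv ⟨hx.1, hx.2.trans_lt hr₂.1⟩)
    ⟨h0.le, le_rfl⟩
  rw [← huu ⟨h0.le, hr₂.1⟩, ← hvv ⟨h0.le, hr₂.1⟩, this]

end Setup

end MEMS

end

/-! ### Uniform closeness of solutions with small initial values -/

noncomputable section

namespace MEMS

lemma etaBound_pos {α β γ : ℝ} (e : Exponents α β γ) : 0 < Sol.etaBound α β γ := by
  have h1 : 0 < α - β := by linarith [e.lt_α]
  have := lowConst_pos e
  unfold Sol.etaBound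
  positivity

/-- All pairs of solutions with small initial values approach each other. -/
structure Stable (α β γ ubar : ℝ) (g : ℝ → ℝ) (u₁ R L : ℝ) (K C c T₁ τ : ℝ) : Prop
    extends Setup α β γ ubar g u₁ R where
  C_pos : 0 < C
  c_pos : 0 < c
  τ_pos : 0 < τ
  decay : ∀ {a b r₀ : ℝ} {u F v F' : ℝ → ℝ}, 0 < r₀ → r₀ ≤ R → a ∈ Ico 0 (u₁ / 2) →
    b ∈ Ico 0 (u₁ / 2) → Sol α β γ ubar g a r₀ u F → Sol α β γ ubar g b r₀ v F' → ∀ T₀,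
    prim g a < Real.exp (theta α β γ * T₀ - K) → prim g b < Real.exp (theta α β γ * T₀ - K) →
    ∀ r ∈ Ioo 0 r₀, T₀ + T₁ ≤ Real.log r →
      (Real.log (prim g (u r)) - Real.log (prim g (v r))) ^ 2
        ≤ C * Real.exp (-c * (Real.log r - (T₀ + T₁)))
  crossing : ∀ {a b r₀ : ℝ} {u F v F' : ℝ → ℝ}, 0 < r₀ → r₀ ≤ R → a ∈ Ico 0 (u₁ / 2) →
    b ∈ Ico 0 (u₁ / 2) → Sol α β γ ubar g a r₀ u F → Sol α β γ ubar g b r₀ v F' → ∀ T₀,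
    prim g a < Real.exp (theta α β γ * T₀ - K) → prim g b < Real.exp (theta α β γ * T₀ - K) →
    ((1 - L) * theta α β γ + (γ - L * β * theta α β γ)) ^ 2
      < 4 * (theta α β γ * (γ - L * β * theta α β γ)) →
    ∀ t, T₀ + T₁ ≤ t → t + τ < Real.log r₀ → ∃ x ∈ Icc t (t + τ), u (Real.exp x) = v (Real.exp x)

/-- The order of choices matters: `exists_pair` fixes the tolerance μ, which determines u₁ through
the regime of ℓ, and u₁ determines R. -/
lemma exists_stable {α β γ ubar q : ℝ} {g : ℝ → ℝ} (e : Exponents α β γ) (hg : Convexlike ubar g)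
    (hq : Tendsto (fun u => deriv g u ^ 2 / (g u * deriv (deriv g) u)) (𝓝[>] 0) (𝓝 q))
    (hq3 : q = 1 → ∀ᶠ u in 𝓝[>] (0 : ℝ), 1 ≤ deriv g u ^ 2 / (g u * deriv (deriv g) u))
    (hL : 0 < 1 / (2 - 1 / q)) (hL1 : 1 / (2 - 1 / q) ≤ 1) :
    ∃ u₁ R K C c T₁ τ, Stable α β γ ubar g u₁ R (1 / (2 - 1 / q)) K C c T₁ τ := by
  obtain ⟨K, C, hC, c, hc, μ, hμ, T₁, -, τ, hτ, H⟩ := exists_pair (-Real.log (lowConst α β γ))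
    e.one_le e.theta_pos e.mul_theta_lt hL hL1 (etaBound_pos e)
  obtain ⟨u₁, hu⟩ := hg.exists_regime hq hq3 hμ
  obtain ⟨R, s⟩ := exists_setup e hg ⟨hu.pos, hu.lt⟩ hu.ell_le
  have key := fun {a b r₀ : ℝ} {u F v F' : ℝ → ℝ} (hr₀ : 0 < r₀) (hr₀R : r₀ ≤ R)
      (ha : a ∈ Ico 0 (u₁ / 2)) (hb : b ∈ Ico 0 (u₁ / 2)) (h : Sol α β γ ubar g a r₀ u F)
      (h' : Sol α β γ ubar g b r₀ v F') (T₀ : ℝ) =>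
    have hmem : ∀ r ∈ Ioo 0 r₀, u r ∈ Ioo 0 u₁ := fun r hr => s.sol_mem h hr₀R ha.2 hr
    have hmem' : ∀ r ∈ Ioo 0 r₀, v r ∈ Ioo 0 u₁ := fun r hr => s.sol_mem h' hr₀R hb.2 hr
    have hlt : u₁ / 2 < ubar := by linarith [hu.pos, hu.lt]
    H (Real.log r₀) (prim g a) (prim g b) _ _ _ _ _ _ _ _
      (h.traj e hg hr₀ fun r hr => hu.ell_le _ (hmem r hr))
      (h'.traj e hg hr₀ fun r hr => hu.ell_le _ (hmem' r hr))
      (fun t ht => hu.near _ (hmem _ (Sol.exp_mem hr₀ ht)))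
      (fun t ht => hu.near _ (hmem' _ (Sol.exp_mem hr₀ ht)))
      (fun t ht => hu.abs_sub_le hg (hmem _ (Sol.exp_mem hr₀ ht)) (hmem' _ (Sol.exp_mem hr₀ ht)))
      (h.yT_ge e hg hr₀) (h'.yT_ge e hg hr₀)
      (h.tendsto_exp_yT hg hr₀ ⟨ha.1, ha.2.trans hlt⟩)
      (h'.tendsto_exp_yT hg hr₀ ⟨hb.1, hb.2.trans hlt⟩) T₀
  refine ⟨u₁, R, K, C, c, T₁, τ, s, hC, hc, hτ, ?_, ?_⟩
  · intro a b r₀ u F v F' hr₀ hr₀R ha hb h h' T₀ h1 h2 r hr hT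
    have := (key hr₀ hr₀R ha hb h h' T₀ h1 h2).1 (Real.log r) (Real.log_lt_log hr.1 hr.2) hT
    simpa only [Sol.yT, Real.exp_log hr.1] using this
  · intro a b r₀ u F v F' hr₀ hr₀R ha hb h h' T₀ h1 h2 hdisc t ht ht'
    obtain ⟨x, hx, hxe⟩ := (key hr₀ hr₀R ha hb h h' T₀ h1 h2).2 hdisc t ht ht'
    refine ⟨x, hx, ?_⟩
    have hx' : x < Real.log r₀ := hx.2.trans_lt ht'
    have m1 := h.mem _ (Sol.exp_mem hr₀ hx')
    have m2 := h'.mem _ (Sol.exp_mem hr₀ hx')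
    have := Real.log_injOn_pos (mem_Ioi.2 (hg.prim_pos m1)) (mem_Ioi.2 (hg.prim_pos m2)) hxe
    exact hg.strictMonoOn_prim.injOn ⟨m1.1.le, m1.2⟩ ⟨m2.1.le, m2.2⟩ this

/-- From G ≤ u g, the derivative of log G is at least 1/u, hence at least 1/u₁. -/
lemma Convexlike.abs_sub_le_log_prim {ubar u₁ u v : ℝ} {g : ℝ → ℝ} (hg : Convexlike ubar g)
    (hu₁ : u₁ < ubar) (hu : u ∈ Ioo 0 u₁) (hv : v ∈ Ioo 0 u₁) :
    |u - v| ≤ u₁ * |Real.log (prim g u) - Real.log (prim g v)| := by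
  wlog huv : u ≤ v generalizing u v
  · rw [abs_sub_comm, abs_sub_comm (Real.log _)]
    exact this hv hu (le_of_not_ge huv)
  have hsub : ∀ x ∈ Ioo 0 u₁, x ∈ Ioo 0 ubar := fun x hx => ⟨hx.1, hx.2.trans hu₁⟩
  have hm : MonotoneOn (fun x => u₁ * Real.log (prim g x) - x) (Ioo 0 u₁) := by
    refine monotoneOn_of_hasDerivAt_nonneg (convex_Ioo 0 u₁) (fun x hx =>
      (((hg.hasDerivAt_prim (hsub x hx)).log (hg.prim_pos (hsub x hx)).ne').const_mul u₁).sub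
        (hasDerivAt_id x)) ?_
    intro x hx
    have h1 := hg.prim_le (hsub x hx)
    have h2 := hg.prim_pos (hsub x hx)
    have h3 := hg.pos x (hsub x hx)
    rw [sub_nonneg, ← mul_div_assoc, le_div_iff₀ h2, one_mul]
    exact h1.trans (mul_le_mul_of_nonneg_right hx.2.le h3.le)
  have h1 := hm hu hv huv
  simp only at h1
  have h2 := neg_abs_le (Real.log (prim g u) - Real.log (prim g v))
  have h3 : 0 < u₁ := hu.1.trans hu.2
  rw [abs_of_nonpos (sub_nonpos.2 huv)]
  nlinarith

lemma tendsto_prim_nhds {ubar : ℝ} {g : ℝ → ℝ} (hg : Convexlike ubar g) {v : ℝ} (hv : 0 < v) :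
    ∃ a₁ > 0, ∀ a ∈ Ico 0 a₁, prim g a < v := by
  obtain ⟨δ, hδ, hsub⟩ := (mem_nhdsGT_iff_exists_Ioo_subset' hg.ubar_pos).1
    (hg.tendsto_prim_zero.eventually_lt_const hv)
  refine ⟨δ, hδ, fun a ha => ?_⟩
  rcases ha.1.eq_or_lt with h | h
  · rwa [← h, prim_zero]
  · exact hsub ⟨h, ha.2⟩

namespace Stable

variable {α β γ ubar u₁ R L K C c T₁ τ : ℝ} {g : ℝ → ℝ}

/-- Solutions with small initial values are uniformly close. -/
lemma exists_close (s : Stable α β γ ubar g u₁ R L K C c T₁ τ) {ε : ℝ} (hε : 0 < ε) :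
    ∃ a₁ ∈ Ioc 0 (u₁ / 2), ∀ a ∈ Ico 0 a₁, ∀ b ∈ Ico 0 a₁, ∀ (r₀ : ℝ) (u F v F' : ℝ → ℝ), r₀ ≤ R →
      Sol α β γ ubar g a r₀ u F → Sol α β γ ubar g b r₀ v F' →
      ∀ r ∈ Ioo 0 r₀, |u r - v r| ≤ ε := by
  have hu₁ := s.hu₁.1
  have hlow := (tendsto_ulow s.e s.hg).const_mul (Sol.upConst α β γ)
  rw [mul_zero] at hlow
  obtain ⟨r₁, hr₁, H⟩ := mem_nhdsGT_iff_exists_Ioc_subset.1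
    (hlow.eventually_lt_const (show 0 < ε / 2 by linarith))
  replace hr₁ : 0 < r₁ := hr₁
  obtain ⟨S, hS, hexp⟩ := exists_exp_le s.c_pos
    (show 0 < (ε / u₁) ^ 2 / C by have := s.C_pos; positivity)
  -- With this T₀ the decay, which starts at T₀ + T₁, has lasted a time S at log r₁. Below r₁ both
  -- solutions are themselves small.
  set T₀ := Real.log r₁ - S - T₁ with hT₀
  obtain ⟨a₂, ha₂, hprim⟩ := tendsto_prim_nhds s.hg (Real.exp_pos (theta α β γ * T₀ - K))
  refine ⟨min a₂ (min (ε / 2) (u₁ / 2)), ⟨lt_min ha₂ (lt_min (by linarith) (by linarith)),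
    (min_le_right _ _).trans (min_le_right _ _)⟩, ?_⟩
  intro a ha b hb r₀ u F v F' hr₀ h h' r hr
  obtain ⟨ha2, ha'⟩ := lt_min_iff.1 ha.2
  obtain ⟨hb2, hb'⟩ := lt_min_iff.1 hb.2
  obtain ⟨ha3, ha4⟩ := lt_min_iff.1 ha'
  obtain ⟨hb3, hb4⟩ := lt_min_iff.1 hb'
  have hrad : ∀ r ∈ Ioo 0 r₀, lowConst α β γ * r ^ theta α β γ < prim g u₁ :=
    fun r hr => s.hR r ⟨hr.1, hr.2.le.trans hr₀⟩
  rcases le_total r r₁ with hle | hle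
  · have h1 := h.le_ulow s.e s.hg s.hu₁ s.hell hrad hr
    have h2 := h'.le_ulow s.e s.hg s.hu₁ s.hell hrad hr
    have h3 := H ⟨hr.1, hle⟩
    rw [Set.mem_ofPred_eq] at h3
    have h4 := (h.mem r hr).1
    have h5 := (h'.mem r hr).1
    rw [abs_le]
    constructor <;> linarith
  · have hlog : Real.log r₁ ≤ Real.log r := Real.log_le_log hr₁ hle
    have h1 := s.decay (hr.1.trans hr.2) hr₀ ⟨ha.1, ha4⟩ ⟨hb.1, hb4⟩ h h' T₀
      (hprim a ⟨ha.1, ha2⟩) (hprim b ⟨hb.1, hb2⟩) r hr (by rw [hT₀]; linarith)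
    have h2 := hexp (Real.log r - (T₀ + T₁)) (by rw [hT₀]; linarith)
    have h3 : (Real.log (prim g (u r)) - Real.log (prim g (v r))) ^ 2 ≤ (ε / u₁) ^ 2 := by
      refine h1.trans ?_
      have := mul_le_mul_of_nonneg_left h2 s.C_pos.le
      rwa [mul_div_cancel₀ _ s.C_pos.ne'] at this
    have h4 := abs_le_of_sq_le_sq h3 (by positivity)
    have h5 := s.hg.abs_sub_le_log_prim s.hu₁.2 (s.sol_mem h hr₀ ha4 hr) (s.sol_mem h' hr₀ hb4 hr)
    refine h5.trans ?_
    have := mul_le_mul_of_nonneg_left h4 hu₁.le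
    rwa [mul_div_cancel₀ _ hu₁.ne'] at this

/-- Uniqueness for the singular problem. -/
lemma singular_unique (s : Stable α β γ ubar g u₁ R L K C c T₁ τ) {r₀ : ℝ} {u F v F' : ℝ → ℝ}
    (hr₀ : r₀ ≤ R) (h : Sol α β γ ubar g 0 r₀ u F) (h' : Sol α β γ ubar g 0 r₀ v F') :
    EqOn u v (Ico 0 r₀) := by
  intro r hr
  rcases hr.1.eq_or_lt with h0 | h0
  · rw [← h0, h.init, h'.init]
  have : |u r - v r| ≤ 0 := le_of_forall_pos_le_add fun ε hε => by
    obtain ⟨a₁, ha₁, H⟩ := s.exists_close hε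
    have h0 : (0 : ℝ) ∈ Ico 0 a₁ := ⟨le_rfl, ha₁.1⟩
    linarith [H 0 h0 0 h0 r₀ u F v F' hr₀ h h' r ⟨‹_›, hr.2⟩]
  exact sub_eq_zero.1 (abs_nonpos_iff.1 this)

end Stable

namespace Setup

variable {α β γ ubar a u₁ R r₀ : ℝ} {g u F : ℝ → ℝ}

/-- A bound on the flux of all solutions. -/
def fluxConst (α β γ u₁ : ℝ) : ℝ := 1 / ((α - β) * lowConst α β γ ^ β) * u₁ ^ β

/-- In `Sol.flux_le` the quotient G/g is at most u₁; the remaining power r^(α-β) vanishes at the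
origin uniformly in a. -/
lemma flux_le_pow (s : Setup α β γ ubar g u₁ R) (h : Sol α β γ ubar g a r₀ u F) (hr₀ : r₀ ≤ R)
    (ha : a < u₁ / 2) {r : ℝ} (hr : r ∈ Ioo 0 r₀) :
    F r ≤ fluxConst α β γ u₁ * r ^ (α - β) := by
  have hαβ : 0 < α - β := by linarith [s.e.lt_α]
  have hc := lowConst_pos s.e
  have hmem := s.sol_mem h hr₀ ha hr
  have hmem' := h.mem r hr
  have h1 := s.hg.prim_le hmem'
  have h2 := s.hg.pos _ hmem'
  have h3 := s.hg.prim_pos hmem'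
  have hβ := s.e.β_pos
  have hr0 := hr.1
  refine (h.flux_le s.e s.hg (fun r hr => s.hell _ (s.sol_mem h hr₀ ha hr)) hr).trans ?_
  have h4 : prim g (u r) / g (u r) ≤ u₁ := by
    rw [div_le_iff₀ h2]
    exact h1.trans (mul_le_mul_of_nonneg_right hmem.2.le h2.le)
  unfold fluxConst
  rw [mul_assoc, mul_comm (u₁ ^ β)]
  gcongr

end Setup

namespace Stable

variable {α β γ ubar u₁ R L K C c T₁ τ : ℝ} {g : ℝ → ℝ}

/-- Near the origin both fluxes are small. From r₁ on, the barrier keeps the solutions above a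
positive constant, so the source is uniformly continuous on their range and closeness of the
solutions gives closeness of F'. -/
lemma exists_flux_close (s : Stable α β γ ubar g u₁ R L K C c T₁ τ) {ε : ℝ} (hε : 0 < ε) :
    ∃ a₁ ∈ Ioc 0 (u₁ / 2), ∀ a ∈ Ico 0 a₁, ∀ b ∈ Ico 0 a₁, ∀ (r₀ : ℝ) (u F v F' : ℝ → ℝ), r₀ ≤ R →
      Sol α β γ ubar g a r₀ u F → Sol α β γ ubar g b r₀ v F' →
      ∀ r ∈ Ioo 0 r₀, |F r - F' r| ≤ ε := by
  have hu₁ := s.hu₁.1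
  have hαβ : 0 < α - β := by linarith [s.e.lt_α]
  have hβ := s.e.β_pos
  have hR := s.R_pos
  have hlim := (tendsto_rpow_zero hαβ (Setup.fluxConst α β γ u₁)).neg
  simp only [neg_neg, neg_zero] at hlim
  obtain ⟨r₁', hr₁', H'⟩ := mem_nhdsGT_iff_exists_Ioc_subset.1
    (hlim.eventually_lt_const (show 0 < ε / 2 by linarith))
  obtain ⟨r₁, hr₁, hr₁R, H⟩ : ∃ r₁, 0 < r₁ ∧ r₁ ≤ R ∧ ∀ r ∈ Ioc 0 r₁,
      Setup.fluxConst α β γ u₁ * r ^ (α - β) < ε / 2 :=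
    ⟨min r₁' R, lt_min hr₁' hR, min_le_right _ _,
      fun r hr => H' ⟨hr.1, hr.2.trans (min_le_left _ _)⟩⟩
  obtain ⟨hm, -⟩ := s.hg.ulow_spec s.e s.hu₁ hr₁ (s.hR r₁ ⟨hr₁, hr₁R⟩)
  set m := ulow α β γ ubar g r₁ with hmd
  have hsub : ∀ x ∈ Icc m u₁, x ∈ Ioo 0 ubar := fun x hx =>
    ⟨hm.1.trans_le hx.1, hx.2.trans_lt s.hu₁.2⟩
  have hcont : ContinuousOn (fun x => (g x ^ β)⁻¹) (Icc m u₁) := fun x hx => by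
    have := s.hg.pos x (hsub x hx)
    exact (((s.hg.d1 x (hsub x hx)).continuousAt.rpow_const (Or.inl this.ne')).inv₀
      (by positivity)).continuousWithinAt
  have huc := isCompact_Icc.uniformContinuousOn_of_continuous hcont
  rw [Metric.uniformContinuousOn_iff] at huc
  set ε' := ε / (2 * R ^ γ) with hε'
  have hε'pos : 0 < ε' := by positivity
  obtain ⟨δ, hδ, hucδ⟩ := huc ε' hε'pos
  obtain ⟨a₁, ha₁, hclose⟩ := s.exists_close (show 0 < δ / 2 by linarith)
  refine ⟨a₁, ha₁, ?_⟩
  intro a ha b hb r₀ u F v F' hr₀ h h'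
  have hsmall : ∀ r ∈ Ioo 0 r₀, r ≤ r₁ → |F r - F' r| ≤ ε / 2 := fun r hr hle => by
    have h1 := s.flux_le_pow h hr₀ (ha.2.trans_le ha₁.2) hr
    have h2 := s.flux_le_pow h' hr₀ (hb.2.trans_le ha₁.2) hr
    have h3 := H r ⟨hr.1, hle⟩
    have h4 := h.F_pos r hr
    have h5 := h'.F_pos r hr
    rw [abs_le]
    constructor <;> linarith
  intro r hr
  rcases le_total r r₁ with hle | hle
  · exact (hsmall r hr hle).trans (by linarith)
  have hIcc : ∀ x ∈ Icc r₁ r, x ∈ Ioo 0 r₀ := fun x hx =>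
    ⟨hr₁.trans_le hx.1, hx.2.trans_lt hr.2⟩
  have hr₁mem := hIcc r₁ ⟨le_rfl, hle⟩
  have hrange : ∀ {a : ℝ} {u F : ℝ → ℝ}, a < u₁ / 2 → Sol α β γ ubar g a r₀ u F →
      ∀ x ∈ Icc r₁ r, u x ∈ Icc m u₁ := fun {a u F} ha h x hx =>
    ⟨(h.ulow_le s.e s.hg s.hu₁ hr₁mem (s.hR r₁ ⟨hr₁, hr₁R⟩)).trans
      (h.strictMonoOn.monotoneOn hr₁mem (hIcc x hx) hx.1), (s.sol_mem h hr₀ ha (hIcc x hx)).2.le⟩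
  have hbound : ∀ x ∈ Icc r₁ r, ‖x ^ (γ - 1) / g (u x) ^ β - x ^ (γ - 1) / g (v x) ^ β‖
      ≤ R ^ (γ - 1) * ε' := fun x hx => by
    have hx0 := (hIcc x hx).1
    have h1 := hucδ (u x) (hrange (ha.2.trans_le ha₁.2) h x hx) (v x)
      (hrange (hb.2.trans_le ha₁.2) h' x hx) (by
        rw [Real.dist_eq]
        exact (hclose a ha b hb r₀ u F v F' hr₀ h h' x (hIcc x hx)).trans_lt (by linarith))
    rw [Real.dist_eq] at h1
    rw [div_eq_mul_inv, div_eq_mul_inv, ← mul_sub, norm_mul, Real.norm_of_nonneg (by positivity),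
      Real.norm_eq_abs]
    have : x ^ (γ - 1) ≤ R ^ (γ - 1) := by
      have : 0 ≤ γ - 1 := by linarith [s.e.one_le, s.e.lt_α, s.e.lt_γ]
      gcongr
      exact (hIcc x hx).2.le.trans hr₀
    gcongr
  have hmv := (convex_Icc r₁ r).norm_image_sub_le_of_norm_hasDerivWithin_le
    (f := fun x => F x - F' x) (C := R ^ (γ - 1) * ε') (x := r₁) (y := r)
    (fun x hx => ((h.dF x (hIcc x hx)).sub (h'.dF x (hIcc x hx))).hasDerivWithinAt)
    hbound ⟨le_rfl, hle⟩ ⟨hle, le_rfl⟩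
  have h1 := hsmall r₁ hr₁mem le_rfl
  have h2 : R ^ (γ - 1) * ε' * ‖r - r₁‖ ≤ ε / 2 := by
    rw [Real.norm_of_nonneg (by linarith)]
    calc R ^ (γ - 1) * ε' * (r - r₁) ≤ R ^ (γ - 1) * ε' * R := by
          gcongr; linarith [hr.2]
      _ = ε / 2 := by
          have : (0 : ℝ) < R ^ γ := by positivity
          rw [hε', Real.rpow_sub hR, Real.rpow_one]
          field_simp
  rw [Real.norm_eq_abs] at hmv
  have h3 : F r - F' r = (F r - F' r - (F r₁ - F' r₁)) + (F r₁ - F' r₁) := by ring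
  rw [h3]
  refine (abs_add_le _ _).trans ?_
  linarith

end Stable

end MEMS

end

/-! ### The singular solution, convergence and intersections -/

noncomputable section

namespace MEMS

lemma tendsto_of_tendstoLocallyUniformlyOn {ι : Type*} {l : Filter ι} {s : Set ℝ}
    {φ : ι → ℝ → ℝ} {φ₀ : ℝ → ℝ} (h : TendstoLocallyUniformlyOn φ φ₀ l s)
    (hc : ContinuousOn φ₀ s) {x : ℝ} (hx : x ∈ s) :
    Tendsto (fun y : ι × ℝ => φ y.1 y.2) (l ×ˢ 𝓝[s] x) (𝓝 (φ₀ x)) := by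
  have h1 := tendstoLocallyUniformlyOn_iff_forall_tendsto.1 h x hx
  have h2 : Tendsto (fun y : ι × ℝ => φ₀ y.2) (l ×ˢ 𝓝[s] x) (𝓝 (φ₀ x)) :=
    (hc x hx).tendsto.comp tendsto_snd
  rw [tendsto_iff_dist_tendsto_zero] at h2 ⊢
  rw [Metric.uniformity_eq_comap_nhds_zero, tendsto_comap_iff] at h1
  have h3 := h1.add h2
  rw [add_zero] at h3
  refine squeeze_zero (fun _ => dist_nonneg) (fun y => ?_) h3
  simp only [Function.comp_apply]
  rw [dist_comm (φ₀ y.2)]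
  exact dist_triangle _ _ _

/-- Local uniform convergence is preserved by continuous superposition operators. -/
lemma tendstoLocallyUniformlyOn_superposition {ι : Type*} {l : Filter ι} {s : Set ℝ}
    {φ ψ : ι → ℝ → ℝ} {φ₀ ψ₀ : ℝ → ℝ} {Ξ : ℝ → ℝ → ℝ → ℝ}
    (hφ : TendstoLocallyUniformlyOn φ φ₀ l s) (hψ : TendstoLocallyUniformlyOn ψ ψ₀ l s)
    (hφc : ContinuousOn φ₀ s) (hψc : ContinuousOn ψ₀ s)
    (hΞ : ∀ x ∈ s, ContinuousAt (fun p : ℝ × ℝ × ℝ => Ξ p.1 p.2.1 p.2.2) (x, φ₀ x, ψ₀ x)) :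
    TendstoLocallyUniformlyOn (fun i x => Ξ x (φ i x) (ψ i x)) (fun x => Ξ x (φ₀ x) (ψ₀ x)) l s := by
  rw [tendstoLocallyUniformlyOn_iff_forall_tendsto]
  intro x hx
  have hid : Tendsto (fun y : ι × ℝ => y.2) (l ×ˢ 𝓝[s] x) (𝓝 x) :=
    (tendsto_id.mono_left nhdsWithin_le_nhds).comp tendsto_snd
  have h1 : Tendsto (fun y : ι × ℝ => Ξ y.2 (φ y.1 y.2) (ψ y.1 y.2)) (l ×ˢ 𝓝[s] x)
      (𝓝 (Ξ x (φ₀ x) (ψ₀ x))) :=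
    (hΞ x hx).tendsto.comp (hid.prodMk_nhds
      ((tendsto_of_tendstoLocallyUniformlyOn hφ hφc hx).prodMk_nhds
        (tendsto_of_tendstoLocallyUniformlyOn hψ hψc hx)))
  have h2 : Tendsto (fun y : ι × ℝ => Ξ y.2 (φ₀ y.2) (ψ₀ y.2)) (l ×ˢ 𝓝[s] x)
      (𝓝 (Ξ x (φ₀ x) (ψ₀ x))) :=
    (hΞ x hx).tendsto.comp (hid.prodMk_nhds
      (((hφc x hx).tendsto.comp tendsto_snd).prodMk_nhds ((hψc x hx).tendsto.comp tendsto_snd)))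
  rw [Metric.uniformity_eq_comap_nhds_zero, tendsto_comap_iff]
  have h3 := h2.dist h1
  rwa [dist_self] at h3

lemma continuousAt_source {β γ u r F : ℝ} {g : ℝ → ℝ} (hr : 0 < r) (hg : ContinuousAt g u)
    (hu : 0 < g u) :
    ContinuousAt (fun p : ℝ × ℝ × ℝ => p.1 ^ (γ - 1) / g p.2.1 ^ β) (r, u, F) := by
  have h1 : ContinuousAt (fun p : ℝ × ℝ × ℝ => p.1) (r, u, F) := continuousAt_fst
  have h2 : ContinuousAt (fun p : ℝ × ℝ × ℝ => p.2.1) (r, u, F) :=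
    continuousAt_fst.comp continuousAt_snd
  have h3 : ContinuousAt (fun p : ℝ × ℝ × ℝ => g p.2.1) (r, u, F) :=
    ContinuousAt.comp (g := g) (f := fun p : ℝ × ℝ × ℝ => p.2.1) hg h2
  exact (h1.rpow_const (Or.inl hr.ne')).div (h3.rpow_const (Or.inl hu.ne'))
    (Real.rpow_pos_of_pos hu _).ne'

lemma continuousAt_slope {α β u r F : ℝ} (hr : 0 < r) (hF : 0 < F) :
    ContinuousAt (fun p : ℝ × ℝ × ℝ => slope α β p.1 p.2.2) (r, u, F) := by
  have h1 : ContinuousAt (fun p : ℝ × ℝ × ℝ => p.1) (r, u, F) := continuousAt_fst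
  have h2 : ContinuousAt (fun p : ℝ × ℝ × ℝ => p.2.2) (r, u, F) :=
    continuousAt_snd.comp continuousAt_snd
  exact (h1.rpow_const (Or.inl hr.ne')).mul (h2.rpow_const (Or.inl hF.ne'))

lemma continuousAt_curvature {α β γ u r F : ℝ} {g : ℝ → ℝ} (hr : 0 < r) (hg : ContinuousAt g u)
    (hu : 0 < g u) (hF : 0 < F) :
    ContinuousAt (fun p : ℝ × ℝ × ℝ => curvature α β γ (fun x => g x ^ β) p.1 p.2.1 p.2.2)
      (r, u, F) := by
  have h1 : ContinuousAt (fun p : ℝ × ℝ × ℝ => p.1) (r, u, F) := continuousAt_fst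
  have h2 : ContinuousAt (fun p : ℝ × ℝ × ℝ => p.2.2) (r, u, F) :=
    continuousAt_snd.comp continuousAt_snd
  have h3 : ∀ s : ℝ, ContinuousAt (fun p : ℝ × ℝ × ℝ => p.1 ^ s) (r, u, F) := fun s =>
    h1.rpow_const (Or.inl hr.ne')
  have h4 : ∀ s : ℝ, ContinuousAt (fun p : ℝ × ℝ × ℝ => p.2.2 ^ s) (r, u, F) := fun s =>
    h2.rpow_const (Or.inl hF.ne')
  exact ((continuousAt_const.mul (h3 _)).mul (h4 _)).add ((h3 _).mul
    (((continuousAt_source hr hg hu).mul continuousAt_const).mul (h4 _)))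

namespace Stable

variable {α β γ ubar u₁ R L K C c T₁ τ r₀ : ℝ} {g : ℝ → ℝ}

/-- Existence for the singular problem. -/
lemma exists_singular (s : Stable α β γ ubar g u₁ R L K C c T₁ τ) :
    ∃ u F, Sol α β γ ubar g 0 R u F := by
  have hu₁ := s.hu₁.1
  have hαβ : 0 < α - β := by linarith [s.e.lt_α]
  have hβ := s.e.β_pos
  have hγ := s.e.γ_pos
  -- The shift by 3 puts every term below u₁/2.
  set a : ℕ → ℝ := fun n => u₁ / (n + 3) with ha
  have hapos : ∀ n, 0 < a n := fun n => by positivity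
  have halt : ∀ n, a n < u₁ / 2 := fun n => by
    have : (0 : ℝ) ≤ n := n.cast_nonneg
    exact div_lt_div_of_pos_left hu₁ two_pos (by linarith)
  have halim : Tendsto a atTop (𝓝 0) := by
    have : Tendsto (fun n : ℕ => (n : ℝ) + 3) atTop atTop :=
      tendsto_atTop_add_const_right _ _ tendsto_natCast_atTop_atTop
    exact this.const_div_atTop u₁
  choose u F hs using fun n => s.exists_regular (hapos n) (halt n)
  have hcauchy : ∀ Φ : ℕ → ℝ → ℝ, (∀ ε > 0, ∃ a₁ > 0, ∀ m n, a m < a₁ → a n < a₁ →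
      ∀ r ∈ Ioo 0 R, |Φ m r - Φ n r| ≤ ε) → ∃ φ, TendstoUniformlyOn Φ φ atTop (Ioo 0 R) := by
    intro Φ H
    have hC : UniformCauchySeqOn Φ atTop (Ioo 0 R) := by
      rw [Metric.uniformCauchySeqOn_iff]
      intro ε hε
      obtain ⟨a₁, ha₁, hcl⟩ := H (ε / 2) (by linarith)
      obtain ⟨N, hN⟩ := eventually_atTop.1 (halim.eventually_lt_const ha₁)
      refine ⟨N, fun m hm n hn r hr => ?_⟩
      rw [Real.dist_eq]
      exact (hcl m n (hN m hm) (hN n hn) r hr).trans_lt (by linarith)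
    have : ∀ r, ∃ x, r ∈ Ioo 0 R → Tendsto (fun n => Φ n r) atTop (𝓝 x) := fun r => by
      by_cases hr : r ∈ Ioo 0 R
      · obtain ⟨x, hx⟩ := cauchySeq_tendsto_of_complete (hC.cauchySeq hr)
        exact ⟨x, fun _ => hx⟩
      · exact ⟨0, fun h => absurd h hr⟩
    choose φ hφ using this
    exact ⟨φ, hC.tendstoUniformlyOn_of_tendsto hφ⟩
  obtain ⟨v, hv⟩ := hcauchy u (fun ε hε => by
    obtain ⟨a₁, ha₁, H⟩ := s.exists_close hε
    exact ⟨a₁, ha₁.1, fun m n hm hn => H _ ⟨(hapos m).le, hm⟩ _ ⟨(hapos n).le, hn⟩ R _ _ _ _ le_rfl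
      (hs m) (hs n)⟩)
  obtain ⟨H, hH⟩ := hcauchy F (fun ε hε => by
    obtain ⟨a₁, ha₁, H⟩ := s.exists_flux_close hε
    exact ⟨a₁, ha₁.1, fun m n hm hn => H _ ⟨(hapos m).le, hm⟩ _ ⟨(hapos n).le, hn⟩ R _ _ _ _ le_rfl
      (hs m) (hs n)⟩)
  have hrad : ∀ r ∈ Ioo 0 R, lowConst α β γ * r ^ theta α β γ < prim g u₁ :=
    fun r hr => s.hR r ⟨hr.1, hr.2.le⟩
  have hvlow : ∀ r ∈ Ioo 0 R, ulow α β γ ubar g r ≤ v r := fun r hr =>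
    ge_of_tendsto' (hv.tendsto_at hr) (fun n => (hs n).ulow_le s.e s.hg s.hu₁ hr (hrad r hr))
  have hvup : ∀ r ∈ Ioo 0 R, v r ≤ Sol.upConst α β γ * ulow α β γ ubar g r := fun r hr => by
    have h1 := halim.add_const (Sol.upConst α β γ * ulow α β γ ubar g r)
    rw [zero_add] at h1
    exact le_of_tendsto_of_tendsto' (hv.tendsto_at hr) h1
      (fun n => (hs n).le_ulow s.e s.hg s.hu₁ s.hell hrad hr)
  have hvmem : ∀ r ∈ Ioo 0 R, v r ∈ Ioo 0 u₁ := fun r hr =>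
    ⟨(s.hg.ulow_spec s.e s.hu₁ hr.1 (hrad r hr)).1.1.trans_le (hvlow r hr),
      ((hvup r hr).trans (s.hsmall r ⟨hr.1, hr.2.le⟩)).trans_lt (by linarith)⟩
  have hvmem' : ∀ r ∈ Ioo 0 R, v r ∈ Ioo 0 ubar := fun r hr =>
    ⟨(hvmem r hr).1, (hvmem r hr).2.trans s.hu₁.2⟩
  have hgu := s.hg.pos u₁ s.hu₁
  -- Positivity survives the limit because `Sol.pow_le_flux` and g(u) ≤ g(u₁) bound all the fluxes
  -- below by one multiple of r^γ.
  have hHpos : ∀ r ∈ Ioo 0 R, 0 < H r := fun r hr => by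
    have hr0 := hr.1
    have hpos : 0 < 1 / γ * r ^ γ / g u₁ ^ β := by positivity
    refine hpos.trans_le (ge_of_tendsto' (hH.tendsto_at hr) fun n => ?_)
    rw [div_le_iff₀ (by positivity)]
    refine ((hs n).pow_le_flux s.e s.hg hr).trans ?_
    rw [mul_comm]
    have h1 := (hs n).mem r hr
    have h2 := (s.sol_mem (hs n) le_rfl (halt n) hr).2
    have := s.hg.pos _ h1
    have := (hs n).F_pos r hr
    gcongr
    exact s.hg.strictMonoOn.monotoneOn ⟨h1.1.le, h1.2⟩ ⟨hu₁.le, s.hu₁.2⟩ h2.le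
  have hHle : ∀ r ∈ Ioo 0 R, H r ≤ Setup.fluxConst α β γ u₁ * r ^ (α - β) := fun r hr =>
    le_of_tendsto' (hH.tendsto_at hr) fun n => s.flux_le_pow (hs n) le_rfl (halt n) hr
  have hvc : ContinuousOn v (Ioo 0 R) := hv.continuousOn (Frequently.of_forall fun n r hr =>
    ((hs n).du r hr).continuousAt.continuousWithinAt)
  have hHc : ContinuousOn H (Ioo 0 R) := hH.continuousOn (Frequently.of_forall fun n r hr =>
    ((hs n).dF r hr).continuousAt.continuousWithinAt)
  have hv' := hv.tendstoLocallyUniformlyOn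
  have hH' := hH.tendstoLocallyUniformlyOn
  have hev : ∀ᶠ r in 𝓝[>] (0 : ℝ), r ∈ Ioo 0 R := Ioo_mem_nhdsGT s.R_pos
  have hup0 : Tendsto (fun r => Sol.upConst α β γ * ulow α β γ ubar g r) (𝓝[>] 0) (𝓝 0) := by
    simpa using (tendsto_ulow s.e s.hg).const_mul (Sol.upConst α β γ)
  have hfl0 : Tendsto (fun r => Setup.fluxConst α β γ u₁ * r ^ (α - β)) (𝓝[>] 0) (𝓝 0) := by
    simpa using (tendsto_rpow_zero hαβ (Setup.fluxConst α β γ u₁)).neg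
  -- The limit is determined only on (0, R); its value at 0 is arbitrary and is reset to the initial
  -- value.
  have hv0 : ∀ r ∈ Ioo 0 R, Function.update v 0 0 r = v r := fun r hr =>
    Function.update_of_ne hr.1.ne' _ _
  refine ⟨Function.update v 0 0, H, fun r hr => ?_, hHpos, fun r hr => ?_, fun r hr => ?_, ?_, ?_,
    Function.update_self _ _ _⟩
  · rw [hv0 r hr]
    exact hvmem' r hr
  · rw [hv0 r hr]
    exact hasDerivAt_of_tendstoLocallyUniformlyOn isOpen_Ioo
      (tendstoLocallyUniformlyOn_superposition (Ξ := fun r u _ => r ^ (γ - 1) / g u ^ β) hv' hH'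
        hvc hHc fun x hx => continuousAt_source hx.1 (s.hg.d1 _ (hvmem' x hx)).continuousAt
          (s.hg.pos _ (hvmem' x hx)))
      (Eventually.of_forall fun n => (hs n).dF) (fun x hx => hH.tendsto_at hx) hr
  · have h1 : HasDerivAt v (slope α β r (H r)) r :=
      hasDerivAt_of_tendstoLocallyUniformlyOn isOpen_Ioo
      (tendstoLocallyUniformlyOn_superposition (Ξ := fun r _ F => slope α β r F) hv' hH'
        hvc hHc fun x hx => continuousAt_slope hx.1 (hHpos x hx))
      (Eventually.of_forall fun n => (hs n).du) (fun x hx => hv.tendsto_at hx) hr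
    refine h1.congr_of_eventuallyEq ?_
    filter_upwards [Ioo_mem_nhds hr.1 hr.2] with x hx using hv0 x hx
  · refine squeeze_zero' ?_ ?_ hfl0
    · filter_upwards [hev] with r hr using (hHpos r hr).le
    · filter_upwards [hev] with r hr using hHle r hr
  · refine squeeze_zero' ?_ ?_ hup0
    · filter_upwards [hev] with r hr
      rw [hv0 r hr]
      exact (hvmem r hr).1.le
    · filter_upwards [hev] with r hr
      rw [hv0 r hr]
      exact hvup r hr

/-- Regular solutions converge to the singular solution. -/
lemma convergesC2Loc (s : Stable α β γ ubar g u₁ R L K C c T₁ τ) (hr₀ : r₀ ≤ R) {v H : ℝ → ℝ}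
    (hv : Sol α β γ ubar g 0 r₀ v H) {U F : ℝ → ℝ → ℝ}
    (hU : ∀ a ∈ Ioo 0 (u₁ / 2), Sol α β γ ubar g a r₀ (U a) (F a)) : ConvergesC2Loc r₀ U v := by
  have hu₁ := s.hu₁.1
  have hev : ∀ a₁ > 0, ∀ᶠ a in 𝓝[>] (0 : ℝ), a ∈ Ioo 0 a₁ := fun a₁ h => Ioo_mem_nhdsGT h
  have hdom := hev (u₁ / 2) (by linarith)
  have h1 : TendstoUniformlyOn U v (𝓝[>] 0) (Ico 0 r₀) := by
    rw [Metric.tendstoUniformlyOn_iff]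
    intro ε hε
    obtain ⟨a₁, ha₁, H⟩ := s.exists_close (show 0 < ε / 2 by linarith)
    filter_upwards [hdom, hev a₁ ha₁.1, hev ε hε] with a ha ha' haε r hr
    rw [dist_comm, Real.dist_eq]
    rcases hr.1.eq_or_lt with h0 | h0
    · rw [← h0, (hU a ha).init, hv.init, sub_zero, abs_of_pos ha.1]
      exact haε.2
    · exact (H a ⟨ha.1.le, ha'.2⟩ 0 ⟨le_rfl, ha₁.1⟩ r₀ _ _ _ _ hr₀ (hU a ha) hv r
        ⟨h0, hr.2⟩).trans_lt (by linarith)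
  have h2 : TendstoUniformlyOn F H (𝓝[>] 0) (Ioo 0 r₀) := by
    rw [Metric.tendstoUniformlyOn_iff]
    intro ε hε
    obtain ⟨a₁, ha₁, H⟩ := s.exists_flux_close (show 0 < ε / 2 by linarith)
    filter_upwards [hdom, hev a₁ ha₁.1] with a ha ha' r hr
    rw [dist_comm, Real.dist_eq]
    exact (H a ⟨ha.1.le, ha'.2⟩ 0 ⟨le_rfl, ha₁.1⟩ r₀ _ _ _ _ hr₀ (hU a ha) hv r
      hr).trans_lt (by linarith)
  have h1' := (h1.mono Ioo_subset_Ico_self).tendstoLocallyUniformlyOn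
  have h2' := h2.tendstoLocallyUniformlyOn
  have hvc : ContinuousOn v (Ioo 0 r₀) := fun r hr => (hv.du r hr).continuousAt.continuousWithinAt
  have hHc : ContinuousOn H (Ioo 0 r₀) := fun r hr => (hv.dF r hr).continuousAt.continuousWithinAt
  have hd : ∀ {a : ℝ} {u F : ℝ → ℝ}, Sol α β γ ubar g a r₀ u F →
      EqOn (fun r => slope α β r (F r)) (deriv u) (Ioo 0 r₀) := fun h r hr => (h.du r hr).deriv.symm
  have hdd : ∀ {a : ℝ} {u F : ℝ → ℝ}, Sol α β γ ubar g a r₀ u F →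
      EqOn (fun r => curvature α β γ (fun x => g x ^ β) r (u r) (F r)) (deriv (deriv u))
        (Ioo 0 r₀) := fun {a u F} h r hr => by
    refine ((h.hasDerivAt_slope hr).congr_of_eventuallyEq ?_).deriv.symm
    filter_upwards [Ioo_mem_nhds hr.1 hr.2] with x hx using (hd h hx).symm
  -- Both u' and u'' are continuous expressions in (r, u, F), so convergence of u and F carries over
  -- to the derivatives.
  have h3 := tendstoLocallyUniformlyOn_superposition (Ξ := fun r _ F => slope α β r F) h1' h2'
    hvc hHc fun x hx => continuousAt_slope hx.1 (hv.F_pos x hx)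
  have h4 := tendstoLocallyUniformlyOn_superposition
    (Ξ := fun r u F => curvature α β γ (fun x => g x ^ β) r u F) h1' h2'
    hvc hHc fun x hx => continuousAt_curvature hx.1 (s.hg.d1 _ (hv.mem x hx)).continuousAt
      (s.hg.pos _ (hv.mem x hx)) (hv.F_pos x hx)
  rw [tendstoLocallyUniformlyOn_iff_forall_isCompact isOpen_Ioo] at h3 h4
  refine ⟨fun S hS hS' => ⟨h1.mono (hS'.trans Ioo_subset_Ico_self), ?_, ?_⟩,
    fun S _ hS' => h1.mono hS'⟩
  · refine ((h3 S hS' hS).congr ?_).congr_right ((hd hv).mono hS')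
    filter_upwards [hdom] with a ha using (hd (hU a ha)).mono hS'
  · refine ((h4 S hS' hS).congr ?_).congr_right ((hdd hv).mono hS')
    filter_upwards [hdom] with a ha using (hdd (hU a ha)).mono hS'

/-- The number of intersections with the singular solution grows without bound. -/
lemma tendsto_zeroNumber (s : Stable α β γ ubar g u₁ R L K C c T₁ τ) (hr₀ : r₀ ≤ R) {v H : ℝ → ℝ}
    (hv : Sol α β γ ubar g 0 r₀ v H) {U F : ℝ → ℝ → ℝ}
    (hU : ∀ a ∈ Ioo 0 (u₁ / 2), Sol α β γ ubar g a r₀ (U a) (F a))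
    (hdisc : ((1 - L) * theta α β γ + (γ - L * β * theta α β γ)) ^ 2
      < 4 * (theta α β γ * (γ - L * β * theta α β γ))) {ρ : ℝ} (hρ : ρ ∈ Ioo 0 r₀) :
    Tendsto (fun a => zeroNumber (Ioo 0 ρ) (fun r => U a r - v r)) (𝓝[>] 0) (𝓝 ⊤) := by
  have hu₁ := s.hu₁.1
  have hτ := s.τ_pos
  rw [ENat.tendsto_nhds_top_iff_natCast_lt]
  intro n
  -- Windows of length τ placed at distance 2τ are disjoint, so their crossings are distinct.
  set d := 2 * τ with hd
  -- Room for the n + 1 windows before log ρ. This T₀ depends on n and ρ only, and a is then taken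
  -- small against it.
  set T₀ := Real.log ρ - d * (n + 2) - T₁ with hT₀
  obtain ⟨a₁, ha₁, hprim⟩ := tendsto_prim_nhds s.hg (Real.exp_pos (theta α β γ * T₀ - K))
  have hdom : ∀ᶠ a in 𝓝[>] (0 : ℝ), a ∈ Ioo 0 (min a₁ (u₁ / 2)) :=
    Ioo_mem_nhdsGT (lt_min ha₁ (by linarith))
  filter_upwards [hdom] with a ha
  obtain ⟨ha2, ha3⟩ := lt_min_iff.1 ha.2
  have hlog : Real.log ρ < Real.log r₀ := Real.log_lt_log hρ.1 hρ.2
  have hpt : ∀ i : Fin (n + 1), ∃ x ∈ Icc (T₀ + T₁ + d * i) (T₀ + T₁ + d * i + τ),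
      U a (Real.exp x) = v (Real.exp x) := fun i => by
    have hi : (i : ℝ) ≤ n := by exact_mod_cast Nat.lt_succ_iff.1 i.2
    have hi0 : (0 : ℝ) ≤ (i : ℕ) := Nat.cast_nonneg _
    refine s.crossing (hρ.1.trans hρ.2) hr₀ ⟨ha.1.le, ha3⟩ ⟨le_rfl, by linarith⟩ (hU a ⟨ha.1, ha3⟩)
      hv T₀ (hprim a ⟨ha.1.le, ha2⟩) (hprim 0 ⟨le_rfl, ha₁⟩) hdisc _ ?_ ?_
    · have : 0 ≤ d * (i : ℕ) := by positivity
      linarith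
    · have : d * (i : ℕ) ≤ d * n := by gcongr
      rw [hT₀]
      linarith
  choose x hx hxe using hpt
  have hinj : Function.Injective fun i => Real.exp (x i) := by
    intro i j hij
    have hij' : x i = x j := Real.exp_injective hij
    by_contra hne
    wlog hlt : i < j generalizing i j
    · exact this hij.symm hij'.symm (Ne.symm hne) (lt_of_le_of_ne (not_lt.1 hlt) (Ne.symm hne))
    have h1 : (i : ℝ) + 1 ≤ (j : ℕ) := by exact_mod_cast Nat.succ_le_of_lt hlt
    have h2 : d * ((i : ℕ) + 1) ≤ d * (j : ℕ) := by gcongr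
    have h3 := (hx i).2
    have h4 := (hx j).1
    linarith
  have hsub : range (fun i => Real.exp (x i)) ⊆ {r ∈ Ioo 0 ρ | U a r - v r = 0} := by
    rintro _ ⟨i, rfl⟩
    refine ⟨⟨Real.exp_pos _, ?_⟩, sub_eq_zero.2 (hxe i)⟩
    rw [← Real.lt_log_iff_exp_lt hρ.1]
    have hi : (i : ℝ) ≤ n := by exact_mod_cast Nat.lt_succ_iff.1 i.2
    have : d * (i : ℕ) ≤ d * n := by gcongr
    have := (hx i).2
    rw [hT₀] at this
    linarith
  have hcard : (range fun i => Real.exp (x i)).encard = (n + 1 : ℕ) := by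
    rw [← image_univ, hinj.encard_image, encard_univ, ENat.card_eq_coe_fintype_card,
      Fintype.card_fin]
  have hle := encard_le_encard hsub
  rw [hcard] at hle
  refine lt_of_lt_of_le ?_ hle
  exact_mod_cast Nat.lt_succ_self n

end Stable

end MEMS

end

/-! ### Profile and regularity of the singular solution at the origin -/

noncomputable section

namespace MEMS

namespace Sol

variable {α β γ ubar q r₀ : ℝ} {g u F : ℝ → ℝ}

lemma exists_radius_lt {a u₂ : ℝ} (h : Sol α β γ ubar g a r₀ u F) (ha : a < u₂) (hr₀ : 0 < r₀) :
    ∃ r₂ ∈ Ioc 0 r₀, ∀ r ∈ Ioo 0 r₂, u r < u₂ := by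
  obtain ⟨δ, hδ, hsub⟩ := (mem_nhdsGT_iff_exists_Ioo_subset' hr₀).1
    (h.u_lim.eventually_lt_const ha)
  exact ⟨min δ r₀, ⟨lt_min hδ hr₀, min_le_right _ _⟩,
    fun r hr => hsub ⟨hr.1, hr.2.trans_le (min_le_left _ _)⟩⟩

/-- The dynamics of a singular solution converges to the interior equilibrium. -/
lemma tendsto_dist (h : Sol α β γ ubar g 0 r₀ u F) (e : Exponents α β γ)
    (hg : Convexlike ubar g) (hr₀ : 0 < r₀)
    (hq : Tendsto (fun u => deriv g u ^ 2 / (g u * deriv (deriv g) u)) (𝓝[>] 0) (𝓝 q))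
    (hq3 : q = 1 → ∀ᶠ u in 𝓝[>] (0 : ℝ), 1 ≤ deriv g u ^ 2 / (g u * deriv (deriv g) u))
    {L : ℝ} (hLq : L = 1 / (2 - 1 / q)) (hL : 0 < L) (hL1 : L ≤ 1) :
    Tendsto (fun t => (wT β γ g u F t - (γ - L * β * theta α β γ)) ^ 2
      + (etaT α β g u F t - theta α β γ) ^ 2) atBot (𝓝 0) := by
  obtain ⟨K, C, hC, c, hc, μ₀, hμ₀, H⟩ := exists_approach (-Real.log (lowConst α β γ))
    e.one_le e.theta_pos e.mul_theta_lt hL hL1 (etaBound_pos e)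
  rw [Metric.tendsto_nhds]
  intro ε hε
  -- The tolerance for |ℓ - L| shrinks with ε; near the origin the regime for this smaller μ
  -- applies.
  set μ := min μ₀ (ε / (4 * C)) with hμ
  have hμpos : 0 < μ := lt_min hμ₀ (by positivity)
  obtain ⟨u₂, hu⟩ := hg.exists_regime hq hq3 hμpos
  rw [← hLq] at hu
  obtain ⟨r₂, hr₂, hlt⟩ := h.exists_radius_lt hu.pos hr₀
  obtain ⟨S, -, hS⟩ := exists_exp_le hc (show 0 < ε / (4 * C) by positivity)
  have h' := h.restrict hr₂.2
  have hmem : ∀ r ∈ Ioo 0 r₂, u r ∈ Ioo 0 u₂ := fun r hr => ⟨(h'.mem r hr).1, hlt r hr⟩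
  filter_upwards [Iio_mem_atBot (Real.log r₂)] with t ht
  have hlim := h'.tendsto_exp_yT hg hr₂.1 ⟨le_rfl, hg.ubar_pos⟩
  rw [prim_zero] at hlim
  have h0 := hS (max S 0) (le_max_left _ _)
  have hT : t - max S 0 ≤ t := by linarith [le_max_right S 0]
  -- Since G(0) = 0 lies below every exponential, T₀ is unrestricted for a singular solution and can
  -- be placed a time max(S, 0) before t.
  have key := H (Real.log r₂) μ 0 _ _ _ _ (h'.traj e hg hr₂.1 fun r hr => hu.ell_le _ (hmem r hr))
    hμpos.le (min_le_left _ _) (fun t ht => hu.near _ (hmem _ (exp_mem hr₂.1 ht)))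
    (h'.yT_ge e hg hr₂.1) hlim (t - max S 0) (hT.trans_lt ht) (Real.exp_pos _) t ht hT
  rw [sub_sub_cancel] at key
  have h1 : μ ≤ ε / (4 * C) := min_le_right _ _
  have h2 : C * (Real.exp (-c * max S 0) + μ) ≤ C * (ε / (4 * C) + ε / (4 * C)) := by gcongr
  have h3 : C * (ε / (4 * C) + ε / (4 * C)) = ε / 2 := by field_simp; ring
  rw [Real.dist_eq, sub_zero, abs_of_nonneg (by positivity)]
  linarith

lemma tendsto_of_sq_add_sq {φ ψ : ℝ → ℝ} {a b : ℝ} {l : Filter ℝ}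
    (h : Tendsto (fun t => (φ t - a) ^ 2 + (ψ t - b) ^ 2) l (𝓝 0)) :
    Tendsto φ l (𝓝 a) ∧ Tendsto ψ l (𝓝 b) := by
  have key : ∀ χ : ℝ → ℝ, ∀ c, (∀ t, (χ t - c) ^ 2 ≤ (φ t - a) ^ 2 + (ψ t - b) ^ 2) →
      Tendsto χ l (𝓝 c) := fun χ c hle => by
    have h1 : Tendsto (fun t => (χ t - c) ^ 2) l (𝓝 0) :=
      squeeze_zero (fun t => sq_nonneg _) hle h
    have h2 := h1.sqrt
    rw [Real.sqrt_zero] at h2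
    rw [tendsto_iff_dist_tendsto_zero]
    refine h2.congr fun t => ?_
    rw [Real.sqrt_sq_eq_abs, Real.dist_eq]
  exact ⟨key φ a fun t => by linarith [sq_nonneg (ψ t - b)],
    key ψ b fun t => by linarith [sq_nonneg (φ t - a)]⟩

lemma A_eq (e : Exponents α β γ) (L : ℝ) :
    A α β γ L = theta α β γ * (γ - L * β * theta α β γ) ^ (1 / β) := by
  have := e.mul_theta
  unfold A
  rw [mul_assoc, this, show γ - α + β = β + γ - α by ring]

lemma equilibrium_pos (e : Exponents α β γ) {L : ℝ} (hL1 : L ≤ 1) :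
    0 < γ - L * β * theta α β γ := by
  have h1 := e.mul_theta_lt
  have h2 : L * (β * theta α β γ) ≤ 1 * (β * theta α β γ) :=
    mul_le_mul_of_nonneg_right hL1 (mul_pos e.β_pos e.theta_pos).le
  linarith

lemma A_pos (e : Exponents α β γ) {L : ℝ} (hL1 : L ≤ 1) : 0 < A α β γ L := by
  rw [A_eq e]
  exact mul_pos e.theta_pos (Real.rpow_pos_of_pos (equilibrium_pos e hL1) _)

/-- The profile of a singular solution at the origin: `G(u(r)) ∼ r ^ θ / A`, together with the
limit `θ` of the logarithmic derivative of `G(u(r))`. -/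
lemma tendsto_profile (h : Sol α β γ ubar g 0 r₀ u F) (e : Exponents α β γ)
    (hg : Convexlike ubar g) (hr₀ : 0 < r₀)
    (hq : Tendsto (fun u => deriv g u ^ 2 / (g u * deriv (deriv g) u)) (𝓝[>] 0) (𝓝 q))
    (hq3 : q = 1 → ∀ᶠ u in 𝓝[>] (0 : ℝ), 1 ≤ deriv g u ^ 2 / (g u * deriv (deriv g) u))
    {L : ℝ} (hLq : L = 1 / (2 - 1 / q)) (hL : 0 < L) (hL1 : L ≤ 1) :
    Tendsto (fun r => prim g (u r) / r ^ theta α β γ) (𝓝[>] 0) (𝓝 (1 / A α β γ L)) ∧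
    Tendsto (fun r => r * g (u r) * slope α β r (F r) / prim g (u r)) (𝓝[>] 0)
      (𝓝 (theta α β γ)) := by
  obtain ⟨hw, hη⟩ := tendsto_of_sq_add_sq (h.tendsto_dist e hg hr₀ hq hq3 hLq hL hL1)
  have hβ := e.β_pos
  have hw0 := equilibrium_pos e hL1
  have hθ := e.theta_pos
  have hη' := hη.comp Real.tendsto_log_nhdsGT_zero
  have hw' := hw.comp Real.tendsto_log_nhdsGT_zero
  have hev : ∀ᶠ r in 𝓝[>] (0 : ℝ), r ∈ Ioo 0 r₀ := Ioo_mem_nhdsGT hr₀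
  have heta : Tendsto (fun r => r * g (u r) * slope α β r (F r) / prim g (u r)) (𝓝[>] 0)
      (𝓝 (theta α β γ)) := by
    refine hη'.congr' ?_
    filter_upwards [hev] with r hr using h.etaT_eq hg hr
  have hww : Tendsto (fun r => r ^ γ / (g (u r) ^ β * F r)) (𝓝[>] 0)
      (𝓝 (γ - L * β * theta α β γ)) := by
    refine hw'.congr' ?_
    filter_upwards [hev] with r hr using h.wT_eq hg hr
  refine ⟨?_, heta⟩
  -- The identity η w^(1/β) = r^θ / G(u) produces the limit θ w₀^(1/β) = A.
  have h1 := (heta.mul (hww.rpow_const (p := 1 / β) (Or.inl hw0.ne'))).inv₀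
    (mul_pos hθ (Real.rpow_pos_of_pos hw0 _)).ne'
  rw [← A_eq e, ← one_div (A α β γ L)] at h1
  refine h1.congr' ?_
  filter_upwards [hev] with r hr
  have hr0 := hr.1
  have i1 := hg.pos _ (h.mem r hr)
  have i2 := h.F_pos r hr
  have i3 := hg.prim_pos (h.mem r hr)
  have hmul : g (u r) ^ β * F r * (r ^ γ / (g (u r) ^ β * F r)) = r ^ γ := by
    field_simp
  have i4 : g (u r) * slope α β r (F r) * (r ^ γ / (g (u r) ^ β * F r)) ^ (1 / β)
      = r ^ (theta α β γ - 1) := by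
    rw [mul_slope hβ i1 i2]
    have : slope α β r (g (u r) ^ β * F r) * (r ^ γ / (g (u r) ^ β * F r)) ^ (1 / β)
        = slope α β r (r ^ γ) := by
      unfold slope
      rw [mul_assoc, ← Real.mul_rpow (by positivity) (by positivity), hmul]
    rw [this]
    have := slope_power (α := α) (β := β) (γ := γ) hr0 one_pos
    rwa [one_mul, Real.one_rpow, one_mul] at this
  have i5 : r * r ^ (theta α β γ - 1) = r ^ theta α β γ := by
    rw [Real.rpow_sub hr0, Real.rpow_one]; field_simp
  calc (r * g (u r) * slope α β r (F r) / prim g (u r)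
        * (r ^ γ / (g (u r) ^ β * F r)) ^ (1 / β))⁻¹
      = (r * (g (u r) * slope α β r (F r) * (r ^ γ / (g (u r) ^ β * F r)) ^ (1 / β))
          / prim g (u r))⁻¹ := by congr 1; ring
    _ = prim g (u r) / r ^ theta α β γ := by rw [i4, i5, inv_div]

/-- The solution maps right neighbourhoods of the origin onto right neighbourhoods. -/
lemma nhdsGT_le_map (h : Sol α β γ ubar g 0 r₀ u F) (hr₀ : 0 < r₀) :
    𝓝[>] (0 : ℝ) ≤ Filter.map u (𝓝[>] 0) := by
  intro S hS
  obtain ⟨δ', hδ', hsub'⟩ := (mem_nhdsGT_iff_exists_Ioo_subset' hr₀).1 (mem_map.1 hS)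
  set δ := min δ' r₀ / 2 with hδ
  have hm : 0 < min δ' r₀ := lt_min hδ' hr₀
  have hδ0 : 0 < δ := by positivity
  have hlt : δ < min δ' r₀ := by rw [hδ]; linarith
  have hδr : δ < r₀ := hlt.trans_le (min_le_right _ _)
  have hsub : ∀ r ∈ Ioo 0 δ, u r ∈ S := fun r hr =>
    hsub' ⟨hr.1, hr.2.trans (hlt.trans_le (min_le_left _ _))⟩
  have hc : ContinuousOn u (Icc 0 δ) :=
    h.continuousOn.mono fun x hx => ⟨hx.1, hx.2.trans_lt hδr⟩
  have hiv := intermediate_value_Ioo hδ0.le hc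
  rw [h.init] at hiv
  refine mem_of_superset (Ioo_mem_nhdsGT (h.mem δ ⟨hδ0, hδr⟩).1) fun x hx => ?_
  obtain ⟨r, hr, rfl⟩ := hiv hx
  exact hsub r hr

lemma tendsto_nhdsGT (h : Sol α β γ ubar g 0 r₀ u F) (hr₀ : 0 < r₀) :
    Tendsto u (𝓝[>] 0) (𝓝[>] 0) := by
  refine tendsto_nhdsWithin_iff.2 ⟨h.u_lim, ?_⟩
  filter_upwards [Ioo_mem_nhdsGT hr₀] with r hr using (h.mem r hr).1

lemma hasDerivWithinAt_zero_iff (h : Sol α β γ ubar g 0 r₀ u F) {m : ℝ} :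
    HasDerivWithinAt u m (Ici 0) 0 ↔ Tendsto (fun r => u r / r) (𝓝[>] 0) (𝓝 m) := by
  rw [hasDerivWithinAt_iff_tendsto_slope, Ici_sdiff_left]
  refine tendsto_congr fun r => ?_
  rw [slope_def_field, h.init, sub_zero, sub_zero]

/-- The derivative at the origin, when `s ^ θ / G(s)` has a finite limit. -/
lemma tendsto_quotient (h : Sol α β γ ubar g 0 r₀ u F) (e : Exponents α β γ)
    (hg : Convexlike ubar g) (hr₀ : 0 < r₀) {Λ l : ℝ}
    (hprof : Tendsto (fun r => prim g (u r) / r ^ theta α β γ) (𝓝[>] 0) (𝓝 (1 / Λ)))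
    (hl : Tendsto (fun s => s ^ theta α β γ / prim g s) (𝓝[>] 0) (𝓝 l)) :
    Tendsto (fun r => u r / r) (𝓝[>] 0) (𝓝 ((1 / Λ * l) ^ (1 / theta α β γ))) := by
  have hθ := e.theta_pos
  have h1 := (hprof.mul (hl.comp (h.tendsto_nhdsGT hr₀))).rpow_const
    (p := 1 / theta α β γ) (Or.inr (by positivity))
  refine h1.congr' ?_
  filter_upwards [Ioo_mem_nhdsGT hr₀] with r hr
  have hr0 := hr.1
  have i0 := (h.mem r hr).1
  have i3 := hg.prim_pos (h.mem r hr)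
  have : prim g (u r) / r ^ theta α β γ * (u r ^ theta α β γ / prim g (u r))
      = (u r / r) ^ theta α β γ := by
    rw [Real.div_rpow i0.le hr0.le]; field_simp
  simp only [Function.comp_apply]
  rw [this, ← Real.rpow_mul (by positivity), mul_one_div_cancel hθ.ne', Real.rpow_one]

/-- Along s = u(r) the quotient equals (u/r)^θ divided by G(u)/r^θ. As u maps right neighbourhoods
of 0 onto right neighbourhoods, a limit along u is a limit in s. -/
lemma tendsto_rpow_div_prim (h : Sol α β γ ubar g 0 r₀ u F) (hg : Convexlike ubar g) (hr₀ : 0 < r₀)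
    {Λ m : ℝ} (hΛ : 0 < Λ) (hθ : 0 < theta α β γ)
    (hprof : Tendsto (fun r => prim g (u r) / r ^ theta α β γ) (𝓝[>] 0) (𝓝 (1 / Λ)))
    (hm : Tendsto (fun r => u r / r) (𝓝[>] 0) (𝓝 m)) :
    Tendsto (fun s => s ^ theta α β γ / prim g s) (𝓝[>] 0) (𝓝 (m ^ theta α β γ / (1 / Λ))) := by
  have h1 := (hm.rpow_const (p := theta α β γ) (Or.inr hθ.le)).div hprof (one_div_pos.2 hΛ).ne'
  refine Tendsto.mono_left (tendsto_map'_iff.2 (h1.congr' ?_)) (h.nhdsGT_le_map hr₀)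
  filter_upwards [Ioo_mem_nhdsGT hr₀] with r hr
  have hr0 := hr.1
  have i0 := (h.mem r hr).1
  have i3 := hg.prim_pos (h.mem r hr)
  simp only [Pi.div_apply, Function.comp_apply]
  rw [Real.div_rpow i0.le hr0.le]
  field_simp

/-- The factorization u' = (u/r) · η · G/(g u), each factor having a limit. -/
lemma tendsto_slope_zero (h : Sol α β γ ubar g 0 r₀ u F) (hg : Convexlike ubar g) (hr₀ : 0 < r₀)
    {L m : ℝ} (hL : Tendsto (ell g) (𝓝[>] 0) (𝓝 L))
    (heta : Tendsto (fun r => r * g (u r) * slope α β r (F r) / prim g (u r)) (𝓝[>] 0)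
      (𝓝 (theta α β γ))) (hm : Tendsto (fun r => u r / r) (𝓝[>] 0) (𝓝 m)) :
    Tendsto (deriv u) (𝓝[>] 0) (𝓝 (m * theta α β γ * (1 - L))) := by
  refine ((hm.mul heta).mul ((hg.tendsto_prim_div hL).comp (h.tendsto_nhdsGT hr₀))).congr' ?_
  filter_upwards [Ioo_mem_nhdsGT hr₀] with r hr
  have hr0 := hr.1
  have i0 := (h.mem r hr).1
  have i1 := hg.pos _ (h.mem r hr)
  have i3 := hg.prim_pos (h.mem r hr)
  rw [(h.du r hr).deriv]
  simp only [Function.comp_apply]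
  field_simp

lemma isC1AtOrigin (h : Sol α β γ ubar g 0 r₀ u F) (hr₀ : 0 < r₀) {m : ℝ}
    (hm : Tendsto (deriv u) (𝓝[>] 0) (𝓝 m)) : IsC1AtOrigin u := by
  refine ⟨r₀, hr₀, ?_⟩
  rw [contDiffOn_one_iff_derivWithin (uniqueDiffOn_Ico 0 r₀)]
  have h0 : HasDerivWithinAt u m (Ici 0) 0 := by
    refine hasDerivWithinAt_Ici_of_tendsto_deriv (s := Ioo 0 r₀)
      (fun r hr => (h.du r hr).differentiableAt.differentiableWithinAt) ?_ (Ioo_mem_nhdsGT hr₀) hm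
    exact (h.continuousOn 0 ⟨le_rfl, hr₀⟩).mono Ioo_subset_Ico_self
  have h0' : HasDerivWithinAt u m (Ico 0 r₀) 0 := h0.mono Ico_subset_Ici_self
  have hud := uniqueDiffOn_Ico 0 r₀
  have hev : ∀ r ∈ Ioo 0 r₀, derivWithin u (Ico 0 r₀) r = slope α β r (F r) := fun r hr =>
    (h.du r hr).hasDerivWithinAt.derivWithin (hud r ⟨hr.1.le, hr.2⟩)
  constructor
  · intro r hr
    rcases hr.1.eq_or_lt with hr0 | hr0
    · rw [← hr0]
      exact h0'.differentiableWithinAt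
    · exact (h.du r ⟨hr0, hr.2⟩).differentiableAt.differentiableWithinAt
  · intro r hr
    rcases hr.1.eq_or_lt with hr0 | hr0
    · rw [← hr0]
      have hc : ContinuousWithinAt (derivWithin u (Ico 0 r₀)) (Ioi 0) 0 := by
        rw [ContinuousWithinAt, h0'.derivWithin (hud 0 ⟨le_rfl, hr₀⟩)]
        refine hm.congr' ?_
        filter_upwards [Ioo_mem_nhdsGT hr₀] with x hx
        rw [hev x hx, (h.du x hx).deriv]
      exact (continuousWithinAt_Ioi_iff_Ici.1 hc).mono Ico_subset_Ici_self
    · have hc : ContinuousAt (fun r => slope α β r (F r)) r :=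
        (h.hasDerivAt_slope ⟨hr0, hr.2⟩).continuousAt
      refine (hc.congr ?_).continuousWithinAt
      filter_upwards [Ioo_mem_nhds hr0 hr.2] with x hx using (hev x hx).symm

lemma _root_.MEMS.IsC1AtOrigin.exists_tendsto_div (hC : IsC1AtOrigin u)
    (h : Sol α β γ ubar g 0 r₀ u F) : ∃ m, Tendsto (fun r => u r / r) (𝓝[>] 0) (𝓝 m) := by
  obtain ⟨ε, hε, hd⟩ := hC
  have h1 := ((hd.differentiableOn one_ne_zero) 0 ⟨le_rfl, hε⟩).hasDerivWithinAt
  refine ⟨_, h.hasDerivWithinAt_zero_iff.1 (h1.mono_of_mem_nhdsWithin ?_)⟩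
  exact Ico_mem_nhdsGE hε

lemma isC1AtOrigin_iff (h : Sol α β γ ubar g 0 r₀ u F) (e : Exponents α β γ)
    (hg : Convexlike ubar g) (hr₀ : 0 < r₀) {L Λ : ℝ} (hΛ : 0 < Λ)
    (hL : Tendsto (ell g) (𝓝[>] 0) (𝓝 L))
    (hprof : Tendsto (fun r => prim g (u r) / r ^ theta α β γ) (𝓝[>] 0) (𝓝 (1 / Λ)))
    (heta : Tendsto (fun r => r * g (u r) * slope α β r (F r) / prim g (u r)) (𝓝[>] 0)
      (𝓝 (theta α β γ))) :
    IsC1AtOrigin u ↔ ∃ l, Tendsto (fun s => s ^ theta α β γ / prim g s) (𝓝[>] 0) (𝓝 l) := by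
  constructor
  · intro hC
    obtain ⟨m, hm⟩ := hC.exists_tendsto_div h
    exact ⟨_, h.tendsto_rpow_div_prim hg hr₀ hΛ e.theta_pos hprof hm⟩
  · rintro ⟨l, hl⟩
    exact h.isC1AtOrigin hr₀ (h.tendsto_slope_zero hg hr₀ hL heta
      (h.tendsto_quotient e hg hr₀ hprof hl))

/-- For m = u'(0) the limit of u' is mθ(1-L), which must equal m; hence m = 0 and s^θ/G(s) → 0. But
θ(1-L) < 1 gives θG < s g near 0, so this positive quotient is nonincreasing there and cannot tend
to 0 at the origin. -/
lemma not_isC1AtOrigin (h : Sol α β γ ubar g 0 r₀ u F) (e : Exponents α β γ)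
    (hg : Convexlike ubar g) (hr₀ : 0 < r₀) {L Λ : ℝ} (hΛ : 0 < Λ)
    (hL : Tendsto (ell g) (𝓝[>] 0) (𝓝 L))
    (hprof : Tendsto (fun r => prim g (u r) / r ^ theta α β γ) (𝓝[>] 0) (𝓝 (1 / Λ)))
    (heta : Tendsto (fun r => r * g (u r) * slope α β r (F r) / prim g (u r)) (𝓝[>] 0)
      (𝓝 (theta α β γ))) (hlt : theta α β γ * (1 - L) < 1) : ¬ IsC1AtOrigin u := by
  intro hC
  have hθ := e.theta_pos
  obtain ⟨m, hm⟩ := hC.exists_tendsto_div h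
  have hd := h.tendsto_slope_zero hg hr₀ hL heta hm
  have h0 : HasDerivWithinAt u (m * theta α β γ * (1 - L)) (Ici 0) 0 := by
    refine hasDerivWithinAt_Ici_of_tendsto_deriv (s := Ioo 0 r₀)
      (fun r hr => (h.du r hr).differentiableAt.differentiableWithinAt) ?_ (Ioo_mem_nhdsGT hr₀) hd
    exact (h.continuousOn 0 ⟨le_rfl, hr₀⟩).mono Ioo_subset_Ico_self
  have hmm : m = m * theta α β γ * (1 - L) :=
    tendsto_nhds_unique hm (h.hasDerivWithinAt_zero_iff.1 h0)
  have hm0 : m = 0 := by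
    have h2 : m * (1 - theta α β γ * (1 - L)) = 0 := by linarith
    rcases mul_eq_zero.1 h2 with h3 | h3
    · exact h3
    · linarith
  have hl := h.tendsto_rpow_div_prim hg hr₀ hΛ hθ hprof hm
  rw [hm0, Real.zero_rpow hθ.ne', zero_div] at hl
  have hev := ((hg.tendsto_prim_div hL).const_mul (theta α β γ)).eventually_lt_const hlt
  obtain ⟨δ, hδ, hsub⟩ := (mem_nhdsGT_iff_exists_Ioo_subset' hg.ubar_pos).1 (hev.and hg.Ioo_mem)
  replace hδ : 0 < δ := hδ
  have hanti : AntitoneOn (fun s => s ^ theta α β γ / prim g s) (Ioo 0 δ) := by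
    refine antitoneOn_of_hasDerivAt_nonpos (convex_Ioo 0 δ) (fun x hx =>
      (Real.hasDerivAt_rpow_const (Or.inl hx.1.ne')).div (hg.hasDerivAt_prim (hsub hx).2)
        (hg.prim_pos (hsub hx).2).ne') fun x hx => ?_
    obtain ⟨hx1, hx2⟩ := hsub hx
    have hx0 := hx.1
    have i1 := hg.pos _ hx2
    have i2 := hg.prim_pos hx2
    apply div_nonpos_of_nonpos_of_nonneg _ (sq_nonneg _)
    have i3 : x ^ theta α β γ = x ^ (theta α β γ - 1) * x := by
      rw [Real.rpow_sub hx0, Real.rpow_one]; field_simp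
    have i4 : theta α β γ * prim g x < g x * x := by
      change theta α β γ * (prim g x / (g x * x)) < 1 at hx1
      rwa [← mul_div_assoc, div_lt_one (by positivity)] at hx1
    have i5 : (0 : ℝ) < x ^ (theta α β γ - 1) := by positivity
    rw [i3]
    nlinarith
  have hx : δ / 2 ∈ Ioo 0 δ := ⟨by linarith, by linarith⟩
  have hpos : 0 < (δ / 2) ^ theta α β γ / prim g (δ / 2) :=
    div_pos (Real.rpow_pos_of_pos hx.1 _) (hg.prim_pos (hsub hx).2)
  refine absurd (ge_of_tendsto hl ?_) (not_le.2 hpos)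
  filter_upwards [Ioo_mem_nhdsGT hx.1] with s hs
  exact hanti ⟨hs.1, hs.2.trans hx.2⟩ hx hs.2.le

end Sol

end MEMS

end

/-! ### Exponents and the discriminant at the equilibrium -/

noncomputable section

namespace MEMS

lemma Exponents.tau_eq {α β γ : ℝ} (e : Exponents α β γ) :
    tau α β γ = (β + 1) * γ - β * theta α β γ := by
  rw [e.mul_theta]; unfold tau; ring

lemma Exponents.one_lt_tau {α β γ : ℝ} (e : Exponents α β γ) : 1 < tau α β γ := by
  have h1 := e.one_le
  have h2 := e.lt_α
  have h3 := e.lt_γ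
  unfold tau
  nlinarith

lemma convexlike_g {β ubar : ℝ} {f : ℝ → ℝ} (hβ : 0 < β) (hubar : 0 < ubar)
    (hf_cont : ContinuousOn f (Ico 0 ubar)) (hf_C2 : ContDiffOn ℝ 2 f (Ioo 0 ubar))
    (hf_zero : f 0 = 0) (hf_pos : ∀ u ∈ Ioo 0 ubar, 0 < f u)
    (hG1 : ∀ u ∈ Ioo 0 ubar, 0 < deriv (g f β) u ∧ 0 < deriv (deriv (g f β)) u) :
    Convexlike ubar (g f β) := by
  have hC2 : ContDiffOn ℝ 2 (g f β) (Ioo 0 ubar) :=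
    hf_C2.rpow_const_of_ne fun x hx => (hf_pos x hx).ne'
  have hC1 : ContDiffOn ℝ 1 (deriv (g f β)) (Ioo 0 ubar) := by
    rw [show (2 : WithTop ℕ∞) = 1 + 1 from rfl,
      contDiffOn_succ_iff_deriv_of_isOpen isOpen_Ioo] at hC2
    exact hC2.2.2
  refine ⟨hubar, ?_, ?_, fun u hu => Real.rpow_pos_of_pos (hf_pos u hu) _, fun u hu => ?_,
    fun u hu => ?_, fun u hu => (hG1 u hu).1, fun u hu => (hG1 u hu).2⟩
  · unfold g
    rw [hf_zero, Real.zero_rpow (one_div_pos.2 hβ).ne']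
  · exact hf_cont.rpow_const fun x _ => Or.inr (one_div_pos.2 hβ).le
  · exact ((hC2.differentiableOn (by norm_num)).differentiableAt
      (Ioo_mem_nhds hu.1 hu.2)).hasDerivAt
  · exact ((hC1.differentiableOn (by norm_num)).differentiableAt
      (Ioo_mem_nhds hu.1 hu.2)).hasDerivAt

lemma limit_ell_mem {q : ℝ} (hq : 1 ≤ q) : 1 / (2 - 1 / q) ∈ Ioc (1 / 2 : ℝ) 1 := by
  have h0 : 0 < 1 / q := by positivity
  have h1 : 1 / q ≤ 1 := by rw [div_le_one (by linarith)]; exact hq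
  constructor
  · exact one_div_lt_one_div_of_lt (by linarith) (by linarith)
  · rw [div_le_one (by linarith)]; linarith

/-- With 1 - L = (q-1)/(2q-1), the condition on (γ-α)/β is exactly θ(q-1) < 2q-1. -/
lemma theta_mul_lt_one {α β γ q : ℝ} (hq : q = 1 ∨ (1 < q ∧ (γ - α) / β < q / (q - 1))) :
    theta α β γ * (1 - 1 / (2 - 1 / q)) < 1 := by
  rcases hq with rfl | ⟨h1, h2⟩
  · norm_num
  · have h3 : 0 < q - 1 := by linarith
    have h4 : 0 < 2 * q - 1 := by linarith
    have h5 : 1 - 1 / (2 - 1 / q) = (q - 1) / (2 * q - 1) := by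
      have : 2 - 1 / q = (2 * q - 1) / q := by field_simp
      rw [this, one_div_div, eq_div_iff h4.ne', sub_mul, div_mul_cancel₀ _ h4.ne']
      ring
    rw [lt_div_iff₀ h3] at h2
    rw [h5, ← mul_div_assoc, div_lt_one h4]
    unfold theta
    linarith

/-- Below the critical exponent the linearisation at the equilibrium is oscillatory. -/
lemma discriminant_neg {α β γ q : ℝ} (e : Exponents α β γ) (hq : 1 ≤ q)
    (hqc : (q : EReal) < qc α β γ) {L : ℝ} (hL : L = 1 / (2 - 1 / q)) :
    ((1 - L) * theta α β γ + (γ - L * β * theta α β γ)) ^ 2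
      < 4 * (theta α β γ * (γ - L * β * theta α β γ)) := by
  have hLmem := limit_ell_mem hq
  rw [← hL] at hLmem
  have hβ := e.β_pos
  have hθ := e.theta_pos
  have hτ : 0 < tau α β γ := by linarith [e.one_lt_tau]
  have hτeq := e.tau_eq
  have hlt := e.mul_theta_lt
  have hL4 : L = 1 / 2 + 1 / (4 * (q - 1 / 2)) := by
    have : 2 - 1 / q = (2 * q - 1) / q := by field_simp
    have h4 : 2 * q - 1 ≠ 0 := by linarith
    have h5 : 4 * (q - 1 / 2) = 2 * (2 * q - 1) := by ring
    rw [hL, this, one_div_div, h5, div_eq_iff h4, add_mul, one_div_mul_eq_div,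
      one_div_mul_eq_div, div_mul_cancel_right₀ h4]
    ring
  set p := √(tau α β γ) with hp
  set r := √(theta α β γ) with hr
  have hp2 : p ^ 2 = tau α β γ := Real.sq_sqrt hτ.le
  have hr2 : r ^ 2 = theta α β γ := Real.sq_sqrt hθ.le
  have hp0 : 0 < p := Real.sqrt_pos.2 hτ
  have hr0 : 0 < r := Real.sqrt_pos.2 hθ
  set X := L * theta α β γ * (β + 1) ^ 2 with hX
  have hden : qcDenom α β γ = 4 * (p - r) ^ 2 - 2 * theta α β γ * (β + 1) ^ 2 := rfl
  have hB : 0 < theta α β γ * (β + 1) ^ 2 := by positivity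
  -- This is q < q_c rewritten through L = 1/2 + 1/(4(q - 1/2)). When q_c is infinite it follows
  -- from L > 1/2 alone.
  have hlow : (p - r) ^ 2 < X := by
    unfold qc at hqc
    split_ifs at hqc with hD
    · have h1 : 1 / 2 * (theta α β γ * (β + 1) ^ 2) < L * (theta α β γ * (β + 1) ^ 2) :=
        mul_lt_mul_of_pos_right hLmem.1 hB
      rw [hden] at hD
      rw [hX]
      linarith
    · rw [EReal.coe_lt_coe_iff] at hqc
      push Not at hD
      have h1 : (q - 1 / 2) * qcDenom α β γ < theta α β γ * (β + 1) ^ 2 := by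
        rw [← lt_div_iff₀ hD]; linarith
      have hq2 : 0 < q - 1 / 2 := by linarith
      have h2 : qcDenom α β γ / 4 < 1 / (4 * (q - 1 / 2)) * (theta α β γ * (β + 1) ^ 2) := by
        rw [one_div, inv_mul_eq_div, lt_div_iff₀ (by positivity)]
        linarith
      have h3 : X = 1 / 2 * (theta α β γ * (β + 1) ^ 2)
          + 1 / (4 * (q - 1 / 2)) * (theta α β γ * (β + 1) ^ 2) := by rw [hX, hL4]; ring
      linarith
  -- The upper root imposes no condition: βθ < γ gives τ > β²θ, so √τ + √θ > (β+1)√θ, while L ≤ 1.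
  have hup : X < (p + r) ^ 2 := by
    have h1 : X ≤ 1 * (theta α β γ * (β + 1) ^ 2) := by
      rw [hX, mul_assoc]
      exact mul_le_mul_of_nonneg_right hLmem.2 hB.le
    have h2 : β * r < p := by
      apply lt_of_pow_lt_pow_left₀ 2 hp0.le
      rw [mul_pow, hr2, hp2, hτeq]
      nlinarith
    have h3 : (r * (β + 1)) ^ 2 < (p + r) ^ 2 := by
      apply pow_lt_pow_left₀ _ (by positivity) two_ne_zero
      linarith
    rw [mul_pow, hr2] at h3
    linarith
  -- (β+1)² times the discriminant b² - 4a is a quadratic in X = Lθ(β+1)² with roots (√τ ± √θ)²; X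
  -- lies strictly between them.
  have hkey : X ^ 2 - 2 * X * (p ^ 2 + r ^ 2) + (p ^ 2 - r ^ 2) ^ 2 < 0 := by
    have : X ^ 2 - 2 * X * (p ^ 2 + r ^ 2) + (p ^ 2 - r ^ 2) ^ 2
        = (X - (p - r) ^ 2) * (X - (p + r) ^ 2) := by ring
    rw [this]
    exact mul_neg_of_pos_of_neg (by linarith) (by linarith)
  rw [hp2, hr2, hτeq, hX] at hkey
  have hfac : (β + 1) ^ 2 * (((1 - L) * theta α β γ + (γ - L * β * theta α β γ)) ^ 2
      - 4 * (theta α β γ * (γ - L * β * theta α β γ))) < 0 := by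
    refine lt_of_eq_of_lt ?_ hkey
    ring
  have := (mul_neg_iff.1 hfac).resolve_right (by
    rintro ⟨h, -⟩
    exact absurd h (not_lt.2 (sq_nonneg _)))
  linarith [this.2]

end MEMS

end

/-! ### Assembly of the theorem -/

theorem theorem1 (α β γ ubar q : ℝ) (f : ℝ → ℝ)
    (hβ : 1 ≤ β) (hβα : β < α) (hαγ : α < γ)
    (hubar : 0 < ubar)
    (hf_cont : ContinuousOn f (Ico 0 ubar))
    (hf_C2 : ContDiffOn ℝ 2 f (Ioo 0 ubar))
    (hf_zero : f 0 = 0)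
    (hf_pos : ∀ u ∈ Ioo 0 ubar, 0 < f u)
    (hG1 : ∀ u ∈ Ioo 0 ubar, 0 < deriv (MEMS.g f β) u ∧ 0 < deriv (deriv (MEMS.g f β)) u)
    (hG2 : Tendsto (MEMS.qQuot f β) (𝓝[>] 0) (𝓝 q))
    (hG3 : q = 1 → ∀ᶠ u in 𝓝[>] (0 : ℝ), 1 ≤ MEMS.qQuot f β u) :
    1 ≤ q ∧ 1 < MEMS.theta α β γ ∧ 1 < MEMS.tau α β γ ∧
    ∃ L : ℝ, Tendsto (MEMS.LQuot f β) (𝓝[>] 0) (𝓝 L) ∧ L ∈ Ioc (1 / 2) 1 ∧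
    0 < MEMS.A α β γ L ∧
    ∃ R > 0, ∀ r₀ : ℝ, 0 < r₀ → r₀ ≤ R →
    ∃ (ustar : ℝ → ℝ) (a₀ : ℝ) (U : ℝ → ℝ → ℝ),
      -- (i) existence, uniqueness and asymptotics of the solution of the singular problem
      MEMS.IsUniqueSolution α β γ ubar f 0 r₀ ustar ∧
      (∃ ψ : ℝ → ℝ, Tendsto ψ (𝓝[>] 0) (𝓝 0) ∧ ∀ r ∈ Ioo 0 r₀,
        r ^ MEMS.theta α β γ / MEMS.A α β γ L * (1 + ψ r) ∈ MEMS.G f β '' Ico 0 ubar ∧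
        ustar r = MEMS.Ginv f β ubar
          (r ^ MEMS.theta α β γ / MEMS.A α β γ L * (1 + ψ r))) ∧
      -- (ii) regularity at the origin
      (MEMS.IsC1AtOrigin ustar ↔
        ∃ l : ℝ, Tendsto (fun s => s ^ MEMS.theta α β γ / MEMS.G f β s) (𝓝[>] 0) (𝓝 l)) ∧
      (∀ l : ℝ, Tendsto (fun s => s ^ MEMS.theta α β γ / MEMS.G f β s) (𝓝[>] 0) (𝓝 l) →
        HasDerivWithinAt ustar
          ((1 / MEMS.A α β γ L * l) ^ (1 / MEMS.theta α β γ)) (Ici 0) 0) ∧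
      ((q = 1 ∨ (1 < q ∧ (γ - α) / β < q / (q - 1))) → ¬ MEMS.IsC1AtOrigin ustar) ∧
      -- the regular solutions `u(·, a) = U a`, for all small `a > 0`
      0 < a₀ ∧
      (∀ a ∈ Ioo 0 a₀, MEMS.IsUniqueSolution α β γ ubar f a r₀ (U a)) ∧
      -- (iii) convergence of the regular solutions
      MEMS.ConvergesC2Loc r₀ U ustar ∧
      -- (iv) intersection number
      ((q : EReal) < MEMS.qc α β γ → ∀ ρ ∈ Ioo 0 r₀,
        Tendsto (fun a => MEMS.zeroNumber (Ioo 0 ρ) (fun r => U a r - ustar r))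
          (𝓝[>] 0) (𝓝 ⊤)) := by
  have e : MEMS.Exponents α β γ := ⟨hβ, hβα, hαγ⟩
  have hg := MEMS.convexlike_g e.β_pos hubar hf_cont hf_C2 hf_zero hf_pos hG1
  have hq1 : 1 ≤ q := hg.one_le_q hG2
  have hL := MEMS.limit_ell_mem hq1
  have hell := hg.tendsto_ell hG2
  obtain ⟨L, hLq⟩ : ∃ L, L = 1 / (2 - 1 / q) := ⟨_, rfl⟩
  have hlt := MEMS.theta_mul_lt_one (α := α) (β := β) (γ := γ) (q := q)
  obtain ⟨u₁, R, K, C, c, T₁, τ, s⟩ :=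
    MEMS.exists_stable e hg hG2 hG3 (by linarith [hL.1]) hL.2
  rw [← hLq] at hL hell hlt s
  have hL0 : 0 < L := by linarith [hL.1]
  have hA := MEMS.Sol.A_pos e hL.2
  refine ⟨hq1, e.one_lt_theta, e.one_lt_tau, L, hell, hL, hA, R, s.R_pos, fun r₀ hr₀ hr₀R => ?_⟩
  obtain ⟨v, H, hv'⟩ := s.exists_singular
  have hv := hv'.restrict hr₀R
  -- A choice total in a is needed to form the family U; outside (0, u₁/2) it is irrelevant.
  have hreg : ∀ a, ∃ u F, a ∈ Ioo 0 (u₁ / 2) → MEMS.Sol α β γ ubar (MEMS.g f β) a r₀ u F := by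
    intro a
    by_cases ha : a ∈ Ioo 0 (u₁ / 2)
    · obtain ⟨u, F, h⟩ := s.exists_regular ha.1 ha.2
      exact ⟨u, F, fun _ => h.restrict hr₀R⟩
    · exact ⟨0, 0, fun h => absurd h ha⟩
  choose U F hU using hreg
  obtain ⟨hprof, heta⟩ := hv.tendsto_profile e hg hr₀ hG2 hG3 hLq hL0 hL.2
  refine ⟨v, u₁ / 2, U, ⟨hv.isSolution e hg hf_pos, fun w hw =>
    s.singular_unique hr₀R (hw.sol e hr₀ hf_pos) hv⟩, ?_,
    hv.isC1AtOrigin_iff e hg hr₀ hA hell hprof heta,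
    fun l hl => hv.hasDerivWithinAt_zero_iff.2 (hv.tendsto_quotient e hg hr₀ hprof hl),
    fun h => hv.not_isC1AtOrigin e hg hr₀ hA hell hprof heta (hlt h), by linarith [s.hu₁.1],
    fun a ha => ⟨(hU a ha).isSolution e hg hf_pos, fun w hw =>
      s.regular_unique ha.1 ha.2 (hw.sol e hr₀ hf_pos) (hU a ha) hr₀R⟩,
    s.convergesC2Loc hr₀R hv hU,
    fun hqc ρ hρ => s.tendsto_zeroNumber hr₀R hv hU (MEMS.discriminant_neg e hq1 hqc hLq) hρ⟩
  -- The error ψ is defined so that its argument of G⁻¹ is exactly G(u*(r)); the profile says that ψ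
  -- → 0.
  refine ⟨fun r => MEMS.A α β γ L * (MEMS.G f β (v r) / r ^ MEMS.theta α β γ) - 1, ?_,
    fun r hr => ?_⟩
  · have h1 := (hprof.const_mul (MEMS.A α β γ L)).sub_const 1
    rwa [mul_one_div_cancel hA.ne', sub_self] at h1
  · have h1 : r ^ MEMS.theta α β γ / MEMS.A α β γ L *
        (1 + (MEMS.A α β γ L * (MEMS.G f β (v r) / r ^ MEMS.theta α β γ) - 1))
        = MEMS.G f β (v r) := by
      have : 0 < r ^ MEMS.theta α β γ := Real.rpow_pos_of_pos hr.1 _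
      field_simp
      ring
    have hmem : v r ∈ Ico 0 ubar := ⟨(hv.mem r hr).1.le, (hv.mem r hr).2⟩
    rw [h1]
    exact ⟨⟨v r, hmem, rfl⟩, (hg.invPrim_prim hmem).symm⟩
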